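/- \textbf{Conventions.} A $C^\infty$-ring is a set $A$ with an operation $A^n\to A$ for every smooth $f:\mathbb R^n\to\mathbb R$, compatibly with projections and composition; $A$ is in particular a commutative $\mathbb R$-algebra. It is \emph{finitely generated} if it is a quotient of some $C^\infty(\mathbb R^n)$, and finitely generated and \emph{germ determined} if $A\cong C^\infty(\mathbb R^n)/I$, where every $f\notin I$ has at some point $p\in\mathbb R^n$ a germ that is not the germ at $p$ of an element of $I$. It is \emph{local} if it has a unique maximal ideal $\mathfrak m$ and $A/\mathfrak m\cong\mathbb R$. $Sp(A)$ is the set of morphisms of $C^\infty$-rings $A\to\mathbb R$ with the Zariski topology, generated by the sets $\{p : p(a)\ne0\}$, $a\in A$. An $A$-module $M$ is \emph{germ determined and locally complete} if for every family $(t_i)$ in $M$ such that each $p\in Sp(A)$ has a neighbourhood on which all germs of all but finitely many $t_i$ vanish, there is a unique $t\in M$ with $t_p=\sum_i (t_i)_p$ for all $p\in Sp(A)$ (here $t_p$ is the image of $t$ in the localization $M_p$). For a simplicial $C^\infty$-ring $A_\bullet$, $\pi_0(A_\bullet)$ is the $C^\infty$-ring $A_0/(\partial_0y\sim\partial_1y,\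 y\in A_1)$, and $\pi_k(A_\bullet)$, $k\ge1$, is the $k$-th homology of the Moore complex $(A_\bullet,\sum(-1)^i\partial_i)$, a $\pi_0(A_\bullet)$-module. A \emph{weak equivalence} is a morphism that is a weak equivalence of underlying simplicial sets. $A_\bullet$ is \emph{geometric} if $\pi_0(A_\bullet)$ is finitely generated and germ determined and each $\pi_k(A_\bullet)$, $k\ge1$, is a germ determined, locally complete $\pi_0(A_\bullet)$-module. Let $s\mathcal G$ be the category of geometric simplicial $C^\infty$-rings. A \emph{localized simplicial $C^\infty$-space} is a Hausdorff space $X$ with a sheaf $\mathcal O_\bullet$ of simplicial $C^\infty$-rings such that the sheaf $\pi_0(\mathcal O_\bullet)$ associated to $U\mapsto\pi_0(\mathcal O_\bullet(U))$ is a soft sheaf of finitely generated $C^\infty$-rings with local stalks, and such that the stalks of $\mathcal O_0$ are local $C^\infty$-rings. A morphism $(X,\mathcal O_{\bullet,X})\to(Y,\mathcal O_{\bullet,Y})$ is a continuous map $\phi:X\to Y$ with a morphism of sheaves of simplicial $C^\infty$-rings $\mathcal O_{\bullet,Y}\to\phi_*\mathcal O_{\bullet,X}$. Let $\overline{s\mathbb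 G}$ be the resulting category. For a simplicial $C^\infty$-ring $A_\bullet$ let $\mathbf{Sp}(A_\bullet)$ be the space $Sp(\pi_0(A_\bullet))$ with the sheaf of simplicial $C^\infty$-rings associated to the presheaf sending $U$ to the simplicial $C^\infty$-ring obtained from $A_\bullet$ by universally inverting all $a\in A_0$ that vanish at no point of $U$, together with their degeneracies. \textbf{Proposition.} Global sections define a functor $\Gamma:\overline{s\mathbb G}\to s\mathcal G^{op}$, the spectrum defines a functor $\mathbf{Sp}:s\mathcal G^{op}\to\overline{s\mathbb G}$, and $\Gamma$ is left adjoint to $\mathbf{Sp}$. The unit of this adjunction is an isomorphism, and its counit consists of weak equivalences: for every geometric $A_\bullet$ the morphism $A_\bullet\to\Gamma(\mathbf{Sp}(A_\bullet))$ is a weak equivalence. -/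

import Mathlib

open CategoryTheory Opposite TopologicalSpace
open scoped ContDiff

universe u v w

namespace CInfty

/-! ### Smooth functions and `C^∞`-rings -/

/-- The ring `C^∞(ℝⁿ)` of smooth real functions on `ℝⁿ`. -/
def smoothSubring (n : ℕ) : Subring ((Fin n → ℝ) → ℝ) where
  carrier := {f | ContDiff ℝ ∞ f}
  mul_mem' := fun {f g} (hf : ContDiff ℝ ∞ f) (hg : ContDiff ℝ ∞ g) => hf.mul hg
  one_mem' := (contDiff_const : ContDiff ℝ ∞ fun _ : Fin n → ℝ => (1 : ℝ))
  add_mem' := fun {f g} (hf : ContDiff ℝ ∞ f) (hg : ContDiff ℝ ∞ g) => hf.add hg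
  zero_mem' := (contDiff_const : ContDiff ℝ ∞ fun _ : Fin n → ℝ => (0 : ℝ))
  neg_mem' := fun {f} (hf : ContDiff ℝ ∞ f) => hf.neg

/-- `C^∞(ℝⁿ)`, as a type. -/
abbrev SmoothFn (n : ℕ) : Type := smoothSubring n

namespace SmoothFn

theorem contDiff {n : ℕ} (f : SmoothFn n) : ContDiff ℝ ∞ f.1 := f.2

/-- The `i`-th coordinate function on `ℝⁿ`. -/
def proj {n : ℕ} (i : Fin n) : SmoothFn n :=
  ⟨fun x => x i, (contDiff_apply ℝ ℝ i : ContDiff ℝ ∞ fun x : Fin n → ℝ => x i)⟩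

/-- The composite of `f : ℝᵐ → ℝ` with `(g₁, …, gₘ) : ℝⁿ → ℝᵐ`. -/
def comp {m n : ℕ} (f : SmoothFn m) (g : Fin m → SmoothFn n) : SmoothFn n :=
  ⟨fun x => f.1 fun i => (g i).1 x,
    (f.contDiff.comp (contDiff_pi.2 fun i => (g i).contDiff) :
      ContDiff ℝ ∞ fun x => f.1 fun i => (g i).1 x)⟩

end SmoothFn

/-- A `C^∞`-ring: a set `A` on which every smooth function `f : ℝⁿ → ℝ` acts as an `n`-ary
operation, compatibly with projections and with composition.  The underlying commutative ring
structure, given by the smooth functions `x + y` and `x y`, is carried along. -/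
class CInftyRing (A : Type u) extends CommRing A where
  op : ∀ {n : ℕ}, SmoothFn n → (Fin n → A) → A
  op_proj : ∀ {n : ℕ} (i : Fin n) (x : Fin n → A), op (SmoothFn.proj i) x = x i
  op_comp : ∀ {m n : ℕ} (f : SmoothFn m) (g : Fin m → SmoothFn n) (x : Fin n → A),
    op (SmoothFn.comp f g) x = op f fun i => op (g i) x
  op_add : ∀ a b : A, op (SmoothFn.proj 0 + SmoothFn.proj 1 : SmoothFn 2) ![a, b] = a + b
  op_mul : ∀ a b : A, op (SmoothFn.proj 0 * SmoothFn.proj 1 : SmoothFn 2) ![a, b] = a * b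


/-- The operations of a `C^∞`-ring without the ring structure, which they determine. -/
structure COps (A : Type u) where
  op : ∀ {n : ℕ}, SmoothFn n → (Fin n → A) → A
  op_proj : ∀ {n : ℕ} (i : Fin n) (x : Fin n → A), op (SmoothFn.proj i) x = x i
  op_comp : ∀ {m n : ℕ} (f : SmoothFn m) (g : Fin m → SmoothFn n) (x : Fin n → A),
    op (SmoothFn.comp f g) x = op f fun i => op (g i) x

namespace COps

variable {A : Type u} (S : COps A)

theorem comp₂ {n : ℕ} (h : SmoothFn 2) (f g : SmoothFn n) (x : Fin n → A) :
    S.op h ![S.op f x, S.op g x] = S.op (SmoothFn.comp h ![f, g]) x := by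
  rw [S.op_comp]; congr 1; funext i; fin_cases i <;> rfl

theorem comp₁ {n : ℕ} (h : SmoothFn 1) (f : SmoothFn n) (x : Fin n → A) :
    S.op h ![S.op f x] = S.op (SmoothFn.comp h ![f]) x := by
  rw [S.op_comp]; congr 1; funext i; fin_cases i; rfl

theorem comp₀ {n : ℕ} (h : SmoothFn 0) (x : Fin n → A) :
    S.op h ![] = S.op (SmoothFn.comp h ![]) x := by
  rw [S.op_comp]; congr 1; funext i; exact i.elim0

theorem add' {n : ℕ} (f g : SmoothFn n) (x : Fin n → A) :
    S.op (SmoothFn.proj 0 + SmoothFn.proj 1 : SmoothFn 2) ![S.op f x, S.op g x] =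
      S.op (f + g) x := S.comp₂ _ f g x

theorem mul' {n : ℕ} (f g : SmoothFn n) (x : Fin n → A) :
    S.op (SmoothFn.proj 0 * SmoothFn.proj 1 : SmoothFn 2) ![S.op f x, S.op g x] =
      S.op (f * g) x := S.comp₂ _ f g x

theorem neg' {n : ℕ} (f : SmoothFn n) (x : Fin n → A) :
    S.op (-SmoothFn.proj 0 : SmoothFn 1) ![S.op f x] = S.op (-f) x := S.comp₁ _ f x

theorem zero' {n : ℕ} (x : Fin n → A) : S.op (0 : SmoothFn 0) ![] = S.op 0 x := S.comp₀ _ x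

theorem one' {n : ℕ} (x : Fin n → A) : S.op (1 : SmoothFn 0) ![] = S.op 1 x := S.comp₀ _ x

/-- The commutative ring structure determined by the operations. -/
@[reducible] def toCommRing : CommRing A :=
  letI : Add A := ⟨fun a b => S.op (SmoothFn.proj 0 + SmoothFn.proj 1 : SmoothFn 2) ![a, b]⟩
  letI : Mul A := ⟨fun a b => S.op (SmoothFn.proj 0 * SmoothFn.proj 1 : SmoothFn 2) ![a, b]⟩
  letI : Neg A := ⟨fun a => S.op (-SmoothFn.proj 0 : SmoothFn 1) ![a]⟩
  letI : Zero A := ⟨S.op (0 : SmoothFn 0) ![]⟩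
  letI : One A := ⟨S.op (1 : SmoothFn 0) ![]⟩
  have ha : ∀ {n : ℕ} (f g : SmoothFn n) (x : Fin n → A), S.op f x + S.op g x = S.op (f + g) x :=
    fun f g x => S.add' f g x
  have hm : ∀ {n : ℕ} (f g : SmoothFn n) (x : Fin n → A), S.op f x * S.op g x = S.op (f * g) x :=
    fun f g x => S.mul' f g x
  have hn : ∀ {n : ℕ} (f : SmoothFn n) (x : Fin n → A), -S.op f x = S.op (-f) x :=
    fun f x => S.neg' f x
  have hz : ∀ {n : ℕ} (x : Fin n → A), (0 : A) = S.op 0 x := fun x => S.zero' x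
  have ho : ∀ {n : ℕ} (x : Fin n → A), (1 : A) = S.op 1 x := fun x => S.one' x
  have e₃ : ∀ a b c : A, ∃ (x : Fin 3 → A), a = S.op (SmoothFn.proj 0) x ∧
      b = S.op (SmoothFn.proj 1) x ∧ c = S.op (SmoothFn.proj 2) x := fun a b c =>
    ⟨![a, b, c], (S.op_proj 0 ![a, b, c]).symm, (S.op_proj 1 ![a, b, c]).symm,
      (S.op_proj 2 ![a, b, c]).symm⟩
  { add_assoc := fun a b c => by
      obtain ⟨x, h₁, h₂, h₃⟩ := e₃ a b c
      rw [h₁, h₂, h₃, ha, ha, ha, ha, add_assoc]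
    zero_add := fun a => by
      obtain ⟨x, h₁, -, -⟩ := e₃ a a a
      rw [h₁, hz x, ha, zero_add]
    add_zero := fun a => by
      obtain ⟨x, h₁, -, -⟩ := e₃ a a a
      rw [h₁, hz x, ha, add_zero]
    add_comm := fun a b => by
      obtain ⟨x, h₁, h₂, -⟩ := e₃ a b a
      rw [h₁, h₂, ha, ha, add_comm]
    mul_assoc := fun a b c => by
      obtain ⟨x, h₁, h₂, h₃⟩ := e₃ a b c
      rw [h₁, h₂, h₃, hm, hm, hm, hm, mul_assoc]
    one_mul := fun a => by
      obtain ⟨x, h₁, -, -⟩ := e₃ a a a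
      rw [h₁, ho x, hm, one_mul]
    mul_one := fun a => by
      obtain ⟨x, h₁, -, -⟩ := e₃ a a a
      rw [h₁, ho x, hm, mul_one]
    mul_comm := fun a b => by
      obtain ⟨x, h₁, h₂, -⟩ := e₃ a b a
      rw [h₁, h₂, hm, hm, mul_comm]
    left_distrib := fun a b c => by
      obtain ⟨x, h₁, h₂, h₃⟩ := e₃ a b c
      rw [h₁, h₂, h₃, ha, hm, hm, hm, ha, mul_add]
    right_distrib := fun a b c => by
      obtain ⟨x, h₁, h₂, h₃⟩ := e₃ a b c
      rw [h₁, h₂, h₃, ha, hm, hm, hm, ha, add_mul]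
    zero_mul := fun a => by
      obtain ⟨x, h₁, -, -⟩ := e₃ a a a
      rw [h₁, hz x, hm, zero_mul]
    mul_zero := fun a => by
      obtain ⟨x, h₁, -, -⟩ := e₃ a a a
      rw [h₁, hz x, hm, mul_zero]
    neg_add_cancel := fun a => by
      obtain ⟨x, h₁, -, -⟩ := e₃ a a a
      rw [h₁, hn, hz x, ha, neg_add_cancel]
    nsmul := nsmulRec
    zsmul := zsmulRec }

/-- The `C^∞`-ring determined by the operations. -/
@[reducible] def toCInftyRing : CInftyRing A :=
  { S.toCommRing with
    op := S.op
    op_proj := S.op_proj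
    op_comp := S.op_comp
    op_add := fun _ _ => rfl
    op_mul := fun _ _ => rfl }

end COps

/-- The operations of a `C^∞`-ring. -/
def CInftyRing.ops (A : Type u) [CInftyRing A] : COps A where
  op := CInftyRing.op
  op_proj := CInftyRing.op_proj
  op_comp := CInftyRing.op_comp

instance : CInftyRing ℝ where
  op f x := f.1 x
  op_proj _ _ := rfl
  op_comp _ _ _ := rfl
  op_add _ _ := rfl
  op_mul _ _ := rfl

instance (n : ℕ) : CInftyRing (SmoothFn n) where
  op := SmoothFn.comp
  op_proj _ _ := rfl
  op_comp _ _ _ := rfl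
  op_add _ _ := rfl
  op_mul _ _ := rfl

theorem op_zero {A : Type u} [CInftyRing A] {n : ℕ} (x : Fin n → A) :
    CInftyRing.op (0 : SmoothFn n) x = 0 := by
  have h := (CInftyRing.ops A).add' 0 0 x
  rw [add_zero] at h
  have h' := CInftyRing.op_add (CInftyRing.op (0 : SmoothFn n) x) (CInftyRing.op (0 : SmoothFn n) x)
  exact left_eq_add.1 (h.symm.trans h')

theorem op_one {A : Type u} [CInftyRing A] {n : ℕ} (x : Fin n → A) :
    CInftyRing.op (1 : SmoothFn n) x = 1 := by
  have key : ∀ a : A, CInftyRing.op (1 : SmoothFn 1) ![a] * a = a := fun a => by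
    have h := (CInftyRing.ops A).mul' 1 (SmoothFn.proj 0) ![a]
    have h' := CInftyRing.op_mul (CInftyRing.op (1 : SmoothFn 1) ![a])
      (CInftyRing.op (SmoothFn.proj 0 : SmoothFn 1) ![a])
    rw [one_mul] at h
    have h'' := h'.symm.trans h
    have hp : CInftyRing.op (SmoothFn.proj 0 : SmoothFn 1) ![a] = a := CInftyRing.op_proj 0 ![a]
    change _ * CInftyRing.op (SmoothFn.proj 0 : SmoothFn 1) ![a] =
      CInftyRing.op (SmoothFn.proj 0 : SmoothFn 1) ![a] at h''
    rwa [hp] at h''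
  have h1 := key 1
  rw [mul_one] at h1
  rw [← h1]
  exact ((CInftyRing.ops A).one' x).symm.trans ((CInftyRing.ops A).one' ![(1 : A)])

/-- A morphism of `C^∞`-rings: a map commuting with all the operations. -/
@[ext]
structure CHom (A : Type u) (B : Type v) [CInftyRing A] [CInftyRing B] where
  toFun : A → B
  map_op : ∀ {n : ℕ} (f : SmoothFn n) (x : Fin n → A),
    toFun (CInftyRing.op f x) = CInftyRing.op f fun i => toFun (x i)

namespace CHom

variable {A : Type u} {B : Type v} {C : Type w} [CInftyRing A] [CInftyRing B] [CInftyRing C]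

instance : FunLike (CHom A B) A B where
  coe := toFun
  coe_injective _ _ h := CHom.ext h

instance : RingHomClass (CHom A B) A B where
  map_add f a b := by
    have h := f.map_op (SmoothFn.proj 0 + SmoothFn.proj 1 : SmoothFn 2) ![a, b]
    have e : (fun i => f.toFun ((![a, b] : Fin 2 → A) i)) = ![f.toFun a, f.toFun b] := by
      funext i; fin_cases i <;> rfl
    rw [e, CInftyRing.op_add, CInftyRing.op_add] at h
    exact h
  map_mul f a b := by
    have h := f.map_op (SmoothFn.proj 0 * SmoothFn.proj 1 : SmoothFn 2) ![a, b]
    have e : (fun i => f.toFun ((![a, b] : Fin 2 → A) i)) = ![f.toFun a, f.toFun b] := by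
      funext i; fin_cases i <;> rfl
    rw [e, CInftyRing.op_mul, CInftyRing.op_mul] at h
    exact h
  map_zero f := by
    have h := f.map_op (0 : SmoothFn 0) ![]
    rwa [op_zero, op_zero] at h
  map_one f := by
    have h := f.map_op (1 : SmoothFn 0) ![]
    rwa [op_one, op_one] at h

theorem map_op' (f : CHom A B) {n : ℕ} (h : SmoothFn n) (x : Fin n → A) :
    f (CInftyRing.op h x) = CInftyRing.op h fun i => f (x i) := f.map_op h x

theorem hext {f g : CHom A B} (h : ∀ a, f a = g a) : f = g := CHom.ext (funext h)

/-- The identity. -/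
def id (A : Type u) [CInftyRing A] : CHom A A := ⟨fun a => a, fun _ _ => rfl⟩

/-- Composition. -/
def comp (g : CHom B C) (f : CHom A B) : CHom A C :=
  ⟨fun a => g (f a), fun h x => by rw [f.map_op', g.map_op']⟩

/-- The underlying ring homomorphism. -/
def toRingHom (f : CHom A B) : A →+* B := (f : A →+* B)

end CHom

/-- The category of `C^∞`-rings. -/
structure CRing where
  of ::
  carrier : Type u
  [str : CInftyRing carrier]

attribute [instance] CRing.str

namespace CRing

instance : CoeSort CRing.{u} (Type u) := ⟨CRing.carrier⟩

/-- Morphisms of `CRing`. -/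
@[ext]
structure Hom (A B : CRing.{u}) where
  hom : CHom A B

instance : Category CRing.{u} where
  Hom A B := Hom A B
  id A := ⟨CHom.id A⟩
  comp f g := ⟨g.hom.comp f.hom⟩

instance : ConcreteCategory CRing.{u} (fun A B => CHom A B) where
  hom f := f.hom
  ofHom f := ⟨f⟩

theorem hom_ext' {A B : CRing.{u}} {f g : A ⟶ B} (h : ∀ a : A, f a = g a) : f = g :=
  Hom.ext (CHom.hext h)

end CRing


/-! ### Finite generation, germ determination, local rings, spectra -/

/-- `A` is finitely generated: a quotient of some `C^∞(ℝⁿ)`. -/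
def IsFinitelyGenerated (A : Type u) [CInftyRing A] : Prop :=
  ∃ (n : ℕ) (φ : CHom (SmoothFn n) A), Function.Surjective φ

/-- An ideal `I` of `C^∞(ℝⁿ)` is germ determined if every `f ∉ I` has, at some point `p`, a germ
that is not the germ at `p` of an element of `I`. -/
def IsGermDeterminedIdeal {n : ℕ} (I : Ideal (SmoothFn n)) : Prop :=
  ∀ f : SmoothFn n, f ∉ I → ∃ p : Fin n → ℝ, ∀ g ∈ I, ¬ f.1 =ᶠ[nhds p] g.1

/-- `A` is (finitely generated and) germ determined: it is the quotient of some `C^∞(ℝⁿ)` by a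
germ determined ideal. -/
def IsGermDetermined (A : Type u) [CInftyRing A] : Prop :=
  ∃ (n : ℕ) (φ : CHom (SmoothFn n) A), Function.Surjective φ ∧
    IsGermDeterminedIdeal (RingHom.ker φ.toRingHom)

/-- `A` is a local `C^∞`-ring: it has a unique maximal ideal, and the quotient by that ideal is
`ℝ`, as a `C^∞`-ring. -/
def IsLocalCRing (A : Type u) [CInftyRing A] : Prop :=
  ∃ 𝔪 : Ideal A, (∀ I : Ideal A, I.IsMaximal ↔ I = 𝔪) ∧
    ∃ ev : CHom A ℝ, Function.Surjective ev ∧ RingHom.ker ev.toRingHom = 𝔪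

/-- The points of the spectrum of `A`: the morphisms of `C^∞`-rings `A → ℝ`. -/
def Sp (A : Type u) [CInftyRing A] : Type u := CHom A ℝ

namespace Sp

variable {A : Type u} [CInftyRing A]

/-- The value `p(a)` of `a` at the point `p`. -/
def eval (p : Sp A) : CHom A ℝ := p

/-- The basic open set `U_a` of the points at which `a` does not vanish. -/
def basicOpen (a : A) : Set (Sp A) := {p | p.eval a ≠ 0}

/-- The Zariski topology. -/
instance : TopologicalSpace (Sp A) := generateFrom (Set.range basicOpen)

theorem isOpen_basicOpen (a : A) : IsOpen (basicOpen a) :=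
  isOpen_generateFrom_of_mem ⟨a, rfl⟩

/-- The map of spectra induced by a morphism. -/
def map {B : Type u} [CInftyRing B] (f : CHom A B) (q : Sp B) : Sp A := CHom.comp q.eval f

theorem continuous_map {B : Type u} [CInftyRing B] (f : CHom A B) : Continuous (map f) := by
  refine continuous_generateFrom_iff.2 ?_
  rintro _ ⟨a, rfl⟩
  exact isOpen_basicOpen (f a)

/-- The elements of `A` that do not vanish at `p`. -/
def nonvanishing (p : Sp A) : Submonoid A where
  carrier := {a | p.eval a ≠ 0}
  one_mem' := by simp
  mul_mem' := fun {a b} ha hb => by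
    simp only [Set.mem_ofPred_eq, map_mul] at *
    exact mul_ne_zero ha hb

end Sp

/-- The germ at `p ∈ Sp(A)` of an element of an `A`-module `M`: its image in the localization
of `M` at `p`. -/
noncomputable def moduleGerm {A : Type u} [CInftyRing A] {M : Type v} [AddCommGroup M] [Module A M]
    (p : Sp A) : M →ₗ[A] LocalizedModule p.nonvanishing M :=
  LocalizedModule.mkLinearMap p.nonvanishing M

/-- The `A`-module `M` is germ determined and locally complete: for every locally finite family
`t` in `M` there is a unique `m` in `M` whose germ at each `p` is the sum of the germs of the
members of the family. -/
def IsGermDeterminedLocallyComplete (A : Type u) [CInftyRing A] (M : Type u) [AddCommGroup M]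
    [Module A M] : Prop :=
  ∀ (ι : Type u) (t : ι → M),
    (∀ p : Sp A, ∃ U : Set (Sp A), IsOpen U ∧ p ∈ U ∧
      {i | ∃ q ∈ U, moduleGerm q (t i) ≠ 0}.Finite) →
    ∃! m : M, ∀ p : Sp A, moduleGerm p m = ∑ᶠ i, moduleGerm p (t i)

/-! ### Smooth localization -/

namespace Loc

variable (A : Type u) [CInftyRing A] (T : Set A)

/-- Formal smooth expressions in the elements of `A` and in inverses of the elements of `T`. -/
inductive Term : Type u
  | of (a : A) : Term
  | inv (a : T) : Term
  | op (n : ℕ) (f : SmoothFn n) (t : Fin n → Term) : Term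

/-- The smallest congruence on formal expressions for which the quotient is a `C^∞`-ring, the map
from `A` is a morphism, and `inv a` is an inverse of `a`. -/
inductive Rel : Term A T → Term A T → Prop
  | refl (t) : Rel t t
  | symm (s t) : Rel s t → Rel t s
  | trans (r s t) : Rel r s → Rel s t → Rel r t
  | op (n : ℕ) (f : SmoothFn n) (s t : Fin n → Term A T) :
      (∀ i, Rel (s i) (t i)) → Rel (.op n f s) (.op n f t)
  | op_proj (n : ℕ) (i : Fin n) (t : Fin n → Term A T) : Rel (.op n (SmoothFn.proj i) t) (t i)
  | op_comp (m n : ℕ) (f : SmoothFn m) (g : Fin m → SmoothFn n) (t : Fin n → Term A T) :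
      Rel (.op n (SmoothFn.comp f g) t) (.op m f fun i => .op n (g i) t)
  | of_op (n : ℕ) (f : SmoothFn n) (x : Fin n → A) :
      Rel (.of (CInftyRing.op f x)) (.op n f fun i => .of (x i))
  | mul_inv (a : T) :
      Rel (.op 2 (SmoothFn.proj 0 * SmoothFn.proj 1) ![.of a, .inv a]) (.of 1)

/-- The congruence as a setoid. -/
def setoid : Setoid (Term A T) := ⟨Rel A T, Rel.refl, Rel.symm _ _, Rel.trans _ _ _⟩

end Loc

/-- The smooth localization `A{T⁻¹}`: the `C^∞`-ring obtained from `A` by universally inverting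
the elements of `T`. -/
def Loc (A : Type u) [CInftyRing A] (T : Set A) : Type u := _root_.Quotient (Loc.setoid A T)

namespace Loc

variable {A : Type u} [CInftyRing A] {T : Set A}

/-- The class of a formal expression. -/
def mk (t : Term A T) : Loc A T := _root_.Quotient.mk (setoid A T) t

theorem mk_eq {s t : Term A T} (h : Rel A T s t) : mk s = mk t := _root_.Quotient.sound h

/-- The operations on the localization. -/
noncomputable def opFun {n : ℕ} (f : SmoothFn n) (x : Fin n → Loc A T) : Loc A T :=
  mk (.op n f fun i => (x i).out)

theorem opFun_mk {n : ℕ} (f : SmoothFn n) (t : Fin n → Term A T) :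
    opFun f (fun i => mk (t i)) = mk (.op n f t) :=
  mk_eq (Rel.op _ _ _ _ fun i => _root_.Quotient.exact (s := setoid A T) (_root_.Quotient.out_eq (mk (t i))))

theorem exists_rep {n : ℕ} (x : Fin n → Loc A T) : ∃ t : Fin n → Term A T, x = fun i => mk (t i) :=
  ⟨fun i => (x i).out, funext fun i => (_root_.Quotient.out_eq (x i)).symm⟩

/-- The operations of the `C^∞`-ring `A{T⁻¹}`. -/
noncomputable def cops : COps (Loc A T) where
  op := opFun
  op_proj i x := by
    obtain ⟨t, rfl⟩ := exists_rep x
    rw [opFun_mk]; exact mk_eq (Rel.op_proj _ _ _)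
  op_comp f g x := by
    obtain ⟨t, rfl⟩ := exists_rep x
    rw [opFun_mk, mk_eq (Rel.op_comp _ _ _ _ _), ← opFun_mk]
    congr 1; funext i; exact (opFun_mk _ _).symm

noncomputable instance : CInftyRing (Loc A T) := cops.toCInftyRing

theorem op_mk {n : ℕ} (f : SmoothFn n) (t : Fin n → Term A T) :
    CInftyRing.op f (fun i => mk (t i)) = mk (.op n f t) := opFun_mk f t

variable (T) in
/-- The localization morphism `A → A{T⁻¹}`. -/
noncomputable def of : CHom A (Loc A T) where
  toFun a := mk (.of a)
  map_op _ _ := (mk_eq (Rel.of_op _ _ _)).trans (op_mk _ _).symm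

theorem of_mul_inv (a : T) : of T a * mk (.inv a) = 1 := by
  have h := CInftyRing.op_mul (of T a) (mk (.inv a))
  have e : (![of T a, mk (.inv a)] : Fin 2 → Loc A T) =
      fun i => mk ((![.of a, .inv a] : Fin 2 → Term A T) i) := by
    funext i; fin_cases i <;> rfl
  rw [← h, e, op_mk, mk_eq (Rel.mul_inv a)]
  exact map_one (of T)

theorem isUnit_of {a : A} (ha : a ∈ T) : IsUnit (of T a) :=
  IsUnit.of_mul_eq_one _ (of_mul_inv ⟨a, ha⟩)

section lift

variable {B : Type v} [CInftyRing B] (f : CHom A B) (hf : ∀ a ∈ T, IsUnit (f a))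

/-- The value of a formal expression in a `C^∞`-ring over `A` in which `T` is inverted. -/
noncomputable def liftTerm : Term A T → B
  | .of a => f a
  | .inv a => Ring.inverse (f a)
  | .op _ g t => CInftyRing.op g fun i => liftTerm (t i)

theorem liftTerm_rel (hf : ∀ a ∈ T, IsUnit (f a)) {s t : Term A T} (h : Rel A T s t) :
    liftTerm f s = liftTerm f t := by
  induction h with
  | refl t => rfl
  | symm s t _ ih => exact ih.symm
  | trans r s t _ _ ih ih' => exact ih.trans ih'
  | op n g s t _ ih => simp only [liftTerm, ih]
  | op_proj n i t => exact CInftyRing.op_proj _ _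
  | op_comp m n g h t => exact CInftyRing.op_comp _ _ _
  | of_op n g x => exact f.map_op _ _
  | mul_inv a =>
    have e : (fun i => liftTerm f ((![.of a, .inv a] : Fin 2 → Term A T) i)) =
        ![f a, Ring.inverse (f a)] := by
      funext i; fin_cases i <;> rfl
    simp only [liftTerm]
    rw [e, CInftyRing.op_mul, Ring.mul_inverse_cancel _ (hf a a.2), map_one]

/-- The universal property of the localization: existence. -/
noncomputable def lift (hf : ∀ a ∈ T, IsUnit (f a)) : CHom (Loc A T) B where
  toFun := _root_.Quotient.lift (liftTerm f) fun _ _ h => liftTerm_rel f hf h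
  map_op g x := by
    obtain ⟨t, rfl⟩ := exists_rep x
    rw [op_mk]; rfl

theorem lift_of (a : A) : lift f hf (of T a) = f a := rfl

/-- The universal property of the localization: uniqueness. -/
theorem hom_ext {g h : CHom (Loc A T) B} (H : ∀ a, g (of T a) = h (of T a)) : g = h := by
  refine CHom.hext fun x => ?_
  obtain ⟨t, rfl⟩ := _root_.Quotient.exists_rep x
  change g (mk t) = h (mk t)
  induction t with
  | of a => exact H a
  | inv a =>
    have h₁ : h (of T a) * g (mk (.inv a)) = 1 := by
      rw [← H, ← map_mul, of_mul_inv, map_one]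
    have h₂ : h (of T a) * h (mk (.inv a)) = 1 := by rw [← map_mul, of_mul_inv, map_one]
    have hu : IsUnit (h (of T a)) := IsUnit.of_mul_eq_one _ h₂
    exact hu.mul_left_cancel (h₁.trans h₂.symm)
  | op n f t ih =>
    rw [← op_mk, g.map_op', h.map_op']
    congr 1; funext i; exact ih i

end lift

/-- The morphism of localizations induced by a morphism carrying `T` into `T'`. -/
noncomputable def map {B : Type v} [CInftyRing B] {T' : Set B} (f : CHom A B)
    (h : ∀ a ∈ T, f a ∈ T') : CHom (Loc A T) (Loc B T') :=
  lift ((of T').comp f) fun a ha => isUnit_of (h a ha)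

theorem map_of {B : Type v} [CInftyRing B] {T' : Set B} (f : CHom A B)
    (h : ∀ a ∈ T, f a ∈ T') (a : A) : map (T' := T') f h (of T a) = of T' (f a) := rfl

end Loc

/-! ### Simplicial `C^∞`-rings and their homotopy -/

/-- Simplicial `C^∞`-rings. -/
abbrev SCRing : Type (u + 1) := SimplicialObject CRing.{u}

/-- Rearrangement of a double sum over faces and degeneracies. -/
theorem sum_shuffle {M : Type*} [AddCommMonoid M] (n : ℕ) (F : Fin (n + 2) → Fin (n + 1) → M) :
    ∑ i, ∑ j, F i j = ∑ j : Fin (n + 1), F j.castSucc j + ∑ j : Fin (n + 1), F j.succ j +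
      ∑ i : Fin (n + 1), ∑ j : Fin n,
        if i ≤ j.castSucc then F i.castSucc j.succ else F i.succ j.castSucc := by
  have h : ∀ i j, F i j = (if i = j.castSucc then F i j else 0) + (if i = j.succ then F i j else 0)
      + (if i < j.castSucc then F i j else 0) + (if j.succ < i then F i j else 0) := by
    intro i j
    simp only [Fin.ext_iff, Fin.lt_def, Fin.val_castSucc, Fin.val_succ]
    split_ifs <;> first | omega | simp
  rw [Finset.sum_congr rfl fun i _ => Finset.sum_congr rfl fun j _ => h i j]
  simp only [Finset.sum_add_distrib]
  have h₁ : ∑ i : Fin (n + 2), ∑ j : Fin (n + 1), (if i = j.castSucc then F i j else 0) =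
      ∑ j : Fin (n + 1), F j.castSucc j := by rw [Finset.sum_comm]; simp
  have h₂ : ∑ i : Fin (n + 2), ∑ j : Fin (n + 1), (if i = j.succ then F i j else 0) =
      ∑ j : Fin (n + 1), F j.succ j := by rw [Finset.sum_comm]; simp
  have h₃ : ∑ i : Fin (n + 2), ∑ j : Fin (n + 1), (if i < j.castSucc then F i j else 0) =
      ∑ i : Fin (n + 1), ∑ j : Fin n, if i ≤ j.castSucc then F i.castSucc j.succ else 0 := by
    rw [Fin.sum_univ_castSucc, Finset.sum_eq_zero (s := Finset.univ) (f := fun j : Fin (n + 1) =>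
      if Fin.last (n + 1) < j.castSucc then F (Fin.last (n + 1)) j else 0)
      (fun j _ => if_neg (Fin.le_last _).not_gt), add_zero]
    refine Finset.sum_congr rfl fun i _ => ?_
    rw [Fin.sum_univ_succ, if_neg (show ¬ i.castSucc < Fin.castSucc 0 from
      (Fin.zero_le i.castSucc).not_gt), zero_add]
    refine Finset.sum_congr rfl fun j _ => if_congr ?_ rfl rfl
    rw [Fin.lt_def, Fin.le_def, Fin.val_castSucc, Fin.val_castSucc, Fin.val_succ, Fin.val_castSucc,
      Nat.lt_succ_iff]
  have h₄ : ∑ i : Fin (n + 2), ∑ j : Fin (n + 1), (if j.succ < i then F i j else 0) =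
      ∑ i : Fin (n + 1), ∑ j : Fin n, if i ≤ j.castSucc then 0 else F i.succ j.castSucc := by
    rw [Fin.sum_univ_succ, Finset.sum_eq_zero (s := Finset.univ) (f := fun j : Fin (n + 1) =>
      if j.succ < 0 then F 0 j else 0) (fun j _ => if_neg (Fin.zero_le _).not_gt), zero_add]
    refine Finset.sum_congr rfl fun i _ => ?_
    rw [Fin.sum_univ_castSucc, if_neg (Fin.succ_le_succ_iff.2 (Fin.le_last i)).not_gt, add_zero]
    refine Finset.sum_congr rfl fun j _ => ?_
    by_cases h : i ≤ j.castSucc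
    · rw [if_pos h, if_neg (Fin.succ_le_succ_iff.2 h).not_gt]
    · rw [if_neg h, if_pos (Fin.succ_lt_succ_iff.2 (not_le.1 h))]
  rw [h₁, h₂, h₃, h₄, add_assoc]
  congr 1
  rw [← Finset.sum_add_distrib]
  refine Finset.sum_congr rfl fun i _ => ?_
  rw [← Finset.sum_add_distrib]
  refine Finset.sum_congr rfl fun j _ => ?_
  split_ifs <;> simp

namespace SCRing

/-- The `C^∞`-ring of `k`-simplices. -/
abbrev lev (A : SCRing.{u}) (k : ℕ) : CRing.{u} := A.obj (op (SimplexCategory.mk k))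

/-- The structure morphism `A_k → A_m` of a map `[m] → [k]`. -/
abbrev str (A : SCRing.{u}) {m k : ℕ} (θ : SimplexCategory.mk m ⟶ SimplexCategory.mk k) :
    CHom (A.lev k) (A.lev m) := (A.map θ.op).hom

theorem str_str (A : SCRing.{u}) {l m k : ℕ} (η : SimplexCategory.mk l ⟶ SimplexCategory.mk m)
    (θ : SimplexCategory.mk m ⟶ SimplexCategory.mk k) (x : A.lev k) :
    A.str η (A.str θ x) = A.str (η ≫ θ) x := by
  simp only [str, op_comp, A.map_comp]; rfl

theorem str_id (A : SCRing.{u}) {k : ℕ} (x : A.lev k) : A.str (𝟙 _) x = x := by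
  simp only [str, op_id, A.map_id]; rfl

theorem map_str {A B : SCRing.{u}} (f : A ⟶ B) {m k : ℕ}
    (θ : SimplexCategory.mk m ⟶ SimplexCategory.mk k) (x : A.lev k) :
    f.app _ (A.str θ x) = B.str θ (f.app _ x) :=
  ConcreteCategory.congr_hom (f.naturality θ.op) x

/-- The `i`-th face map. -/
abbrev d (A : SCRing.{u}) {k : ℕ} (i : Fin (k + 2)) : CHom (A.lev (k + 1)) (A.lev k) :=
  A.str (SimplexCategory.δ i)

/-- The `i`-th degeneracy map. -/
abbrev s (A : SCRing.{u}) {k : ℕ} (i : Fin (k + 1)) : CHom (A.lev k) (A.lev (k + 1)) :=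
  A.str (SimplexCategory.σ i)

/-- The total degeneracy `A₀ → A_k`. -/
abbrev deg (A : SCRing.{u}) (k : ℕ) : CHom (A.lev 0) (A.lev k) :=
  A.str (SimplexCategory.const _ (SimplexCategory.mk 0) 0)

theorem str_deg (A : SCRing.{u}) {m k : ℕ} (θ : SimplexCategory.mk m ⟶ SimplexCategory.mk k)
    (a : A.lev 0) : A.str θ (A.deg k a) = A.deg m a := by
  rw [str_str]; rfl

theorem deg_zero (A : SCRing.{u}) (a : A.lev 0) : A.deg 0 a = a := by
  have : SimplexCategory.const (SimplexCategory.mk 0) (SimplexCategory.mk 0) 0 = 𝟙 _ :=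
    Subsingleton.elim _ _
  rw [deg, this, str_id]

/-! #### The `C^∞`-ring `π₀` -/

theorem d_s_zero (A : SCRing.{u}) (i : Fin 2) (a : A.lev 0) : A.d i (A.s 0 a) = a := by
  rw [d, s, str_str]
  have : SimplexCategory.δ i ≫ SimplexCategory.σ (0 : Fin 1) = 𝟙 (SimplexCategory.mk 0) :=
    Subsingleton.elim _ _
  rw [this, str_id]

/-- The ideal of `A₀` consisting of the differences `∂₀ y - ∂₁ y` for `y ∈ A₁`. -/
def piZeroIdeal (A : SCRing.{u}) : Ideal (A.lev 0) where
  carrier := {a | ∃ y : A.lev 1, A.d 0 y - A.d 1 y = a}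
  zero_mem' := ⟨0, by simp⟩
  add_mem' := by
    rintro _ _ ⟨y, rfl⟩ ⟨z, rfl⟩
    exact ⟨y + z, by rw [map_add, map_add]; ring⟩
  smul_mem' := by
    rintro c _ ⟨y, rfl⟩
    exact ⟨A.s 0 c * y, by rw [map_mul, map_mul, d_s_zero, d_s_zero, smul_eq_mul]; ring⟩

theorem mem_piZeroIdeal (A : SCRing.{u}) {a : A.lev 0} :
    a ∈ A.piZeroIdeal ↔ ∃ y : A.lev 1, A.d 0 y - A.d 1 y = a := Iff.rfl

/-- Elements congruent modulo the ideal are the two faces of a `1`-simplex. -/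
theorem exists_faces (A : SCRing.{u}) {a b : A.lev 0} (h : a - b ∈ A.piZeroIdeal) :
    ∃ y : A.lev 1, A.d 0 y = a ∧ A.d 1 y = b := by
  obtain ⟨y, hy⟩ := h
  refine ⟨y - A.s 0 (A.d 1 y) + A.s 0 b, ?_, ?_⟩
  · rw [map_add, map_sub, d_s_zero, d_s_zero, hy]; ring
  · rw [map_add, map_sub, d_s_zero, d_s_zero]; ring

theorem op_sub_op_mem (A : SCRing.{u}) {n : ℕ} (f : SmoothFn n) (x y : Fin n → A.lev 0)
    (h : ∀ i, x i - y i ∈ A.piZeroIdeal) :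
    CInftyRing.op f x - CInftyRing.op f y ∈ A.piZeroIdeal := by
  choose z hz hz' using fun i => A.exists_faces (h i)
  refine ⟨CInftyRing.op f z, ?_⟩
  rw [CHom.map_op', CHom.map_op']
  simp only [hz, hz']

/-- `π₀(A)`: the quotient of `A₀` by the relation `∂₀ y ∼ ∂₁ y` for `y ∈ A₁`. -/
def PiZero (A : SCRing.{u}) : Type u := A.lev 0 ⧸ A.piZeroIdeal

noncomputable instance (A : SCRing.{u}) : CommRing A.PiZero :=
  inferInstanceAs (CommRing (A.lev 0 ⧸ A.piZeroIdeal))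

/-- The quotient map `A₀ → π₀(A)`. -/
def toPiZero (A : SCRing.{u}) : A.lev 0 →+* A.PiZero := Ideal.Quotient.mk A.piZeroIdeal

theorem toPiZero_surjective (A : SCRing.{u}) : Function.Surjective A.toPiZero :=
  Ideal.Quotient.mk_surjective

theorem toPiZero_eq (A : SCRing.{u}) {a b : A.lev 0} :
    A.toPiZero a = A.toPiZero b ↔ a - b ∈ A.piZeroIdeal := Ideal.Quotient.eq

/-- The operations of the quotient `C^∞`-ring `π₀(A)`. -/
noncomputable def piZeroOp (A : SCRing.{u}) {n : ℕ} (f : SmoothFn n) (x : Fin n → A.PiZero) :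
    A.PiZero :=
  A.toPiZero (CInftyRing.op f fun i => Function.surjInv A.toPiZero_surjective (x i))

theorem piZeroOp_mk (A : SCRing.{u}) {n : ℕ} (f : SmoothFn n) (x : Fin n → A.lev 0) :
    A.piZeroOp f (fun i => A.toPiZero (x i)) = A.toPiZero (CInftyRing.op f x) := by
  refine A.toPiZero_eq.2 (A.op_sub_op_mem f _ _ fun i => A.toPiZero_eq.1 ?_)
  exact Function.surjInv_eq A.toPiZero_surjective _

theorem exists_rep (A : SCRing.{u}) {n : ℕ} (x : Fin n → A.PiZero) :
    ∃ t : Fin n → A.lev 0, x = fun i => A.toPiZero (t i) :=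
  ⟨fun i => Function.surjInv A.toPiZero_surjective (x i),
    funext fun _ => (Function.surjInv_eq A.toPiZero_surjective _).symm⟩

noncomputable instance (A : SCRing.{u}) : CInftyRing A.PiZero where
  op := A.piZeroOp
  op_proj i x := by
    obtain ⟨t, rfl⟩ := A.exists_rep x
    rw [piZeroOp_mk, CInftyRing.op_proj]
  op_comp f g x := by
    obtain ⟨t, rfl⟩ := A.exists_rep x
    simp only [piZeroOp_mk, CInftyRing.op_comp]
  op_add a b := by
    obtain ⟨a, rfl⟩ := A.toPiZero_surjective a
    obtain ⟨b, rfl⟩ := A.toPiZero_surjective b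
    have e : (![A.toPiZero a, A.toPiZero b] : Fin 2 → A.PiZero) =
        fun i => A.toPiZero ((![a, b] : Fin 2 → A.lev 0) i) := by
      funext i; fin_cases i <;> rfl
    rw [e, piZeroOp_mk, CInftyRing.op_add, map_add]
  op_mul a b := by
    obtain ⟨a, rfl⟩ := A.toPiZero_surjective a
    obtain ⟨b, rfl⟩ := A.toPiZero_surjective b
    have e : (![A.toPiZero a, A.toPiZero b] : Fin 2 → A.PiZero) =
        fun i => A.toPiZero ((![a, b] : Fin 2 → A.lev 0) i) := by
      funext i; fin_cases i <;> rfl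
    rw [e, piZeroOp_mk, CInftyRing.op_mul, map_mul]

theorem op_toPiZero (A : SCRing.{u}) {n : ℕ} (f : SmoothFn n) (x : Fin n → A.lev 0) :
    CInftyRing.op f (fun i => A.toPiZero (x i)) = A.toPiZero (CInftyRing.op f x) :=
  A.piZeroOp_mk f x

/-- The quotient map as a morphism of `C^∞`-rings. -/
noncomputable def quot (A : SCRing.{u}) : CHom (A.lev 0) A.PiZero where
  toFun := A.toPiZero
  map_op f x := (A.op_toPiZero f x).symm

theorem quot_surjective (A : SCRing.{u}) : Function.Surjective A.quot := A.toPiZero_surjective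

theorem quot_eq (A : SCRing.{u}) {a b : A.lev 0} :
    A.quot a = A.quot b ↔ a - b ∈ A.piZeroIdeal := A.toPiZero_eq

/-- The morphism induced on `π₀`. -/
noncomputable def piZeroMap {A B : SCRing.{u}} (f : A ⟶ B) : CHom A.PiZero B.PiZero where
  toFun x := B.quot (f.app _ (Function.surjInv A.quot_surjective x))
  map_op h x := by
    obtain ⟨t, rfl⟩ := A.exists_rep x
    have key : ∀ a : A.lev 0, B.quot (f.app _ (Function.surjInv A.quot_surjective (A.quot a))) =
        B.quot (f.app _ a) := fun a => by
      obtain ⟨y, hy⟩ := A.quot_eq.1 (Function.surjInv_eq A.quot_surjective (A.quot a))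
      refine B.quot_eq.2 ⟨f.app _ y, ?_⟩
      rw [← map_str, ← map_str, ← map_sub, hy, map_sub]
    change B.quot (f.app _ (Function.surjInv A.quot_surjective
      (CInftyRing.op h fun i => A.quot (t i)))) = CInftyRing.op h fun i =>
        B.quot (f.app _ (Function.surjInv A.quot_surjective (A.quot (t i))))
    rw [← A.quot.map_op', key]
    simp only [key]
    rw [CHom.map_op', CHom.map_op']

theorem piZeroMap_quot {A B : SCRing.{u}} (f : A ⟶ B) (a : A.lev 0) :
    piZeroMap f (A.quot a) = B.quot (f.app _ a) := by
  obtain ⟨y, hy⟩ := A.quot_eq.1 (Function.surjInv_eq A.quot_surjective (A.quot a))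
  refine B.quot_eq.2 ⟨f.app _ y, ?_⟩
  rw [← map_str, ← map_str, ← map_sub, hy, map_sub]

theorem piZero_hom_ext {A : SCRing.{u}} {B : Type v} [CInftyRing B] {f g : CHom A.PiZero B}
    (h : ∀ a, f (A.quot a) = g (A.quot a)) : f = g :=
  CHom.hext fun x => by obtain ⟨a, rfl⟩ := A.quot_surjective x; exact h a

/-- The functor `π₀` from simplicial `C^∞`-rings to `C^∞`-rings. -/
noncomputable def piZero : SCRing.{u} ⥤ CRing.{u} where
  obj A := CRing.of A.PiZero
  map f := ⟨piZeroMap f⟩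
  map_id A := CRing.Hom.ext (piZero_hom_ext fun a => piZeroMap_quot (𝟙 A) a)
  map_comp f g := CRing.Hom.ext (piZero_hom_ext fun a => by
    change _ = piZeroMap g (piZeroMap f _)
    rw [piZeroMap_quot, piZeroMap_quot, piZeroMap_quot]; rfl)

/-! #### The modules `π_k`, for `k ≥ 1` -/

/-- `A_k` as a module over `A₀`, by means of the degeneracy. -/
def Simplices (A : SCRing.{u}) (k : ℕ) : Type u := A.lev k

instance (A : SCRing.{u}) (k : ℕ) : AddCommGroup (A.Simplices k) :=
  inferInstanceAs (AddCommGroup (A.lev k))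

instance (A : SCRing.{u}) (k : ℕ) : Module (A.lev 0) (A.Simplices k) :=
  Module.compHom (A.lev k) (A.deg k).toRingHom

theorem smul_def (A : SCRing.{u}) (k : ℕ) (a : A.lev 0) (x : A.Simplices k) :
    a • x = (A.deg k a * (show A.lev k from x) : A.lev k) := rfl

/-- A face map, as a linear map. -/
def face (A : SCRing.{u}) {k : ℕ} (i : Fin (k + 2)) :
    A.Simplices (k + 1) →ₗ[A.lev 0] A.Simplices k where
  toFun x := A.d i x
  map_add' x y := map_add (A.d i) x y
  map_smul' a x := by
    change A.d i (A.deg (k + 1) a * (show A.lev (k + 1) from x)) = A.deg k a * A.d i x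
    rw [map_mul, str_deg]

/-- The differential `∑ (-1)ⁱ ∂ᵢ` of the Moore complex. -/
def moore (A : SCRing.{u}) (k : ℕ) : A.Simplices (k + 1) →ₗ[A.lev 0] A.Simplices k :=
  ∑ i : Fin (k + 2), (-1 : ℤ) ^ (i : ℕ) • A.face i

/-- `π_{k+1}(A)`: the homology in degree `k + 1` of the Moore complex of `A`. -/
def PiSucc (A : SCRing.{u}) (k : ℕ) : Type u :=
  LinearMap.ker (A.moore k) ⧸
    (LinearMap.range (A.moore (k + 1))).comap (LinearMap.ker (A.moore k)).subtype

noncomputable instance (A : SCRing.{u}) (k : ℕ) : AddCommGroup (A.PiSucc k) :=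
  inferInstanceAs (AddCommGroup (LinearMap.ker (A.moore k) ⧸
    (LinearMap.range (A.moore (k + 1))).comap (LinearMap.ker (A.moore k)).subtype))

noncomputable instance moduleZero (A : SCRing.{u}) (k : ℕ) : Module (A.lev 0) (A.PiSucc k) :=
  inferInstanceAs (Module (A.lev 0) (LinearMap.ker (A.moore k) ⧸
    (LinearMap.range (A.moore (k + 1))).comap (LinearMap.ker (A.moore k)).subtype))

theorem moore_apply (A : SCRing.{u}) (k : ℕ) (x : A.Simplices (k + 1)) :
    A.moore k x = (∑ i : Fin (k + 2), (-1) ^ (i : ℕ) * A.d i x : A.lev k) := by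
  refine (LinearMap.sum_apply _ _ _).trans ?_
  refine Finset.sum_congr rfl fun i _ => ?_
  refine (zsmul_eq_mul (A.d i x) ((-1 : ℤ) ^ (i : ℕ))).trans ?_
  push_cast; rfl

/-- The map `[m] → [1]` sending `0, …, j - 1` to `0` and the rest to `1`. -/
def cut (m j : ℕ) : SimplexCategory.mk m ⟶ SimplexCategory.mk 1 :=
  SimplexCategory.mkHom ⟨fun i : Fin (m + 1) => if (i : ℕ) < j then (0 : Fin 2) else 1, by
    intro a b hab
    have : (a : ℕ) ≤ b := hab
    dsimp only
    split_ifs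
    · exact le_rfl
    · exact Fin.zero_le _
    · omega
    · exact le_rfl⟩

theorem cut_apply (m j : ℕ) (i : Fin (m + 1)) :
    (cut m j).toOrderHom i = if (i : ℕ) < j then (0 : Fin 2) else 1 := rfl

theorem δ_cut_le (m j : ℕ) (i : Fin (m + 2)) (h : (i : ℕ) ≤ j) :
    SimplexCategory.δ i ≫ cut (m + 1) (j + 1) = cut m j := by
  ext l : 3
  change (if ((i.succAbove l : Fin (m + 2)) : ℕ) < j + 1 then (0 : Fin 2) else 1) =
    if (l : ℕ) < j then 0 else 1
  refine if_congr ?_ rfl rfl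
  rw [Fin.succAbove]
  split_ifs with h'
  · rw [Fin.lt_def, Fin.val_castSucc] at h'
    rw [Fin.val_castSucc]; omega
  · rw [Fin.val_succ]; omega

theorem δ_cut_ge (m j : ℕ) (i : Fin (m + 2)) (h : j ≤ (i : ℕ)) :
    SimplexCategory.δ i ≫ cut (m + 1) j = cut m j := by
  ext l : 3
  change (if ((i.succAbove l : Fin (m + 2)) : ℕ) < j then (0 : Fin 2) else 1) =
    if (l : ℕ) < j then 0 else 1
  refine if_congr ?_ rfl rfl
  rw [Fin.succAbove]
  split_ifs with h'
  · rw [Fin.val_castSucc]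
  · rw [Fin.lt_def, Fin.val_castSucc] at h'
    rw [Fin.val_succ]; omega

theorem str_cut_zero (A : SCRing.{u}) (m : ℕ) (y : A.lev 1) :
    A.str (cut m 0) y = A.deg m (A.d 0 y) := by
  rw [str_str]; rfl

theorem str_cut_last (A : SCRing.{u}) (m : ℕ) (y : A.lev 1) :
    A.str (cut m (m + 1)) y = A.deg m (A.d 1 y) := by
  rw [str_str]
  congr 2
  ext l : 3
  exact if_pos l.2

/-- The action of `∂₀ y - ∂₁ y` on a cycle gives a boundary. -/
theorem smul_mem_range (A : SCRing.{u}) (k : ℕ) (y : A.lev 1) (x : A.lev (k + 1))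
    (hx : ∑ i : Fin (k + 2), (-1) ^ (i : ℕ) * A.d i x = 0) :
    ∑ i : Fin (k + 3), (-1) ^ (i : ℕ) * A.d i
      (∑ j : Fin (k + 2), (-1) ^ (j : ℕ) * (A.str (cut (k + 2) (j + 1)) y * A.s j x)) =
    A.deg (k + 1) (A.d 0 y - A.d 1 y) * x := by
  have e : ∀ i : Fin (k + 3), (-1) ^ (i : ℕ) * A.d i
      (∑ j : Fin (k + 2), (-1) ^ (j : ℕ) * (A.str (cut (k + 2) (j + 1)) y * A.s j x)) =
      ∑ j : Fin (k + 2), (-1) ^ (i : ℕ) * ((-1) ^ (j : ℕ) *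
        (A.str (SimplexCategory.δ i ≫ cut (k + 2) (j + 1)) y *
          A.str (SimplexCategory.δ i ≫ SimplexCategory.σ j) x)) := fun i => by
    rw [map_sum, Finset.mul_sum]
    refine Finset.sum_congr rfl fun j _ => ?_
    rw [map_mul, map_mul, map_pow, map_neg, map_one, str_str, str_str]
  rw [Finset.sum_congr rfl fun i _ => e i, sum_shuffle]
  have h₁ : ∀ j : Fin (k + 2), (-1) ^ (j.castSucc : ℕ) * ((-1) ^ (j : ℕ) *
        (A.str (SimplexCategory.δ j.castSucc ≫ cut (k + 2) (j + 1)) y *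
          A.str (SimplexCategory.δ j.castSucc ≫ SimplexCategory.σ j) x)) =
      A.str (cut (k + 1) j) y * x := fun j => by
    rw [δ_cut_le _ _ _ (by simp), SimplexCategory.δ_comp_σ_self, str_id, ← mul_assoc,
      Fin.val_castSucc, ← pow_add, Even.neg_one_pow ⟨_, rfl⟩, one_mul]
  have h₂ : ∀ j : Fin (k + 2), (-1) ^ (j.succ : ℕ) * ((-1) ^ (j : ℕ) *
        (A.str (SimplexCategory.δ j.succ ≫ cut (k + 2) (j + 1)) y *
          A.str (SimplexCategory.δ j.succ ≫ SimplexCategory.σ j) x)) =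
      -(A.str (cut (k + 1) (j + 1)) y * x) := fun j => by
    rw [δ_cut_ge _ _ _ (by simp), SimplexCategory.δ_comp_σ_succ, str_id, ← mul_assoc,
      Fin.val_succ, ← pow_add, Odd.neg_one_pow ⟨j, by ring⟩, neg_one_mul]
  have h₃ : ∀ (i : Fin (k + 2)) (j : Fin (k + 1)),
      (if i ≤ j.castSucc then (-1) ^ (i.castSucc : ℕ) * ((-1) ^ (j.succ : ℕ) *
        (A.str (SimplexCategory.δ i.castSucc ≫ cut (k + 2) (j.succ + 1)) y *
          A.str (SimplexCategory.δ i.castSucc ≫ SimplexCategory.σ j.succ) x))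
      else (-1) ^ (i.succ : ℕ) * ((-1) ^ (j.castSucc : ℕ) *
        (A.str (SimplexCategory.δ i.succ ≫ cut (k + 2) (j.castSucc + 1)) y *
          A.str (SimplexCategory.δ i.succ ≫ SimplexCategory.σ j.castSucc) x))) =
      -((-1) ^ (j : ℕ) * (A.str (cut (k + 1) (j + 1)) y *
        A.s j ((-1) ^ (i : ℕ) * A.d i x))) := fun i j => by
    have hs : A.s j ((-1) ^ (i : ℕ) * A.d i x) =
        (-1) ^ (i : ℕ) * A.str (SimplexCategory.σ j ≫ SimplexCategory.δ i) x := by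
      rw [map_mul, map_pow, map_neg, map_one, str_str]
    rw [hs]
    split_ifs with h
    · rw [SimplexCategory.δ_comp_σ_of_le h,
        δ_cut_le _ _ _ (by have : (i : ℕ) ≤ j := h; simp; omega), Fin.val_succ, Fin.val_castSucc,
        pow_succ]
      ring
    · rw [SimplexCategory.δ_comp_σ_of_gt (not_le.1 h),
        δ_cut_ge _ _ _ (by have : (j : ℕ) < i := not_le.1 h; simp; omega), Fin.val_succ,
        Fin.val_castSucc, pow_succ]
      ring
  rw [Finset.sum_congr rfl fun j _ => h₁ j, Finset.sum_congr rfl fun j _ => h₂ j,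
    Finset.sum_congr rfl fun i _ => Finset.sum_congr rfl fun j _ => h₃ i j, Finset.sum_comm]
  have h₄ : ∑ j : Fin (k + 1), ∑ i : Fin (k + 2), -((-1) ^ (j : ℕ) *
      (A.str (cut (k + 1) (j + 1)) y * A.s j ((-1) ^ (i : ℕ) * A.d i x))) = 0 := by
    refine Finset.sum_eq_zero fun j _ => ?_
    rw [Finset.sum_neg_distrib, ← Finset.mul_sum, ← Finset.mul_sum, ← map_sum, hx, map_zero,
      mul_zero, mul_zero, neg_zero]
  rw [h₄, add_zero, Finset.sum_neg_distrib, ← sub_eq_add_neg, Fin.sum_univ_succ,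
    Fin.sum_univ_castSucc (fun j : Fin (k + 2) => A.str (cut (k + 1) (j + 1)) y * x)]
  simp only [Fin.val_zero, Fin.val_succ, Fin.val_castSucc, Fin.val_last]
  rw [str_cut_zero, str_cut_last, map_sub]
  ring

theorem isTorsionBySet (A : SCRing.{u}) (k : ℕ) :
    Module.IsTorsionBySet (A.lev 0) (A.PiSucc k) A.piZeroIdeal := by
  rintro ξ ⟨a, y, rfl⟩
  obtain ⟨⟨x, hx⟩, rfl⟩ := Submodule.Quotient.mk_surjective _ ξ
  refine (Submodule.Quotient.mk_eq_zero _).2 ⟨_, (A.moore_apply (k + 1) _).trans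
    (A.smul_mem_range k y x ((A.moore_apply k x).symm.trans hx))⟩

/-- The homotopy group `π_{k+1}(A)` as a module over `π₀(A)`: the class of `a ∈ A₀` acts by
multiplication by the degeneracy of `a`. -/
noncomputable instance (A : SCRing.{u}) (k : ℕ) : Module A.PiZero (A.PiSucc k) :=
  (A.isTorsionBySet k).module

theorem quot_smul (A : SCRing.{u}) (k : ℕ) (a : A.lev 0) (ξ : A.PiSucc k) :
    A.quot a • ξ = a • ξ := rfl

end SCRing

/-! ### Weak equivalences -/

section HomotopyGroups

/-- The constant `n`-simplex at a vertex `v`. -/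
def constSimplex (K : SSet.{u}) (n : ℕ) (v : K.obj (op (SimplexCategory.mk 0))) :
    K.obj (op (SimplexCategory.mk n)) :=
  K.map (SimplexCategory.const (SimplexCategory.mk n) (SimplexCategory.mk 0) 0).op v

/-- The `n`-simplices of `K` all of whose proper faces are constant at the vertex `v`. -/
def Sphere (K : SSet.{u}) (n : ℕ) (v : K.obj (op (SimplexCategory.mk 0))) : Type u :=
  {x : K.obj (op (SimplexCategory.mk n)) //
    ∀ (m : ℕ) (θ : SimplexCategory.mk m ⟶ SimplexCategory.mk n), m < n →
      K.map θ.op x = constSimplex K m v}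

/-- The homotopy relation: `x` and `y` are the last two faces of an `(n + 1)`-simplex whose other
faces are constant. -/
def Sphere.Homotopic {K : SSet.{u}} {n : ℕ} {v : K.obj (op (SimplexCategory.mk 0))}
    (x y : Sphere K n v) : Prop :=
  ∃ w : K.obj (op (SimplexCategory.mk (n + 1))),
    (∀ i : Fin (n + 2), (i : ℕ) < n → K.map (SimplexCategory.δ i).op w = constSimplex K n v) ∧
    K.map (SimplexCategory.δ (Fin.last n).castSucc).op w = x.1 ∧
    K.map (SimplexCategory.δ (Fin.last (n + 1))).op w = y.1

/-- The simplicial homotopy group (set, for `n = 0`) `πₙ(K, v)` of a Kan complex `K`. -/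
def HomotopyGroup (K : SSet.{u}) (n : ℕ) (v : K.obj (op (SimplexCategory.mk 0))) : Type u :=
  Quot (Sphere.Homotopic : Sphere K n v → Sphere K n v → Prop)

theorem map_constSimplex {K L : SSet.{u}} (f : K ⟶ L) (n : ℕ)
    (v : K.obj (op (SimplexCategory.mk 0))) :
    f.app _ (constSimplex K n v) = constSimplex L n (f.app _ v) :=
  ConcreteCategory.congr_hom (f.naturality _) v

theorem app_map {K L : SSet.{u}} (f : K ⟶ L) {m n : SimplexCategory} (θ : m ⟶ n)
    (x : K.obj (op n)) : L.map θ.op (f.app _ x) = f.app _ (K.map θ.op x) :=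
  (ConcreteCategory.congr_hom (f.naturality θ.op) x).symm

/-- The map induced on spheres. -/
def Sphere.map {K L : SSet.{u}} (f : K ⟶ L) {n : ℕ} {v : K.obj (op (SimplexCategory.mk 0))}
    (x : Sphere K n v) : Sphere L n (f.app _ v) :=
  ⟨f.app _ x.1, fun m θ h => by rw [app_map, x.2 m θ h, map_constSimplex]⟩

/-- The map induced on homotopy groups. -/
def HomotopyGroup.map {K L : SSet.{u}} (f : K ⟶ L) (n : ℕ)
    (v : K.obj (op (SimplexCategory.mk 0))) :
    HomotopyGroup K n v → HomotopyGroup L n (f.app _ v) :=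
  Quot.map (Sphere.map f) fun x y ⟨w, h, hx, hy⟩ =>
    ⟨f.app _ w, fun i hi => by rw [app_map, h i hi, map_constSimplex],
      by rw [app_map, hx]; rfl, by rw [app_map, hy]; rfl⟩

end HomotopyGroups

namespace SCRing

/-- The underlying simplicial set of a simplicial `C^∞`-ring; being a simplicial group, it is a
Kan complex. -/
abbrev sset (A : SCRing.{u}) : SSet.{u} :=
  ((SimplicialObject.whiskering CRing.{u} (Type u)).obj (forget CRing.{u})).obj A

/-- The map of underlying simplicial sets. -/
abbrev ssetMap {A B : SCRing.{u}} (f : A ⟶ B) : A.sset ⟶ B.sset :=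
  ((SimplicialObject.whiskering CRing.{u} (Type u)).obj (forget CRing.{u})).map f

/-- A morphism of simplicial `C^∞`-rings is a weak equivalence if so is the map of underlying
simplicial sets, i.e. if it induces bijections on `π₀` and on all homotopy groups at all
base points. -/
def IsWeakEquivalence {A B : SCRing.{u}} (f : A ⟶ B) : Prop :=
  ∀ (n : ℕ) (v : A.sset.obj (op (SimplexCategory.mk 0))),
    Function.Bijective (HomotopyGroup.map (ssetMap f) n v)

/-- A simplicial `C^∞`-ring is geometric if `π₀` is a finitely generated, germ determined
`C^∞`-ring and every `π_k`, `k ≥ 1`, is a germ determined, locally complete module over `π₀`. -/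
def IsGeometric : ObjectProperty SCRing.{u} := fun A =>
  IsGermDetermined A.PiZero ∧
    ∀ k : ℕ, IsGermDeterminedLocallyComplete A.PiZero (A.PiSucc k)

end SCRing

/-! ### Stalks and sheafification -/

section Stalks

variable {X : TopCat.{u}} (P : X.Presheaf CRing.{u})

/-- The stalk at `x` of a presheaf of `C^∞`-rings. -/
abbrev Stalk (x : X) : Type u := TopCat.Presheaf.stalk (P ⋙ forget CRing.{u}) x

/-- The germ at `x` of a section over `U ∋ x`. -/
noncomputable def germ {U : Opens X} {x : X} (hx : x ∈ U) (s : P.obj (op U)) : Stalk P x :=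
  TopCat.Presheaf.germ (P ⋙ forget CRing.{u}) U x hx s

/-- Restriction of sections. -/
def res {U V : Opens X} (h : V ≤ U) : CHom (P.obj (op U)) (P.obj (op V)) :=
  (P.map (homOfLE h).op).hom

theorem res_res {U V W : Opens X} (h : V ≤ U) (h' : W ≤ V) (s : P.obj (op U)) :
    res P h' (res P h s) = res P (h'.trans h) s := by
  have : P.map (homOfLE (h'.trans h)).op = P.map (homOfLE h).op ≫ P.map (homOfLE h').op := by
    rw [← P.map_comp]; rfl
  simp only [res, this]; rfl

theorem germ_res {U V : Opens X} (h : V ≤ U) {x : X} (hx : x ∈ V) (s : P.obj (op U)) :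
    germ P hx (res P h s) = germ P (h hx) s :=
  TopCat.Presheaf.germ_res_apply (P ⋙ forget CRing.{u}) (homOfLE h) x hx s

theorem exists_germ (x : X) (ξ : Stalk P x) :
    ∃ (U : Opens X) (hx : x ∈ U) (s : P.obj (op U)), germ P hx s = ξ :=
  TopCat.Presheaf.exists_germ_eq (P ⋙ forget CRing.{u}) ξ

theorem germ_eq {U V : Opens X} {x : X} (hU : x ∈ U) (hV : x ∈ V) (s : P.obj (op U))
    (t : P.obj (op V)) (h : germ P hU s = germ P hV t) :
    ∃ (W : Opens X) (_ : x ∈ W) (hWU : W ≤ U) (hWV : W ≤ V), res P hWU s = res P hWV t := by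
  obtain ⟨W, hW, i, j, e⟩ := TopCat.Presheaf.germ_eq (P ⋙ forget CRing.{u}) x hU hV s t h
  exact ⟨W, hW, leOfHom i, leOfHom j, e⟩

/-- A common neighbourhood contained in finitely many. -/
theorem exists_common {n : ℕ} {x : X} (U : Fin n → Opens X) (hU : ∀ i, x ∈ U i) :
    ∃ W : Opens X, x ∈ W ∧ ∀ i, W ≤ U i :=
  ⟨⟨⋂ i, (U i : Set X), isOpen_iInter_of_finite fun i => (U i).2⟩,
    Set.mem_iInter.2 hU, fun i => Set.iInter_subset (fun i => (U i : Set X)) i⟩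

theorem exists_germs {n : ℕ} (x : X) (ξ : Fin n → Stalk P x) :
    ∃ (U : Opens X) (hx : x ∈ U) (s : Fin n → P.obj (op U)), ξ = fun i => germ P hx (s i) := by
  choose U hU s hs using fun i => exists_germ P x (ξ i)
  obtain ⟨W, hW, h⟩ := exists_common U hU
  exact ⟨W, hW, fun i => res P (h i) (s i), funext fun i => by rw [germ_res, hs]⟩

/-- The operations on germs, computed on representatives over a common neighbourhood. -/
noncomputable def stalkOp {x : X} {n : ℕ} (f : SmoothFn n) (ξ : Fin n → Stalk P x) : Stalk P x :=
  germ P (exists_germs P x ξ).choose_spec.choose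
    (CInftyRing.op f (exists_germs P x ξ).choose_spec.choose_spec.choose)

theorem germ_op_congr {x : X} {n : ℕ} (f : SmoothFn n) {U V : Opens X} (hU : x ∈ U) (hV : x ∈ V)
    (s : Fin n → P.obj (op U)) (t : Fin n → P.obj (op V))
    (h : ∀ i, germ P hU (s i) = germ P hV (t i)) :
    germ P hU (CInftyRing.op f s) = germ P hV (CInftyRing.op f t) := by
  choose W hW hWU hWV e using fun i => germ_eq P hU hV (s i) (t i) (h i)
  obtain ⟨O, hO, hOW⟩ := exists_common W hW
  have hx : x ∈ O ⊓ (U ⊓ V) := ⟨hO, hU, hV⟩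
  have h₁ : O ⊓ (U ⊓ V) ≤ U := inf_le_right.trans inf_le_left
  have h₂ : O ⊓ (U ⊓ V) ≤ V := inf_le_right.trans inf_le_right
  rw [← germ_res P h₁ hx, ← germ_res P h₂ hx, CHom.map_op', CHom.map_op']
  congr 2
  funext i
  have := congrArg (res P (inf_le_left.trans (hOW i) : O ⊓ (U ⊓ V) ≤ W i)) (e i)
  rwa [res_res, res_res] at this

theorem stalkOp_germ {x : X} {n : ℕ} (f : SmoothFn n) {U : Opens X} (hx : x ∈ U)
    (s : Fin n → P.obj (op U)) :
    stalkOp P f (fun i => germ P hx (s i)) = germ P hx (CInftyRing.op f s) :=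
  have H := exists_germs P x fun i => germ P hx (s i)
  germ_op_congr P f _ hx _ s fun i => (congrFun H.choose_spec.choose_spec.choose_spec i).symm

/-- The operations of the `C^∞`-ring of germs. -/
noncomputable def stalkOps (x : X) : COps (Stalk P x) where
  op := stalkOp P
  op_proj i ξ := by
    obtain ⟨U, hx, s, rfl⟩ := exists_germs P x ξ
    rw [stalkOp_germ, CInftyRing.op_proj]
  op_comp f g ξ := by
    obtain ⟨U, hx, s, rfl⟩ := exists_germs P x ξ
    simp only [stalkOp_germ, CInftyRing.op_comp]

noncomputable instance (x : X) : CInftyRing (Stalk P x) := (stalkOps P x).toCInftyRing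

theorem op_germ {x : X} {n : ℕ} (f : SmoothFn n) {U : Opens X} (hx : x ∈ U)
    (s : Fin n → P.obj (op U)) :
    CInftyRing.op f (fun i => germ P hx (s i)) = germ P hx (CInftyRing.op f s) :=
  stalkOp_germ P f hx s

/-- Taking germs is a morphism of `C^∞`-rings. -/
noncomputable def germHom {U : Opens X} {x : X} (hx : x ∈ U) : CHom (P.obj (op U)) (Stalk P x) where
  toFun := germ P hx
  map_op f s := (op_germ P f hx s).symm

/-- A family of germs over `U` is a section of the sheaf associated to `P` if it is locally given
by sections of `P`. -/
def IsLocallyGerm (U : Opens X) (σ : ∀ x : U, Stalk P x.1) : Prop :=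
  ∀ x : U, ∃ (V : Opens X) (_ : x.1 ∈ V) (hVU : V ≤ U) (s : P.obj (op V)),
    ∀ (y : X) (hy : y ∈ V), σ ⟨y, hVU hy⟩ = germ P hy s

/-- The sections over `U` of the sheaf associated to `P`. -/
def ShSec (U : Opens X) : Type u := {σ : ∀ x : U, Stalk P x.1 // IsLocallyGerm P U σ}

namespace ShSec

variable {P}

/-- The value at `x` of a section of the associated sheaf. -/
def val {U : Opens X} (σ : ShSec P U) {x : X} (hx : x ∈ U) : Stalk P x := σ.1 ⟨x, hx⟩

theorem ext {U : Opens X} {σ τ : ShSec P U} (h : ∀ (x : X) (hx : x ∈ U), σ.val hx = τ.val hx) :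
    σ = τ := Subtype.ext (funext fun x => h x.1 x.2)

theorem exists_local {U : Opens X} (σ : ShSec P U) {x : X} (hx : x ∈ U) :
    ∃ (V : Opens X) (_ : x ∈ V) (hVU : V ≤ U) (s : P.obj (op V)),
      ∀ (y : X) (hy : y ∈ V), σ.val (hVU hy) = germ P hy s := σ.2 ⟨x, hx⟩

theorem exists_locals {U : Opens X} {n : ℕ} (σ : Fin n → ShSec P U) {x : X} (hx : x ∈ U) :
    ∃ (V : Opens X) (_ : x ∈ V) (hVU : V ≤ U) (s : Fin n → P.obj (op V)),
      ∀ (i : Fin n) (y : X) (hy : y ∈ V), (σ i).val (hVU hy) = germ P hy (s i) := by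
  choose V hV hVU s hs using fun i => (σ i).exists_local hx
  obtain ⟨W, hW, h⟩ := exists_common V hV
  refine ⟨W ⊓ U, ⟨hW, hx⟩, inf_le_right, fun i => res P (inf_le_left.trans (h i)) (s i), ?_⟩
  intro i y hy
  rw [germ_res, ← hs]

/-- The operations on sections, computed pointwise. -/
noncomputable def opFun {U : Opens X} {n : ℕ} (f : SmoothFn n) (σ : Fin n → ShSec P U) :
    ShSec P U :=
  ⟨fun x => CInftyRing.op f fun i => (σ i).val x.2, fun x => by
    obtain ⟨V, hV, hVU, s, hs⟩ := exists_locals σ x.2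
    refine ⟨V, hV, hVU, CInftyRing.op f s, fun y hy => ?_⟩
    change CInftyRing.op f (fun i => (σ i).val (hVU hy)) = _
    rw [← op_germ]
    congr 1
    funext i
    exact hs i y hy⟩

noncomputable instance (U : Opens X) : CInftyRing (ShSec P U) :=
  COps.toCInftyRing
    { op := opFun
      op_proj := fun i _ => ext fun _ _ => CInftyRing.op_proj i _
      op_comp := fun f g _ => ext fun _ _ => CInftyRing.op_comp f g _ }

theorem val_op {U : Opens X} {n : ℕ} (f : SmoothFn n) (σ : Fin n → ShSec P U) {x : X} (hx : x ∈ U) :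
    (CInftyRing.op f σ).val hx = CInftyRing.op f fun i => (σ i).val hx := rfl

/-- Evaluation at a point is a morphism of `C^∞`-rings. -/
def valHom {U : Opens X} {x : X} (hx : x ∈ U) : CHom (ShSec P U) (Stalk P x) where
  toFun σ := σ.val hx
  map_op _ _ := rfl

/-- Restriction of sections. -/
def restrict {U V : Opens X} (h : V ≤ U) : CHom (ShSec P U) (ShSec P V) where
  toFun σ := ⟨fun x => σ.val (h x.2), fun x => by
    obtain ⟨W, hW, hWU, s, hs⟩ := σ.exists_local (h x.2)
    refine ⟨W ⊓ V, ⟨hW, x.2⟩, inf_le_right, res P inf_le_left s, fun y hy => ?_⟩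
    rw [germ_res]
    exact hs y hy.1⟩
  map_op _ _ := rfl

theorem restrict_val {U V : Opens X} (h : V ≤ U) (σ : ShSec P U) {x : X} (hx : x ∈ V) :
    (restrict h σ).val hx = σ.val (h hx) := rfl

end ShSec

/-- The sheaf of `C^∞`-rings associated to `P`. -/
noncomputable def sheafify : X.Presheaf CRing.{u} where
  obj U := CRing.of (ShSec P U.unop)
  map i := ⟨ShSec.restrict (leOfHom i.unop)⟩

/-- The canonical morphism from `P` to the associated sheaf. -/
noncomputable def toSheafify : P ⟶ sheafify P where
  app U := ⟨{
    toFun := fun s => ⟨fun x => germ P x.2 s, fun x =>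
      ⟨U.unop, x.2, le_rfl, s, fun _ _ => rfl⟩⟩
    map_op := fun f s => ShSec.ext fun _ hx => (op_germ P f hx s).symm }⟩
  naturality _ _ i := CRing.hom_ext' fun s => ShSec.ext fun _ hx =>
    germ_res P (leOfHom i.unop) hx s

end Stalks

section MapStalk

variable {X Y : TopCat.{u}} {P : X.Presheaf CRing.{u}} {Q : Y.Presheaf CRing.{u}} (φ : Y ⟶ X)

theorem mem_preimage {y : Y} {U : Opens X} (h : φ y ∈ U) : y ∈ (Opens.map φ).obj U := h

theorem preimage_mono {U V : Opens X} (h : V ≤ U) : (Opens.map φ).obj V ≤ (Opens.map φ).obj U :=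
  ((Opens.map φ).map (homOfLE h)).le

variable (η : P ⟶ (TopCat.Presheaf.pushforward CRing.{u} φ).obj Q)

/-- The sections of `Q` over the preimage of `U` given by a section of `P` over `U`. -/
def comap (U : Opens X) : CHom (P.obj (op U)) (Q.obj (op ((Opens.map φ).obj U))) :=
  (η.app (op U)).hom

theorem comap_res {U V : Opens X} (h : V ≤ U) (s : P.obj (op U)) :
    comap φ η V (res P h s) = res Q (preimage_mono φ h) (comap φ η U s) :=
  ConcreteCategory.congr_hom (η.naturality (homOfLE h).op) s

theorem exists_stalkMap (y : Y) (ξ : Stalk P (φ y)) : ∃ ζ : Stalk Q y,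
    ∀ (U : Opens X) (hU : φ y ∈ U) (s : P.obj (op U)), germ P hU s = ξ →
      ζ = germ Q (mem_preimage φ hU) (comap φ η U s) := by
  obtain ⟨U, hU, s, rfl⟩ := exists_germ P (φ y) ξ
  refine ⟨germ Q (mem_preimage φ hU) (comap φ η U s), fun V hV t ht => ?_⟩
  obtain ⟨W, hW, hWU, hWV, e⟩ := germ_eq P hU hV s t ht.symm
  have := congrArg (fun r => germ Q (mem_preimage φ hW) (comap φ η W r)) e
  simp only [comap_res] at this
  rwa [germ_res, germ_res] at this

/-- The map of stalks induced by a morphism of presheaves over a continuous map. -/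
noncomputable def stalkMap (y : Y) (ξ : Stalk P (φ y)) : Stalk Q y :=
  (exists_stalkMap φ η y ξ).choose

theorem stalkMap_germ {y : Y} {U : Opens X} (hU : φ y ∈ U) (s : P.obj (op U)) :
    stalkMap φ η y (germ P hU s) = germ Q (mem_preimage φ hU) (comap φ η U s) :=
  (exists_stalkMap φ η y _).choose_spec U hU s rfl

theorem stalkMap_op (y : Y) {n : ℕ} (f : SmoothFn n) (ξ : Fin n → Stalk P (φ y)) :
    stalkMap φ η y (CInftyRing.op f ξ) = CInftyRing.op f fun i => stalkMap φ η y (ξ i) := by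
  obtain ⟨U, hU, s, rfl⟩ := exists_germs P (φ y) ξ
  rw [op_germ, stalkMap_germ, CHom.map_op', ← op_germ]
  congr 1
  funext i
  exact (stalkMap_germ φ η hU (s i)).symm

/-- The morphism induced on sections of the associated sheaves. -/
noncomputable def shSecMap (U : Opens X) :
    CHom (ShSec P U) (ShSec Q ((Opens.map φ).obj U)) where
  toFun σ := ⟨fun y => stalkMap φ η y.1 (σ.val (x := φ y.1) y.2), fun y => by
    obtain ⟨V, hV, hVU, s, hs⟩ := σ.exists_local (x := φ y.1) y.2
    refine ⟨(Opens.map φ).obj V, hV, preimage_mono φ hVU, comap φ η V s, fun z hz => ?_⟩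
    exact (congrArg (stalkMap φ η z) (hs (φ z) hz)).trans (stalkMap_germ φ η hz s)⟩
  map_op f _ := ShSec.ext fun y _ => stalkMap_op φ η y f _

theorem shSecMap_val {U : Opens X} (σ : ShSec P U) {y : Y} (hy : φ y ∈ U) :
    (shSecMap φ η U σ).val (mem_preimage φ hy) = stalkMap φ η y (σ.val hy) := rfl

end MapStalk

/-! ### Sheafification of simplicial presheaves -/

section Simplicial

open AlgebraicGeometry

variable {X : TopCat.{u}}

/-- The presheaf of `k`-simplices of a presheaf of simplicial `C^∞`-rings. -/
def level (P : X.Presheaf SCRing.{u}) (k : SimplexCategoryᵒᵖ) : X.Presheaf CRing.{u} where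
  obj U := (P.obj U).obj k
  map i := (P.map i).app k
  map_id U := by rw [P.map_id]; rfl
  map_comp i j := by rw [P.map_comp]; rfl

/-- The morphism between presheaves of simplices given by a map in the simplex category. -/
def levelStr (P : X.Presheaf SCRing.{u}) {k l : SimplexCategoryᵒᵖ} (θ : k ⟶ l) :
    level P k ⟶ level P l where
  app U := (P.obj U).map θ
  naturality _ _ i := ((P.map i).naturality θ).symm

/-- The morphism of presheaves of `k`-simplices over a continuous map. -/
def levelMap {Y : TopCat.{u}} {P : X.Presheaf SCRing.{u}} {Q : Y.Presheaf SCRing.{u}} {φ : Y ⟶ X}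
    (η : P ⟶ (TopCat.Presheaf.pushforward SCRing.{u} φ).obj Q) (k : SimplexCategoryᵒᵖ) :
    level P k ⟶ (TopCat.Presheaf.pushforward CRing.{u} φ).obj (level Q k) where
  app U := (η.app U).app k
  naturality _ _ i := congrArg (fun f => NatTrans.app f k) (η.naturality i)

section secMap

variable {P Q R : X.Presheaf CRing.{u}} (η : P ⟶ Q)

/-- The map of stalks induced by a morphism of presheaves. -/
noncomputable def stMap (x : X) (ξ : Stalk P x) : Stalk Q x :=
  (TopCat.Presheaf.stalkFunctor (Type u) x).map (Functor.whiskerRight η (forget CRing.{u})) ξ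

theorem stMap_germ {U : Opens X} {x : X} (hx : x ∈ U) (s : P.obj (op U)) :
    stMap η x (germ P hx s) = germ Q hx ((η.app (op U)).hom s) :=
  TopCat.Presheaf.stalkFunctor_map_germ_apply U x hx
    (Functor.whiskerRight η (forget CRing.{u})) s

theorem stMap_op (x : X) {n : ℕ} (f : SmoothFn n) (ξ : Fin n → Stalk P x) :
    stMap η x (CInftyRing.op f ξ) = CInftyRing.op f fun i => stMap η x (ξ i) := by
  obtain ⟨U, hU, s, rfl⟩ := exists_germs P x ξ
  rw [op_germ, stMap_germ, CHom.map_op', ← op_germ]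
  congr 1
  funext i
  exact (stMap_germ η hU (s i)).symm

/-- The morphism induced on sections of the associated sheaves. -/
noncomputable def secMap (U : Opens X) : CHom (ShSec P U) (ShSec Q U) where
  toFun σ := ⟨fun x => stMap η x.1 (σ.val x.2), fun x => by
    obtain ⟨V, hV, hVU, s, hs⟩ := σ.exists_local x.2
    exact ⟨V, hV, hVU, (η.app (op V)).hom s, fun y hy =>
      (congrArg (stMap η y) (hs y hy)).trans (stMap_germ η hy s)⟩⟩
  map_op f _ := ShSec.ext fun x _ => stMap_op η x f _

theorem secMap_val {U : Opens X} (σ : ShSec P U) {x : X} (hx : x ∈ U) :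
    (secMap η U σ).val hx = stMap η x (σ.val hx) := rfl

end secMap

/-- The sheaf of simplicial `C^∞`-rings associated to a presheaf of simplicial `C^∞`-rings. -/
noncomputable def simplicialSheafify (P : X.Presheaf SCRing.{u}) : X.Presheaf SCRing.{u} where
  obj U :=
    { obj := fun k => CRing.of (ShSec (level P k) U.unop)
      map := fun θ => ⟨secMap (levelStr P θ) U.unop⟩
      map_id := fun k => CRing.hom_ext' fun σ => ShSec.ext fun x hx => by
        change stMap (levelStr P (𝟙 k)) x (σ.val hx) = σ.val hx
        obtain ⟨V, hV, s, e⟩ := exists_germ _ x (σ.val hx)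
        rw [← e, stMap_germ]
        congr 1
        exact ConcreteCategory.congr_hom ((P.obj (op V)).map_id k) s
      map_comp := fun θ χ => CRing.hom_ext' fun σ => ShSec.ext fun x hx => by
        change stMap (levelStr P (θ ≫ χ)) x (σ.val hx) =
          stMap (levelStr P χ) x (stMap (levelStr P θ) x (σ.val hx))
        obtain ⟨V, hV, s, e⟩ := exists_germ _ x (σ.val hx)
        rw [← e, stMap_germ, stMap_germ, stMap_germ]
        congr 1
        exact ConcreteCategory.congr_hom ((P.obj (op V)).map_comp θ χ) s }
  map i :=
    { app := fun k => ⟨ShSec.restrict (leOfHom i.unop)⟩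
      naturality := fun _ _ _ => rfl }

/-- The morphism of associated sheaves induced by a morphism of presheaves over a continuous
map. -/
noncomputable def simplicialSheafifyMap {Y : TopCat.{u}} {P : X.Presheaf SCRing.{u}}
    {Q : Y.Presheaf SCRing.{u}} {φ : Y ⟶ X}
    (η : P ⟶ (TopCat.Presheaf.pushforward SCRing.{u} φ).obj Q) :
    simplicialSheafify P ⟶
      (TopCat.Presheaf.pushforward SCRing.{u} φ).obj (simplicialSheafify Q) where
  app U :=
    { app := fun k => ⟨shSecMap φ (levelMap η k) U.unop⟩
      naturality := fun k l θ => CRing.hom_ext' fun σ => ShSec.ext fun y hy => by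
        change stalkMap φ (levelMap η l) y (stMap (levelStr P θ) (φ y) (σ.val (x := φ y) hy)) =
          stMap (levelStr Q θ) y (stalkMap φ (levelMap η k) y (σ.val (x := φ y) hy))
        obtain ⟨V, hV, s, e⟩ := exists_germ _ (φ y) (σ.val (x := φ y) hy)
        rw [← e, stMap_germ, stalkMap_germ, stalkMap_germ, stMap_germ]
        congr 1
        exact ConcreteCategory.congr_hom ((η.app (op V)).naturality θ) s }
  naturality _ _ _ := rfl

/-- The functor replacing the presheaf of simplicial `C^∞`-rings on a space by the associated
sheaf. -/
noncomputable def sheafification :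
    PresheafedSpace SCRing.{u} ⥤ PresheafedSpace SCRing.{u} where
  obj X := ⟨X.carrier, simplicialSheafify X.presheaf⟩
  map f := ⟨f.base, simplicialSheafifyMap f.c⟩
  map_id X := by
    refine PresheafedSpace.hext _ _ rfl (heq_of_eq ?_)
    refine NatTrans.ext (funext fun U => NatTrans.ext (funext fun k => CRing.hom_ext' fun σ =>
      ShSec.ext fun x hx => ?_))
    change stalkMap (𝟙 X.carrier) (levelMap (PresheafedSpace.Hom.c (𝟙 X)) k) x
      (σ.val (x := x) hx) = σ.val (x := x) hx
    obtain ⟨V, hV, s, e⟩ := exists_germ _ x (σ.val (x := x) hx)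
    rw [← e]
    exact stalkMap_germ (𝟙 X.carrier) (levelMap (PresheafedSpace.Hom.c (𝟙 X)) k) hV s
  map_comp {X Y Z} f g := by
    refine PresheafedSpace.hext _ _ rfl (heq_of_eq ?_)
    refine NatTrans.ext (funext fun U => NatTrans.ext (funext fun k => CRing.hom_ext' fun σ =>
      ShSec.ext fun x hx => ?_))
    change stalkMap (f.base ≫ g.base) (levelMap (PresheafedSpace.Hom.c (f ≫ g)) k) x
        (σ.val (x := g.base (f.base x)) hx) =
      stalkMap f.base (levelMap f.c k) x
        (stalkMap g.base (levelMap g.c k) (f.base x) (σ.val (x := g.base (f.base x)) hx))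
    obtain ⟨V, hV, s, e⟩ := exists_germ _ (g.base (f.base x)) (σ.val (x := g.base (f.base x)) hx)
    rw [← e, stalkMap_germ, stalkMap_germ]
    exact stalkMap_germ (f.base ≫ g.base) (levelMap (PresheafedSpace.Hom.c (f ≫ g)) k) hV s

end Simplicial

/-! ### The spectrum of a simplicial `C^∞`-ring -/

namespace SCRing

open AlgebraicGeometry

/-- The total degeneracy `A₀ → A_k`, for `k` an object of the simplex category. -/
def degAt (A : SCRing.{u}) (k : SimplexCategoryᵒᵖ) : CHom (A.lev 0) (A.obj k) :=
  (A.map (SimplexCategory.const k.unop (SimplexCategory.mk 0) 0).op).hom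

theorem map_degAt (A : SCRing.{u}) {k l : SimplexCategoryᵒᵖ} (θ : k ⟶ l) (a : A.lev 0) :
    (A.map θ).hom (A.degAt k a) = A.degAt l a :=
  (ConcreteCategory.congr_hom (A.map_comp (SimplexCategory.const k.unop (SimplexCategory.mk 0) 0).op
    θ) a).symm

theorem app_degAt {A B : SCRing.{u}} (f : A ⟶ B) (k : SimplexCategoryᵒᵖ) (a : A.lev 0) :
    (f.app k).hom (A.degAt k a) = B.degAt k ((f.app _).hom a) :=
  ConcreteCategory.congr_hom (f.naturality _) a

/-- The topological space `Sp(A) = Sp(π₀(A))`. -/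
noncomputable def spTop (A : SCRing.{u}) : TopCat.{u} := TopCat.of (Sp A.PiZero)

/-- The value at `p ∈ Sp(A)` of an element of `A₀`. -/
noncomputable def value (A : SCRing.{u}) (p : A.spTop) : CHom (A.lev 0) ℝ :=
  (Sp.eval (A := A.PiZero) p).comp A.quot

/-- The set of elements of `A₀` that vanish at no point of `U`. -/
def inverted (A : SCRing.{u}) (U : Opens A.spTop) : Set (A.lev 0) :=
  {a | ∀ p ∈ U, A.value p a ≠ 0}

/-- The degeneracies in `A_k` of the elements of `A₀` that vanish at no point of `U`. -/
def invertedAt (A : SCRing.{u}) (U : Opens A.spTop) (k : SimplexCategoryᵒᵖ) : Set (A.obj k) :=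
  A.degAt k '' A.inverted U

theorem inverted_anti (A : SCRing.{u}) {U V : Opens A.spTop} (h : V ≤ U) {k : SimplexCategoryᵒᵖ} :
    ∀ a ∈ A.invertedAt U k, CHom.id _ a ∈ A.invertedAt V k := by
  rintro _ ⟨a, ha, rfl⟩
  exact ⟨a, fun p hp => ha p (h hp), rfl⟩

theorem map_mem_invertedAt (A : SCRing.{u}) (U : Opens A.spTop) {k l : SimplexCategoryᵒᵖ}
    (θ : k ⟶ l) : ∀ a ∈ A.invertedAt U k, (A.map θ).hom a ∈ A.invertedAt U l := by
  rintro _ ⟨a, ha, rfl⟩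
  exact ⟨a, ha, (A.map_degAt θ a).symm⟩

/-- The presheaf on `Sp(A)` whose value at `U` is the simplicial `C^∞`-ring obtained from `A` by
universally inverting the elements of `A₀` that vanish at no point of `U`, together with their
degeneracies. -/
noncomputable def locPresheaf (A : SCRing.{u}) : A.spTop.Presheaf SCRing.{u} where
  obj U :=
    { obj := fun k => CRing.of (Loc (A.obj k) (A.invertedAt U.unop k))
      map := fun θ => ⟨Loc.map (A.map θ).hom (A.map_mem_invertedAt U.unop θ)⟩
      map_id := fun k => CRing.Hom.ext (Loc.hom_ext fun a => by
        change Loc.of (A.invertedAt U.unop k) ((A.map (𝟙 k)).hom a) = Loc.of _ a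
        rw [A.map_id]; rfl)
      map_comp := fun θ χ => CRing.Hom.ext (Loc.hom_ext fun a => by
        change Loc.of (A.invertedAt U.unop _) ((A.map (θ ≫ χ)).hom a) = Loc.of _ _
        rw [A.map_comp]; rfl) }
  map i :=
    { app := fun k => ⟨Loc.map (CHom.id _) (A.inverted_anti (leOfHom i.unop))⟩
      naturality := fun _ _ _ => CRing.Hom.ext (Loc.hom_ext fun _ => rfl) }
  map_id _ := NatTrans.ext (funext fun _ => CRing.Hom.ext (Loc.hom_ext fun _ => rfl))
  map_comp _ _ := NatTrans.ext (funext fun _ => CRing.Hom.ext (Loc.hom_ext fun _ => rfl))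

/-- The space `Sp(A)` with the presheaf of localizations of `A`. -/
noncomputable def preSp (A : SCRing.{u}) : PresheafedSpace SCRing.{u} := ⟨A.spTop, A.locPresheaf⟩

/-- The continuous map of spectra induced by a morphism. -/
noncomputable def spMap {A B : SCRing.{u}} (f : A ⟶ B) : B.spTop ⟶ A.spTop :=
  TopCat.ofHom ⟨Sp.map (piZeroMap f), Sp.continuous_map _⟩

theorem value_spMap {A B : SCRing.{u}} (f : A ⟶ B) (q : B.spTop) (a : A.lev 0) :
    A.value (spMap f q) a = B.value q ((f.app _).hom a) :=
  congrArg (Sp.eval (A := B.PiZero) q) (piZeroMap_quot f a)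

theorem app_mem_invertedAt {A B : SCRing.{u}} (f : A ⟶ B) (U : Opens A.spTop)
    (k : SimplexCategoryᵒᵖ) : ∀ a ∈ A.invertedAt U k,
      (f.app k).hom a ∈ B.invertedAt ((Opens.map (spMap f)).obj U) k := by
  rintro _ ⟨a, ha, rfl⟩
  exact ⟨(f.app _).hom a, fun q hq => by rw [← value_spMap]; exact ha _ hq, (app_degAt f k a).symm⟩

/-- The morphism of presheafed spaces induced by a morphism of simplicial `C^∞`-rings. -/
noncomputable def preSpMap {A B : SCRing.{u}} (f : A ⟶ B) : B.preSp ⟶ A.preSp where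
  base := spMap f
  c :=
    { app := fun U =>
        { app := fun k => ⟨Loc.map (f.app k).hom (app_mem_invertedAt f U.unop k)⟩
          naturality := fun _ l θ => CRing.Hom.ext (Loc.hom_ext fun a =>
            congrArg (Loc.of (B.invertedAt ((Opens.map (spMap f)).obj U.unop) l))
              (ConcreteCategory.congr_hom (f.naturality θ) a)) }
      naturality := fun _ _ _ => NatTrans.ext (funext fun _ =>
        CRing.Hom.ext (Loc.hom_ext fun _ => rfl)) }

theorem locPresheaf_map_of (A : SCRing.{u}) {U V : (Opens A.spTop)ᵒᵖ} (i : U ⟶ V)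
    (k : SimplexCategoryᵒᵖ) (a : A.obj k) :
    ((A.locPresheaf.map i).app k).hom (Loc.of (A.invertedAt U.unop k) a) =
      Loc.of (A.invertedAt V.unop k) a := rfl

/-- The functor sending `A` to `Sp(A)` with its presheaf of localizations. -/
noncomputable def preSpFunctor : SCRing.{u}ᵒᵖ ⥤ PresheafedSpace SCRing.{u} where
  obj A := A.unop.preSp
  map f := preSpMap f.unop
  map_id A := by
    have w : spMap (𝟙 A.unop) = 𝟙 _ := by
      ext p
      exact CHom.hext fun x => congrArg (Sp.eval (A := A.unop.PiZero) p)
        (ConcreteCategory.congr_hom (piZero.map_id A.unop) x)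
    refine PresheafedSpace.ext _ _ w ?_
    exact NatTrans.ext (funext fun U => NatTrans.ext (funext fun k => CRing.Hom.ext
      (Loc.hom_ext fun a => rfl)))
  map_comp {A B C} f g := by
    have w : spMap (g.unop ≫ f.unop) = spMap f.unop ≫ spMap g.unop := by
      ext p
      exact CHom.hext fun x => congrArg (Sp.eval (A := A.unop.PiZero) p)
        (ConcreteCategory.congr_hom (piZero.map_comp g.unop f.unop) x)
    refine PresheafedSpace.ext _ _ w ?_
    exact NatTrans.ext (funext fun U => NatTrans.ext (funext fun k => CRing.Hom.ext
      (Loc.hom_ext fun a => rfl)))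

/-- The spectrum functor `A ↦ (Sp(A), O_{Sp(A)})`, where the structure sheaf is the sheaf associated
to the presheaf of localizations of `A`. -/
noncomputable def spectrum : SCRing.{u}ᵒᵖ ⥤ PresheafedSpace SCRing.{u} :=
  preSpFunctor ⋙ sheafification

end SCRing

/-! ### `C^∞`-spaces and simplicial `C^∞`-spaces -/

section Spaces

open AlgebraicGeometry

/-- A sheaf is soft if every section over a closed subset `Z` extends to a global section.  A
section over `Z` is a family of germs at the points of `Z` that is locally on `Z` given by sections
over open subsets. -/
def IsSoft {X : TopCat.{u}} (F : X.Presheaf CRing.{u}) : Prop :=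
  ∀ (Z : Set X), IsClosed Z → ∀ σ : ∀ x : X, x ∈ Z → Stalk F x,
    (∀ x ∈ Z, ∃ (U : Opens X) (_ : x ∈ U) (s : F.obj (op U)),
      ∀ (y : X) (hyU : y ∈ U) (hyZ : y ∈ Z), σ y hyZ = germ F hyU s) →
    ∃ s : F.obj (op ⊤), ∀ (y : X) (hyZ : y ∈ Z),
      germ F (show y ∈ (⊤ : Opens X) from trivial) s = σ y hyZ

/-- `(X, F)` is a `C^∞`-space: `X` is Hausdorff, and `F` is a soft sheaf of finitely generated
`C^∞`-rings whose stalks are local `C^∞`-rings. -/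
structure IsCInftySpace {X : TopCat.{u}} (F : X.Presheaf CRing.{u}) : Prop where
  t2 : T2Space X
  isSheaf : TopCat.Presheaf.IsSheaf (F ⋙ forget CRing.{u})
  isSoft : IsSoft F
  isFinitelyGenerated : ∀ U : Opens X, IsFinitelyGenerated (F.obj (op U))
  isLocal : ∀ x : X, IsLocalCRing (Stalk F x)

/-- The sheaf `π₀` of a presheaf `P` of simplicial `C^∞`-rings: the sheaf associated to
`U ↦ π₀(P(U))`. -/
noncomputable def piZeroSheaf {X : TopCat.{u}} (P : X.Presheaf SCRing.{u}) : X.Presheaf CRing.{u} :=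
  sheafify (P ⋙ SCRing.piZero)

/-- A simplicial `C^∞`-space: a topological space `X` with a sheaf `O` of simplicial `C^∞`-rings
(in each simplicial degree, a sheaf of sets) such that `(X, π₀(O))` is a `C^∞`-space. -/
def IsSimplicialCInftySpace : ObjectProperty (PresheafedSpace SCRing.{u}) := fun X =>
  (∀ k : SimplexCategoryᵒᵖ, TopCat.Presheaf.IsSheaf (level X.presheaf k ⋙ forget CRing.{u})) ∧
    IsCInftySpace (piZeroSheaf X.presheaf)

/-- A localized simplicial `C^∞`-space: the stalks of the sheaf of `0`-simplices are local. -/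
def IsLocalizedCInftySpace : ObjectProperty (PresheafedSpace SCRing.{u}) := fun X =>
  IsSimplicialCInftySpace X ∧
    ∀ x : X, IsLocalCRing (Stalk (level X.presheaf (op (SimplexCategory.mk 0))) x)

/-- The category of localized simplicial `C^∞`-spaces. -/
abbrev LocalizedSpace : Type (u + 1) := IsLocalizedCInftySpace.{u}.FullSubcategory

/-- The category of geometric simplicial `C^∞`-rings. -/
abbrev GeometricRing : Type (u + 1) := SCRing.IsGeometric.{u}.FullSubcategory

/-- The functor of global sections on localized simplicial `C^∞`-spaces, with values in geometric
simplicial `C^∞`-rings. -/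
def globalSections
    (h : ∀ X : LocalizedSpace.{u}, SCRing.IsGeometric (PresheafedSpace.Γ.obj (op X.obj))) :
    LocalizedSpace.{u} ⥤ GeometricRing.{u}ᵒᵖ :=
  (SCRing.IsGeometric.{u}.lift (IsLocalizedCInftySpace.{u}.ι.op ⋙ PresheafedSpace.Γ)
    fun X => h X.unop).rightOp

/-- The spectrum functor on geometric simplicial `C^∞`-rings, with values in localized simplicial
`C^∞`-spaces. -/
noncomputable def geometricSpectrum
    (h : ∀ A : GeometricRing.{u}, IsLocalizedCInftySpace (SCRing.spectrum.obj (op A.obj))) :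
    GeometricRing.{u}ᵒᵖ ⥤ LocalizedSpace.{u} :=
  IsLocalizedCInftySpace.{u}.lift (SCRing.IsGeometric.{u}.ι.op ⋙ SCRing.spectrum) fun A => h A.unop

end Spaces
end CInfty

/-! Two facts about smooth functions drive the proof.

Bump functions make localization at a point a quotient. A smooth function that does not vanish at a
point has a smooth inverse there, up to a bump function. Hence in a local `C^∞`-ring an expression
`f(x₁, …, xₙ)` depends only on the germ of `f` at the values of the `xᵢ` (`IsLocalCRing.hom_congr`).
Also, the relation "equal after multiplication with some `u`, `u(p) ≠ 0`" is a congruence for all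
smooth operations (`EqAt.op`). So the stalk at `p` of the structure sheaf of the spectrum is the
quotient of `A_k` by this relation, with `u` ranging over `A₀` (`spGerm_surjective`,
`spGerm_eq_iff`).

Partitions of unity make the sheaves fine. Finitely many generators of `π₀` embed the space as a
closed subset of some `ℝⁿ`. On a localized space `Y` the coordinates lift to global sections of `O₀`
(`exists_lift`), and a partition of unity on `ℝⁿ` then glues simplices of any degree whose germs are
constrained to affine subspaces (`fine_glue`). Having a prescribed boundary, and being a cycle of a
prescribed class, are such constraints. So homology commutes with global sections: `π₀(Γ)` is the
ring of global sections of the sheaf `π₀` (`kappa_bijective`), a class in `π_k(Γ)`, `k ≥ 1`, is zero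
iff its image in every stalk is, and locally finite sums of classes exist. This is geometricity. In
the other direction, `isCInftySpace_of_chart` turns the computation of the stalks into the axioms of
a `C^∞`-space.

For the adjunction, a morphism `Y → Sp(A)` is determined by `A → Γ(Y)`, because elements of `A` give
all germs on `Sp(A)`, and a local `C^∞`-ring has only one morphism to `ℝ`, which fixes the map on
points. Conversely, elements vanishing nowhere on an open set become units over its preimage, and
the universal property of the localization yields the morphism.

The unit is a homeomorphism because `Y` and `Sp(π₀(Γ))` have the same image in `ℝⁿ`. It is bijective
on stalks because germs on `Y` extend to global sections, and a global section with zero germ is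
killed by a bump function.

For the counit, `π₀` is injective by germ determination and surjective by gluing functions on `ℝⁿ`.
For `k ≥ 1` the class of a cycle in a stalk is its germ in the localized module, so uniqueness and
existence in the definition of a germ determined, locally complete module give injectivity and
surjectivity. Normalization of the Moore complex translates bijectivity on homology into a weak
equivalence (`isWeakEquivalence_of_bijective`). -/

namespace CInfty

open Topology Filter

/-! ### Smooth functions -/

namespace SmoothFn

/-- The constant function with value `c`. -/
def const (n : ℕ) (c : ℝ) : SmoothFn n := ⟨fun _ => c, (contDiff_const : ContDiff ℝ ∞ fun _ => c)⟩

theorem coe_sum {n : ℕ} {ι : Type*} (S : Finset ι) (ρ : ι → SmoothFn n) :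
    (∑ i ∈ S, ρ i).1 = ∑ i ∈ S, (ρ i).1 := map_sum (smoothSubring n).subtype ρ S

theorem sum_apply {n : ℕ} {ι : Type*} (S : Finset ι) (ρ : ι → SmoothFn n) (q : Fin n → ℝ) :
    (∑ i ∈ S, ρ i).1 q = ∑ i ∈ S, (ρ i).1 q := by
  rw [coe_sum, Finset.sum_apply]

/-- There are bump functions supported in any given neighbourhood. -/
theorem exists_bump {n : ℕ} {p : Fin n → ℝ} {s : Set (Fin n → ℝ)} (hs : s ∈ 𝓝 p) :
    ∃ u : SmoothFn n, tsupport u.1 ⊆ s ∧ u.1 =ᶠ[𝓝 p] 1 := by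
  obtain ⟨r, hr, h⟩ := Metric.nhds_basis_closedBall.mem_iff.1 hs
  let b : ContDiffBump p := ⟨r / 2, r, half_pos hr, half_lt_self hr⟩
  exact ⟨⟨b, (b.contDiff : ContDiff ℝ ∞ b)⟩, b.tsupport_eq.subset.trans h, b.eventuallyEq_one⟩

/-- A function that is smooth near the topological support of a smooth function `u` becomes smooth
after multiplication with `u`. -/
theorem contDiff_mul_of_tsupport {n : ℕ} (u : SmoothFn n) {g : (Fin n → ℝ) → ℝ}
    (hg : ∀ x ∈ tsupport u.1, ContDiffAt ℝ ∞ g x) : ContDiff ℝ ∞ fun x => u.1 x * g x := by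
  refine contDiff_iff_contDiffAt.2 fun x => ?_
  by_cases hx : x ∈ tsupport u.1
  · exact u.contDiff.contDiffAt.mul (hg x hx)
  · refine (contDiffAt_const (c := (0 : ℝ))).congr_of_eventuallyEq ?_
    filter_upwards [notMem_tsupport_iff_eventuallyEq.1 hx] with y hy
    rw [hy]; exact zero_mul _

/-- A local inverse of a smooth function at a point where it does not vanish. -/
theorem exists_local_inv {n : ℕ} (f : SmoothFn n) {p : Fin n → ℝ} (hp : f.1 p ≠ 0) :
    ∃ g : SmoothFn n, (f * g).1 =ᶠ[𝓝 p] 1 := by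
  obtain ⟨u, hu, hu'⟩ := exists_bump
    ((isOpen_ne_fun f.contDiff.continuous continuous_const).mem_nhds hp)
  refine ⟨⟨fun x => u.1 x * (f.1 x)⁻¹, u.contDiff_mul_of_tsupport fun x hx =>
    f.contDiff.contDiffAt.inv (hu hx)⟩, ?_⟩
  filter_upwards [hu', (isOpen_ne_fun f.contDiff.continuous continuous_const).mem_nhds hp]
    with x hx hx'
  change f.1 x * (u.1 x * (f.1 x)⁻¹) = 1
  rw [hx, Pi.one_apply, one_mul, mul_inv_cancel₀ hx']

/-- Two functions with the same germ at `p` agree after multiplication with a bump function. -/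
theorem exists_bump_mul_eq {n : ℕ} {f g : SmoothFn n} {p : Fin n → ℝ} (h : f.1 =ᶠ[𝓝 p] g.1) :
    ∃ u : SmoothFn n, u.1 p = 1 ∧ u * f = u * g := by
  -- The set where `f` and `g` agree is itself a neighbourhood of `p`, so it can contain the support
  -- of `u`.
  obtain ⟨u, hu, hu'⟩ := exists_bump h
  refine ⟨u, hu'.self_of_nhds, Subtype.ext (funext fun x => ?_)⟩
  change u.1 x * f.1 x = u.1 x * g.1 x
  by_cases hx : x ∈ tsupport u.1
  · have : f.1 x = g.1 x := hu hx
    rw [this]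
  · rw [image_eq_zero_of_notMem_tsupport hx, zero_mul, zero_mul]

end SmoothFn

/-! ### Free `C^∞`-rings and constants -/

section Basic

variable {A : Type u} [CInftyRing A] {B : Type v} [CInftyRing B]

/-- The morphism `C^∞(ℝⁿ) → A` carrying the coordinates to given elements. -/
def evalHom {n : ℕ} (x : Fin n → A) : CHom (SmoothFn n) A where
  toFun f := CInftyRing.op f x
  map_op f g := CInftyRing.op_comp f g x

theorem evalHom_apply {n : ℕ} (x : Fin n → A) (f : SmoothFn n) :
    evalHom x f = CInftyRing.op f x := rfl

theorem evalHom_proj {n : ℕ} (x : Fin n → A) (i : Fin n) : evalHom x (SmoothFn.proj i) = x i :=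
  CInftyRing.op_proj i x

/-- Every `f` is the operation `f` applied to the coordinates, so `C^∞(ℝⁿ)` is free on them and
morphisms out of it may be compared on coordinates. -/
theorem CHom.eq_evalHom {n : ℕ} (φ : CHom (SmoothFn n) A) :
    φ = evalHom fun i => φ (SmoothFn.proj i) :=
  CHom.hext fun f => φ.map_op' f SmoothFn.proj

theorem CHom.comp_apply {C : Type w} [CInftyRing C] (g : CHom B C) (f : CHom A B) (a : A) :
    (g.comp f) a = g (f a) := rfl

theorem CHom.eval_real {n : ℕ} (φ : CHom (SmoothFn n) ℝ) (f : SmoothFn n) :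
    φ f = f.1 fun i => φ (SmoothFn.proj i) := φ.map_op' f SmoothFn.proj

/-- Evaluation at a point of `ℝⁿ`. -/
def SmoothFn.evalAt {n : ℕ} (q : Fin n → ℝ) : CHom (SmoothFn n) ℝ := evalHom q

variable (A) in
/-- The element of a `C^∞`-ring given by a real number. -/
def cst (c : ℝ) : A := CInftyRing.op (SmoothFn.const 0 c) ![]

theorem map_cst (f : CHom A B) (c : ℝ) : f (cst A c) = cst B c := by
  rw [cst, f.map_op', cst]
  congr 1
  exact funext fun i => i.elim0

theorem cst_real (c : ℝ) : cst ℝ c = c := rfl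

/-- A surjective morphism together with a morphism killing its kernel. -/
theorem exists_factor {C : Type w} [CInftyRing C] (π : CHom A B) (hπ : Function.Surjective π)
    (f : CHom A C) (h : ∀ a, π a = 0 → f a = 0) : ∃ g : CHom B C, ∀ a, g (π a) = f a := by
  -- A set-theoretic section of `π` suffices: its choice is invisible to `f`, which kills the kernel
  -- of `π`.
  have key : ∀ a, f (Function.surjInv hπ (π a)) = f a := fun a => by
    rw [← sub_eq_zero, ← map_sub]
    refine h _ ?_
    rw [map_sub, Function.surjInv_eq hπ, sub_self]
  refine ⟨⟨fun b => f (Function.surjInv hπ b), fun {n} g x => ?_⟩, key⟩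
  have hx : x = fun i => π (Function.surjInv hπ (x i)) :=
    funext fun i => (Function.surjInv_eq hπ (x i)).symm
  rw [hx, ← π.map_op', key, f.map_op']
  simp only [key]

end Basic

/-! ### Local `C^∞`-rings -/

section Local

variable {A : Type u} [CInftyRing A]

/-- A proper ideal contains no unit, hence lies in the kernel of `ev`. Surjectivity of `ev` is
automatic, because constants exist in every `C^∞`-ring. -/
theorem isLocalCRing_of (ev : CHom A ℝ) (h : ∀ a, ev a ≠ 0 → IsUnit a) : IsLocalCRing A := by
  have hs : Function.Surjective ev := fun c => ⟨cst A c, map_cst ev c⟩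
  have hmax : (RingHom.ker ev.toRingHom).IsMaximal :=
    RingHom.ker_isMaximal_of_surjective ev.toRingHom hs
  refine ⟨RingHom.ker ev.toRingHom, fun I => ⟨fun hI => ?_, fun hI => hI ▸ hmax⟩, ev, hs, rfl⟩
  refine hI.eq_of_le hmax.ne_top fun a ha => ?_
  by_contra hne
  exact hI.ne_top (Ideal.eq_top_of_isUnit_mem I ha (h a hne))

namespace IsLocalCRing

/-- The residue morphism of a local `C^∞`-ring. -/
noncomputable def ev (h : IsLocalCRing A) : CHom A ℝ := h.choose_spec.2.choose

theorem isUnit_iff (h : IsLocalCRing A) {a : A} : IsUnit a ↔ h.ev a ≠ 0 := by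
  refine ⟨fun ha => (ha.map h.ev).ne_zero, fun ha => ?_⟩
  by_contra hu
  obtain ⟨M, hM, haM⟩ := exists_max_ideal_of_mem_nonunits hu
  have h₁ : M = h.choose := (h.choose_spec.1 M).1 hM
  have h₂ : RingHom.ker h.ev.toRingHom = h.choose := h.choose_spec.2.choose_spec.2
  rw [h₁, ← h₂] at haM
  exact ha haM

/-- The element `a - g(a)` is in the kernel of `g`, hence not a unit, so its residue vanishes. In
particular morphisms between local `C^∞`-rings respect residues without being required to. -/
theorem eq_ev (h : IsLocalCRing A) (g : CHom A ℝ) : g = h.ev := by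
  refine CHom.hext fun a => ?_
  by_contra hne
  have h₁ : h.ev (a - cst A (g a)) ≠ 0 := by
    rw [map_sub, map_cst, cst_real]
    exact sub_ne_zero.2 (Ne.symm hne)
  have h₂ := ((h.isUnit_iff.2 h₁).map g).ne_zero
  rw [map_sub, map_cst, cst_real, sub_self] at h₂
  exact h₂ rfl

/-- A nontrivial quotient of a local `C^∞`-ring is local. -/
theorem of_surjective {B : Type v} [CInftyRing B] (h : IsLocalCRing A) (π : CHom A B)
    (hπ : Function.Surjective π) [Nontrivial B] : IsLocalCRing B := by
  obtain ⟨g, hg⟩ := exists_factor π hπ h.ev fun a ha => by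
    by_contra hne
    exact ((h.isUnit_iff.2 hne).map π).ne_zero ha
  refine isLocalCRing_of g fun b hb => ?_
  obtain ⟨a, rfl⟩ := hπ b
  rw [hg] at hb
  exact (h.isUnit_iff.2 hb).map π

/-- In a local `C^∞`-ring, `f(x₁, …, xₙ)` depends only on the germ of `f` at the values of the
`xᵢ`. -/
theorem hom_congr (h : IsLocalCRing A) {n : ℕ} (φ : CHom (SmoothFn n) A) {f g : SmoothFn n}
    (hfg : f.1 =ᶠ[𝓝 fun i => h.ev (φ (SmoothFn.proj i))] g.1) : φ f = φ g := by
  obtain ⟨w, hw, e⟩ := SmoothFn.exists_bump_mul_eq hfg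
  -- The residue of `φ w` is the value of `w` at the point, namely `1`. So the bump function becomes
  -- a unit and can be cancelled.
  have hu : IsUnit (φ w) := h.isUnit_iff.2 (by
    rw [← CHom.comp_apply, CHom.eval_real]
    exact hw.trans_ne one_ne_zero)
  refine hu.mul_left_cancel ?_
  rw [← map_mul, ← map_mul, e]

end IsLocalCRing

end Local

/-! ### Localization at a point -/

section Point

variable {A : Type u} [CInftyRing A] {B : Type v} [CInftyRing B]

/-- An inverse, up to multiplication with an element not vanishing at `p`. -/
theorem exists_inv_at (p : CHom A ℝ) {a : A} (ha : p a ≠ 0) :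
    ∃ b u : A, p u ≠ 0 ∧ u * (a * b) = u := by
  -- It is enough to treat `t ↦ 1/t` near the nonzero number `p(a)`; the inverse `g` and the bump
  -- function `w` of one variable are then applied to `a`.
  obtain ⟨g, hg⟩ := SmoothFn.exists_local_inv (SmoothFn.proj 0 : SmoothFn 1) (p := ![p a]) ha
  obtain ⟨w, hw, e⟩ := SmoothFn.exists_bump_mul_eq (f := SmoothFn.proj 0 * g) (g := 1) hg
  refine ⟨evalHom ![a] g, evalHom ![a] w, ?_, ?_⟩
  · rw [← CHom.comp_apply, CHom.eval_real]
    have : (fun i => (p.comp (evalHom ![a])) (SmoothFn.proj i)) = ![p a] := by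
      funext i; fin_cases i; exact congrArg p (evalHom_proj ![a] 0)
    rw [this, hw]; exact one_ne_zero
  · have := congrArg (evalHom ![a]) e
    rw [map_mul, map_mul, map_mul, map_one, mul_one, evalHom_proj] at this
    exact this

/-- Two elements of an `A`-algebra `B` agree near `p` if they become equal after multiplication
with an element of `A` that does not vanish at `p`. -/
def EqAt (p : CHom A ℝ) (d : CHom A B) (x y : B) : Prop := ∃ u : A, p u ≠ 0 ∧ d u * x = d u * y

namespace EqAt

variable {p : CHom A ℝ} {d : CHom A B} {x y z : B}

theorem refl (x : B) : EqAt p d x x := ⟨1, by simp, rfl⟩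

theorem symm (h : EqAt p d x y) : EqAt p d y x := let ⟨u, hu, e⟩ := h; ⟨u, hu, e.symm⟩

theorem trans (h : EqAt p d x y) (h' : EqAt p d y z) : EqAt p d x z := by
  obtain ⟨u, hu, e⟩ := h
  obtain ⟨v, hv, e'⟩ := h'
  refine ⟨u * v, by rw [map_mul]; exact mul_ne_zero hu hv, ?_⟩
  rw [map_mul, mul_right_comm, e, mul_right_comm, mul_assoc, e', mul_assoc]

theorem exists_common {n : ℕ} {x y : Fin n → B} (h : ∀ i, EqAt p d (x i) (y i)) :
    ∃ u : A, p u ≠ 0 ∧ ∀ i, d u * x i = d u * y i := by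
  choose u hu e using h
  refine ⟨∏ i, u i, by rw [map_prod]; exact Finset.prod_ne_zero_iff.2 fun i _ => hu i, fun i => ?_⟩
  obtain ⟨c, hc⟩ := Finset.dvd_prod_of_mem u (Finset.mem_univ i)
  rw [hc, map_mul, mul_right_comm, e, mul_right_comm]

/-- The operation `f` is not linear, so `u` cannot be moved through it. Instead, take `k` and `w` in
one variable with `w(t) t k(t) = w(t)` and `w(p(u)) = 1`. Where `w(u)` does not vanish, `k(u)`
inverts `u` and `xᵢ = k(u) (u xᵢ)`. The multiplier for the conclusion is `w(u)`. -/
theorem op {n : ℕ} (f : SmoothFn n) {x y : Fin n → B} (h : ∀ i, EqAt p d (x i) (y i)) :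
    EqAt p d (CInftyRing.op f x) (CInftyRing.op f y) := by
  obtain ⟨u, hu, e⟩ := exists_common h
  obtain ⟨k, hk⟩ := SmoothFn.exists_local_inv (SmoothFn.proj 0 : SmoothFn 1) (p := ![p u]) hu
  obtain ⟨w, hw, e'⟩ := SmoothFn.exists_bump_mul_eq (f := SmoothFn.proj 0 * k) (g := 1) hk
  refine ⟨evalHom ![u] w, ?_, ?_⟩
  · rw [← CHom.comp_apply, CHom.eval_real]
    have : (fun i => (p.comp (evalHom ![u])) (SmoothFn.proj i)) = ![p u] := by
      funext i; fin_cases i; exact congrArg p (evalHom_proj ![u] 0)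
    rw [this, hw]; exact one_ne_zero
  -- the value `w(u) f(x)` depends only on `u` and on the products `u xᵢ`
  let w' : SmoothFn (n + 1) := SmoothFn.comp w ![SmoothFn.proj 0]
  let k' : SmoothFn (n + 1) := SmoothFn.comp k ![SmoothFn.proj 0]
  have key : ∀ x : Fin n → B, evalHom ![d u] w * CInftyRing.op f x =
      evalHom ![d u] w * CInftyRing.op f fun i => evalHom ![d u] k * (d u * x i) := fun x => by
    -- The required identity holds already between functions on `ℝⁿ⁺¹`, with coordinate `0` in the
    -- role of `u` and the others in the role of `x`. The morphism `E` specializes it to `B`.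
    let E : CHom (SmoothFn (n + 1)) B := evalHom (Fin.cons (d u) x)
    have h0 : E (SmoothFn.proj 0) = d u := evalHom_proj _ _
    have hE : ∀ g : SmoothFn 1, E (SmoothFn.comp g ![SmoothFn.proj 0]) = evalHom ![d u] g :=
      fun g => by
        refine (E.map_op' g ![SmoothFn.proj 0]).trans ?_
        rw [evalHom_apply]
        congr 1
        funext i; fin_cases i; exact h0
    have id : w' * SmoothFn.comp f (fun i => SmoothFn.proj i.succ) =
        w' * SmoothFn.comp f fun i => k' * (SmoothFn.proj 0 * SmoothFn.proj i.succ) := by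
      refine Subtype.ext (funext fun q => ?_)
      have hq := congrFun (congrArg Subtype.val e') ![q 0]
      change w.1 ![q 0] * (q 0 * k.1 ![q 0]) = w.1 ![q 0] * 1 at hq
      have hv : (fun i => (![SmoothFn.proj 0] : Fin 1 → SmoothFn (n + 1)) i |>.1 q) = ![q 0] := by
        funext i; fin_cases i; rfl
      change w.1 (fun i => (![SmoothFn.proj 0] : Fin 1 → SmoothFn (n + 1)) i |>.1 q) *
          f.1 (fun i => q i.succ) =
        w.1 (fun i => (![SmoothFn.proj 0] : Fin 1 → SmoothFn (n + 1)) i |>.1 q) *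
          f.1 fun i => k.1 (fun i => (![SmoothFn.proj 0] : Fin 1 → SmoothFn (n + 1)) i |>.1 q) *
            (q 0 * q i.succ)
      rw [hv]
      by_cases h0 : w.1 ![q 0] = 0
      · rw [h0, zero_mul, zero_mul]
      · have h1 := mul_left_cancel₀ h0 hq
        refine congrArg (w.1 ![q 0] * f.1 ·) (funext fun i => ?_)
        rw [← mul_assoc, mul_comm (k.1 _), h1, one_mul]
    have := congrArg E id
    have hfE : ∀ g : Fin n → SmoothFn (n + 1), E (SmoothFn.comp f g) =
        CInftyRing.op f fun i => E (g i) := fun g => E.map_op' f g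
    rw [map_mul, map_mul, hE, hfE, hfE] at this
    simp only [map_mul] at this
    rw [hE, h0] at this
    have hx : ∀ i : Fin n, E (SmoothFn.proj i.succ) = x i := fun i => evalHom_proj _ _
    simp only [hx] at this
    exact this
  have hd : d (evalHom ![u] w) = evalHom ![d u] w := by
    rw [evalHom_apply, d.map_op', evalHom_apply]
    congr 1
    funext i; fin_cases i; rfl
  rw [hd, key x, key y]
  simp only [e]

end EqAt

/-- An element of `A` representing a formal expression near the point `p`. -/
noncomputable def Loc.repr {T : Set B} (inv : B → B) : Loc.Term B T → B
  | .of a => a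
  | .inv a => inv a
  | .op _ f t => CInftyRing.op f fun i => Loc.repr inv (t i)

/-- By induction over the generation of the congruence: the relation for inverses is what `hinv`
supplies, closure under operations is `EqAt.op`, and the remaining generators become identities in
`B`. Thus equality in a localization implies equality in `B` near `p`. -/
theorem Loc.repr_rel {p : CHom A ℝ} {d : CHom A B} {T : Set B} {inv : B → B}
    (hinv : ∀ a ∈ T, EqAt p d (a * inv a) 1) {s t : Loc.Term B T} (h : Loc.Rel B T s t) :
    EqAt p d (Loc.repr inv s) (Loc.repr inv t) := by
  induction h with
  | refl t => exact .refl _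
  | symm s t _ ih => exact ih.symm
  | trans r s t _ _ ih ih' => exact ih.trans ih'
  | op n g s t _ ih => exact EqAt.op g ih
  | op_proj n i t => simp only [Loc.repr, CInftyRing.op_proj]; exact .refl _
  | op_comp m n g h t => simp only [Loc.repr, CInftyRing.op_comp]; exact .refl _
  | of_op n g x => simp only [Loc.repr]; exact .refl _
  | mul_inv a =>
    have e : (fun i => Loc.repr inv ((![.of a, .inv a] : Fin 2 → Loc.Term B T) i)) =
        ![(a : B), inv a] := by
      funext i; fin_cases i <;> rfl
    simp only [Loc.repr]
    rw [e, CInftyRing.op_mul]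
    exact hinv a a.2

end Point

end CInfty

namespace CInfty

open Topology Filter

/-! ### Sheaves of `C^∞`-rings -/

section Sheaf

variable {X : TopCat.{u}} (P : X.Presheaf CRing.{u})

theorem germHom_apply {U : Opens X} {x : X} (hx : x ∈ U) (s : P.obj (op U)) :
    germHom P hx s = germ P hx s := rfl

theorem sheafify_isSheaf : TopCat.Presheaf.IsSheaf (sheafify P ⋙ forget CRing.{u}) := by
  refine TopCat.Presheaf.isSheaf_of_isSheafUniqueGluing_types _ fun ι U sf hsf => ?_
  have hU : ∀ x : (iSup U : Opens X), ∃ i, x.1 ∈ U i := fun x => Opens.mem_iSup.1 x.2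
  choose i hi using hU
  have key : ∀ (a b : ι) (x : X) (ha : x ∈ U a) (hb : x ∈ U b),
      ShSec.val (sf a) ha = ShSec.val (sf b) hb := fun a b x ha hb =>
    congrArg (fun σ : ShSec P (U a ⊓ U b) => σ.val (x := x) ⟨ha, hb⟩) (hsf a b)
  refine ⟨⟨fun x => ShSec.val (sf (i x)) (hi x), fun x => ?_⟩, fun a => ?_, fun σ hσ => ?_⟩
  · obtain ⟨V, hV, hVU, s, hs⟩ := ShSec.exists_local (sf (i x)) (hi x)
    exact ⟨V, hV, hVU.trans (le_iSup U _), s, fun y hy => (key _ _ _ _ (hVU hy)).trans (hs y hy)⟩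
  · exact ShSec.ext fun x hx => key _ _ _ _ _
  · refine ShSec.ext fun x hx => ?_
    have := hσ (i ⟨x, hx⟩)
    exact congrArg (fun σ : ShSec P (U (i ⟨x, hx⟩)) => σ.val (hi ⟨x, hx⟩)) this

theorem stMap_toSheafify_val {U : Opens X} {x : X} (hx : x ∈ U) (σ : ShSec P U) :
    stMap (toSheafify P) x (σ.val hx) = germ (sheafify P) hx σ := by
  obtain ⟨V, hV, hVU, s, hs⟩ := σ.exists_local hx
  rw [hs x hV, stMap_germ]
  refine Eq.trans ?_ (germ_res (sheafify P) hVU hV σ)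
  exact congrArg (germ (sheafify P) hV) (ShSec.ext fun y hy => (hs y hy).symm)

theorem stMap_toSheafify_bijective (x : X) : Function.Bijective (stMap (toSheafify P) x) := by
  constructor
  · intro ξ ζ h
    obtain ⟨U, hU, s, rfl⟩ := exists_germ P x ξ
    obtain ⟨V, hV, t, rfl⟩ := exists_germ P x ζ
    rw [stMap_germ, stMap_germ] at h
    obtain ⟨W, hW, hWU, hWV, e⟩ := germ_eq (sheafify P) hU hV _ _ h
    exact congrArg (fun σ : ShSec P W => σ.val hW) e
  · intro ξ
    obtain ⟨U, hU, σ, rfl⟩ := exists_germ (sheafify P) x ξ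
    exact ⟨_, stMap_toSheafify_val P hU σ⟩

/-- The map of stalks as a morphism of `C^∞`-rings. -/
noncomputable def stHom {P Q : X.Presheaf CRing.{u}} (η : P ⟶ Q) (x : X) :
    CHom (Stalk P x) (Stalk Q x) := ⟨stMap η x, fun f ξ => stMap_op η x f ξ⟩

theorem stHom_germ {P Q : X.Presheaf CRing.{u}} (η : P ⟶ Q) {U : Opens X} {x : X} (hx : x ∈ U)
    (s : P.obj (op U)) : stHom η x (germ P hx s) = germ Q hx ((η.app (op U)).hom s) :=
  stMap_germ η hx s

variable {P}

theorem exists_isUnit_res {U : Opens X} {x : X} (hx : x ∈ U) (s : P.obj (op U))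
    (h : IsUnit (germ P hx s)) : ∃ (W : Opens X) (_ : x ∈ W) (hW : W ≤ U), IsUnit (res P hW s) := by
  obtain ⟨ξ, hξ⟩ := h.exists_right_inv
  obtain ⟨V, hV, t, rfl⟩ := exists_germ P x ξ
  have h₁ : x ∈ U ⊓ V := ⟨hx, hV⟩
  have e : germ P h₁ (res P inf_le_left s * res P inf_le_right t) = germ P h₁ 1 := by
    rw [← germHom_apply, map_mul, germHom_apply, germHom_apply, germ_res, germ_res, hξ,
      ← germHom_apply, map_one]
  obtain ⟨W, hW, hWU, _, e⟩ := germ_eq P h₁ h₁ _ _ e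
  rw [map_mul, map_one, res_res, res_res] at e
  exact ⟨W, hW, hWU.trans inf_le_left, IsUnit.of_mul_eq_one _ e⟩

variable (hP : TopCat.Presheaf.IsSheaf (P ⋙ forget CRing.{u}))

include hP in
theorem sec_ext {U : Opens X} {s t : P.obj (op U)}
    (h : ∀ (x : X) (hx : x ∈ U), germ P hx s = germ P hx t) : s = t :=
  TopCat.Presheaf.section_ext (C := Type u) ⟨P ⋙ forget CRing.{u}, hP⟩ U s t h

include hP in
theorem exists_sec {U : Opens X} (σ : ShSec P U) :
    ∃ s : P.obj (op U), ∀ (x : X) (hx : x ∈ U), germ P hx s = σ.val hx := by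
  choose V hV hVU s hs using fun x : U => σ.2 x
  obtain ⟨t, ht, -⟩ := TopCat.Sheaf.existsUnique_gluing' (C := Type u)
    ⟨P ⋙ forget CRing.{u}, hP⟩ V U (fun x => homOfLE (hVU x))
    (fun x hx => Opens.mem_iSup.2 ⟨⟨x, hx⟩, hV _⟩) s (fun i j =>
      sec_ext hP fun y hy => ((germ_res P inf_le_left hy _).trans ((hs i y hy.1).symm.trans
        (hs j y hy.2))).trans (germ_res P inf_le_right hy _).symm)
  refine ⟨t, fun x hx => ?_⟩
  have h1 := congrArg (germ P (hV ⟨x, hx⟩)) (ht ⟨x, hx⟩)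
  exact (germ_res P (hVU ⟨x, hx⟩) (hV ⟨x, hx⟩) t).symm.trans (h1.trans (hs ⟨x, hx⟩ x _).symm)

-- Being a unit is an open condition, and inverses are unique, so the inverses in the stalks come
-- locally from sections and glue.
include hP in
theorem isUnit_of_germ {U : Opens X} (s : P.obj (op U))
    (h : ∀ (x : X) (hx : x ∈ U), IsUnit (germ P hx s)) : IsUnit s := by
  obtain ⟨t, ht⟩ := exists_sec hP (U := U) ⟨fun x => Ring.inverse (germ P x.2 s), fun x => by
    obtain ⟨W, hW, hWU, hu⟩ := exists_isUnit_res x.2 s (h x.1 x.2)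
    refine ⟨W, hW, hWU, Ring.inverse (res P hWU s), fun y hy => ?_⟩
    have h₁ : germ P (hWU hy) s * germ P hy (Ring.inverse (res P hWU s)) = 1 := by
      rw [← germ_res P hWU hy, ← germHom_apply, ← germHom_apply, ← map_mul,
        Ring.mul_inverse_cancel _ hu, map_one]
    refine (h y (hWU hy)).mul_left_cancel ?_
    rw [h₁, Ring.mul_inverse_cancel _ (h y (hWU hy))]⟩
  refine IsUnit.of_mul_eq_one t (sec_ext hP fun x hx => ?_)
  rw [← germHom_apply, ← germHom_apply, map_mul, map_one, germHom_apply, germHom_apply, ht x hx]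
  exact Ring.mul_inverse_cancel _ (h x hx)

end Sheaf

/-! ### Stalks of simplicial presheaves -/

section StalkSC

variable {X : TopCat.{u}} (O : X.Presheaf SCRing.{u})

/-- The stalk of a presheaf of simplicial `C^∞`-rings. -/
noncomputable def stalkSC (x : X) : SCRing.{u} where
  obj k := CRing.of (Stalk (level O k) x)
  map θ := ⟨stHom (levelStr O θ) x⟩
  map_id k := CRing.hom_ext' fun ξ => by
    obtain ⟨V, hV, s, e⟩ := exists_germ _ x ξ
    change stHom (levelStr O (𝟙 k)) x ξ = ξ
    rw [← e, stHom_germ]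
    congr 1
    exact ConcreteCategory.congr_hom ((O.obj (op V)).map_id k) s
  map_comp θ χ := CRing.hom_ext' fun ξ => by
    change stHom (levelStr O (θ ≫ χ)) x ξ = stHom (levelStr O χ) x (stHom (levelStr O θ) x ξ)
    obtain ⟨V, hV, s, e⟩ := exists_germ _ x ξ
    rw [← e, stHom_germ, stHom_germ, stHom_germ]
    congr 1
    exact ConcreteCategory.congr_hom ((O.obj (op V)).map_comp θ χ) s

/-- Taking germs is a morphism of simplicial `C^∞`-rings. -/
noncomputable def germSC {U : Opens X} {x : X} (hx : x ∈ U) : O.obj (op U) ⟶ stalkSC O x where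
  app k := ⟨germHom (level O k) hx⟩
  naturality _ _ θ := CRing.hom_ext' fun s => (stHom_germ (levelStr O θ) hx s).symm

/-- The morphism of presheaves from the `0`-simplices to `π₀`. -/
noncomputable def toPi : level O (op (SimplexCategory.mk 0)) ⟶ O ⋙ SCRing.piZero where
  app U := ⟨(O.obj U).quot⟩
  naturality _ _ i := CRing.hom_ext' fun s => (SCRing.piZeroMap_quot (O.map i) s).symm

theorem toPi_germ {U : Opens X} {x : X} (hx : x ∈ U) (s : (O.obj (op U)).lev 0) :
    stHom (toPi O) x (germ (level O _) hx s) =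
      germ (O ⋙ SCRing.piZero) hx ((O.obj (op U)).quot s) := stHom_germ (toPi O) hx s

theorem toPi_surjective (x : X) : Function.Surjective (stHom (toPi O) x) := fun ξ => by
  obtain ⟨U, hU, s, rfl⟩ := exists_germ _ x ξ
  obtain ⟨a, rfl⟩ := (O.obj (op U)).quot_surjective s
  exact ⟨_, toPi_germ O hU a⟩

/-- Stalks commute with `π₀`: a germ that vanishes in `π₀` vanishes over some neighbourhood, where a
`1`-simplex witnesses this; taking the germ of the `1`-simplex, and conversely representing a germ
of one, moves between the two sides. -/
theorem toPi_eq_zero (x : X) (ξ : (stalkSC O x).lev 0) :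
    stHom (toPi O) x ξ = 0 ↔ ξ ∈ (stalkSC O x).piZeroIdeal := by
  constructor
  · intro h
    obtain ⟨U, hU, s, e⟩ := exists_germ (level O (op (SimplexCategory.mk 0))) x ξ
    replace h := (toPi_germ O hU s).symm.trans ((congrArg _ e).trans h)
    have h0 : germ (O ⋙ SCRing.piZero) hU 0 = 0 := map_zero (germHom (O ⋙ SCRing.piZero) hU)
    obtain ⟨W, hW, hWU, _, e'⟩ := germ_eq (O ⋙ SCRing.piZero) hU hU _ _ (h.trans h0.symm)
    rw [map_zero] at e'
    have e'' : (O.obj (op W)).quot (res (level O _) hWU s) = 0 :=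
      (SCRing.piZeroMap_quot (O.map (homOfLE hWU).op) s).symm.trans e'
    obtain ⟨y, hy⟩ := (O.obj (op W)).quot_eq.1 (e''.trans (map_zero (O.obj (op W)).quot).symm)
    replace hy := hy.trans (sub_zero _)
    refine ⟨germ (level O _) hW y, ?_⟩
    refine Eq.trans ?_ ((germ_res (level O _) hWU hW s).trans e)
    rw [← hy]
    have m := SCRing.map_str (germSC O hW) (k := 1) (m := 0)
    refine (congrArg₂ (· - ·) (m (SimplexCategory.δ 0) y).symm
      (m (SimplexCategory.δ 1) y).symm).trans ?_
    exact (map_sub (germHom (level O _) hW) _ _).symm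
  · rintro ⟨η, rfl⟩
    obtain ⟨U, hU, y, e⟩ := exists_germ (level O (op (SimplexCategory.mk 1))) x η
    have m := fun θ => SCRing.map_str (germSC O hU) (k := 1) (m := 0) θ y
    have e₀ : ∀ i : Fin 2, stHom (toPi O) x ((stalkSC O x).d i η) =
        germ (O ⋙ SCRing.piZero) hU ((O.obj (op U)).quot ((O.obj (op U)).d i y)) := fun i =>
      (congrArg (stHom (toPi O) x) ((congrArg ((stalkSC O x).d i) e.symm).trans
        (m (SimplexCategory.δ i)).symm)).trans (toPi_germ O hU _)
    refine (map_sub (stHom (toPi O) x) _ _).trans (sub_eq_zero.2 ((e₀ 0).trans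
      (Eq.trans ?_ (e₀ 1).symm)))
    exact congrArg _ ((O.obj (op U)).quot_eq.2 ⟨y, rfl⟩)

end StalkSC

end CInfty

namespace CInfty

open Topology Filter

/-! ### Partitions of unity -/

section Partition

open scoped Manifold

variable {X : TopCat.{u}} {U : Opens X} {n : ℕ} {j : X → Fin n → ℝ}

/-- A smooth partition of unity on `ℝⁿ` restricts to a partition of unity subordinate to a given
cover of a space embedded as a closed subset. -/
theorem exists_partition (hj : IsClosedEmbedding fun x : U => j x) (W : U → Opens X)
    (hW : ∀ x, x.1 ∈ W x) :
    ∃ ρ : U → SmoothFn n, LocallyFinite (fun x => Function.support (ρ x).1) ∧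
      ∀ y₀ ∈ U, ∃ V : Opens X, y₀ ∈ V ∧ V ≤ U ∧ ∃ S : Finset U, (∀ x ∈ S, V ≤ W x) ∧
        ∀ y ∈ V, ∀ᶠ q in 𝓝 (j y), (∀ x ∉ S, (ρ x).1 q = 0) ∧ ∑ x ∈ S, (ρ x).1 q = 1 := by
  classical
  have hO : ∀ x : U, ∃ O : Set (Fin n → ℝ), IsOpen O ∧
      (fun x : U => j x) ⁻¹' O = {y : U | y.1 ∈ W x} := fun x =>
    hj.isInducing.isOpen_iff.1 ((W x).2.preimage continuous_subtype_val)
  choose O hO hOW using hO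
  -- The index `none` stands for the complement of the closed image. Its member of the partition
  -- vanishes near the image, so the others still add up to `1` there.
  let O' : Option U → Set (Fin n → ℝ) := fun i => i.elim (Set.range fun x : U => j x)ᶜ O
  obtain ⟨f, hf⟩ := SmoothPartitionOfUnity.exists_isSubordinate (ι := Option U)
    𝓘(ℝ, Fin n → ℝ) (isClosed_univ (X := Fin n → ℝ)) O'
    (by
      rintro (_ | x)
      · exact hj.isClosed_range.isOpen_compl
      · exact hO x)
    (fun q _ => by
      by_cases hq : q ∈ Set.range fun x : U => j x
      · obtain ⟨x, rfl⟩ := hq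
        have : x ∈ {y : U | y.1 ∈ W x} := hW x
        rw [← hOW x] at this
        exact Set.mem_iUnion.2 ⟨some x, this⟩
      · exact Set.mem_iUnion.2 ⟨none, hq⟩)
  refine ⟨fun x => ⟨f (some x), (f (some x)).contMDiff.contDiff⟩,
    f.locallyFinite.comp_injective (Option.some_injective _), fun y₀ hy₀ => ?_⟩
  obtain ⟨N, hN, hfin⟩ := f.locallyFinite (j y₀)
  -- On `N'` only those members are nonzero whose closed support contains `j y₀`. The identities
  -- therefore hold on an open subset of `ℝⁿ`, and not only along the image, as is needed for germs
  -- of functions on `ℝⁿ`.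
  let N' := interior N ∩ ⋂ i ∈ {i ∈ hfin.toFinset | j y₀ ∉ tsupport (f i)}, (tsupport (f i))ᶜ
  have hN'o : IsOpen N' := isOpen_interior.inter
    (isOpen_biInter_finset fun i _ => (isClosed_tsupport _).isOpen_compl)
  have hN'm : j y₀ ∈ N' := ⟨mem_interior_iff_mem_nhds.2 hN, by simp⟩
  let S : Finset U := ({i ∈ hfin.toFinset | j y₀ ∈ tsupport (f i)}).eraseNone
  have hzero : ∀ q ∈ N', ∀ i : Option U, j y₀ ∉ tsupport (f i) ∨ i ∉ hfin.toFinset → f i q = 0 := by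
    rintro q ⟨hq, hq'⟩ i hi
    by_cases hi' : i ∈ hfin.toFinset
    · have h1 := hi.resolve_right (not_not.2 hi')
      exact image_eq_zero_of_notMem_tsupport
        (Set.mem_iInter₂.1 hq' i (Finset.mem_filter.2 ⟨hi', h1⟩))
    · by_contra hne
      exact hi' (hfin.mem_toFinset.2 ⟨q, hne, interior_subset hq⟩)
  have hSW : ∀ x ∈ S, y₀ ∈ W x := fun x hx => by
    have h1 : j y₀ ∈ O x :=
      hf (some x) (Finset.mem_filter.1 (Finset.mem_eraseNone.1 hx)).2
    have : (⟨y₀, hy₀⟩ : U) ∈ (fun x : U => j x) ⁻¹' O x := h1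
    rw [hOW] at this
    exact this
  have hVo : IsOpen (Subtype.val '' ((fun x : U => j x) ⁻¹' N')) :=
    U.2.isOpenMap_subtype_val _ (hN'o.preimage hj.continuous)
  refine ⟨⟨Subtype.val '' ((fun x : U => j x) ⁻¹' N') ∩ ⋂ x ∈ S, (W x : Set X),
    hVo.inter (isOpen_biInter_finset fun x _ => (W x).2)⟩, ⟨⟨⟨y₀, hy₀⟩, hN'm, rfl⟩,
      Set.mem_iInter₂.2 hSW⟩, ?_, S, fun x hx y hy => Set.mem_iInter₂.1 hy.2 x hx, ?_⟩
  · rintro _ ⟨⟨y, -, rfl⟩, -⟩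
    exact y.2
  · rintro _ ⟨⟨y, hy, rfl⟩, -⟩
    filter_upwards [hN'o.mem_nhds hy] with q hq
    have h0 : ∀ x ∉ S, f (some x) q = 0 := fun x hx => hzero q hq _ (by
      by_contra! h
      exact hx (Finset.mem_eraseNone.2 (Finset.mem_filter.2 ⟨h.2, h.1⟩)))
    refine ⟨h0, ?_⟩
    have hnone : f none q = 0 := hzero q hq _ (Or.inl fun h => hf none h ⟨⟨y₀, hy₀⟩, rfl⟩)
    rw [← f.sum_eq_one (Set.mem_univ q), finsum_eq_sum_of_support_subset (s := S.map .some)]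
    · exact (Finset.sum_map S Function.Embedding.some fun i => f i q).symm
    · rintro (_ | x) hx
      · exact (hx hnone).elim
      · by_contra h
        exact hx (h0 x fun hS => h (by simpa using hS))

/-- Gluing of sections of a sheaf by means of a partition of unity: sections with values in
given sets of germs exist if they exist locally, provided that these sets are closed under the
relevant affine combinations. -/
theorem exists_glue (P : X.Presheaf CRing.{u}) (hj : IsClosedEmbedding fun x : U => j x)
    (C : ∀ x : X, Set (Stalk P x)) (D : ∀ x : X, Set (SmoothFn n → Stalk P x))
    (hloc : ∀ x ∈ U, ∃ (W : Opens X) (_ : x ∈ W) (τ : SmoothFn n → P.obj (op W)),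
      ∀ (y : X) (hy : y ∈ W), y ∈ U → (fun f => germ P hy (τ f)) ∈ D y)
    (h0 : ∀ y ∈ U, ∀ τ ∈ D y, ∀ f : SmoothFn n, f.1 =ᶠ[𝓝 (j y)] 0 → τ f = 0)
    (hC : ∀ y ∈ U, ∀ (S : Finset U) (ρ : U → SmoothFn n) (τ : U → SmoothFn n → Stalk P y),
      (∀ i ∈ S, τ i ∈ D y) → (∑ i ∈ S, ρ i).1 =ᶠ[𝓝 (j y)] 1 → ∑ i ∈ S, τ i (ρ i) ∈ C y) :
    ∃ σ : ShSec P U, ∀ (y : X) (hy : y ∈ U), σ.val hy ∈ C y := by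
  classical
  -- `τ x f` should be read as a section near `x` multiplied by `f`. How `f` acts is left to `D`,
  -- since in `exists_lift` there is no global action yet and `f` is applied to local lifts of the
  -- coordinates.
  choose W hW τ hτ using fun x : U => hloc x.1 x.2
  obtain ⟨ρ, -, h⟩ := exists_partition hj W hW
  -- Extension by zero outside `W x`. Near any given point only indices in a finite set `S`, whose
  -- `W x` contain the neighbourhood, contribute, so the default value does no harm.
  let g : ∀ (y : X) (x : U), Stalk P y := fun y x =>
    if hy : y ∈ W x then germ P hy (τ x (ρ x)) else 0
  have hg : ∀ y₀ ∈ U, ∃ V : Opens X, y₀ ∈ V ∧ V ≤ U ∧ ∃ S : Finset U, (∀ x ∈ S, V ≤ W x) ∧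
      ∀ y ∈ V, ∑ᶠ x, g y x = ∑ x ∈ S, g y x ∧ (∑ x ∈ S, ρ x).1 =ᶠ[𝓝 (j y)] 1 := by
    intro y₀ hy₀
    obtain ⟨V, hV, hVU, S, hS, hρ⟩ := h y₀ hy₀
    refine ⟨V, hV, hVU, S, hS, fun y hy => ⟨?_, ?_⟩⟩
    · refine finsum_eq_sum_of_support_subset _ fun x hx => ?_
      by_contra hxS
      refine hx ?_
      by_cases hyx : y ∈ W x
      · refine (dif_pos hyx).trans (h0 y (hVU hy) _ (hτ x y hyx (hVU hy)) (ρ x) ?_)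
        filter_upwards [hρ y hy] with q hq
        exact hq.1 x hxS
      · exact dif_neg hyx
    · filter_upwards [hρ y hy] with q hq
      rw [SmoothFn.sum_apply, hq.2]; rfl
  refine ⟨⟨fun y => ∑ᶠ x, g y.1 x, fun y₀ => ?_⟩, fun y hy => ?_⟩
  · obtain ⟨V, hV, hVU, S, hS, hg⟩ := hg y₀.1 y₀.2
    refine ⟨V, hV, hVU, ∑ x ∈ S.attach, res P (hS x.1 x.2) (τ x (ρ x)), fun y hy => ?_⟩
    rw [← germHom_apply, map_sum]
    refine (hg y hy).1.trans ?_
    rw [← Finset.sum_attach]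
    refine Finset.sum_congr rfl fun x _ => ?_
    rw [germHom_apply, germ_res]
    exact dif_pos (hS x.1 x.2 hy)
  · obtain ⟨V, hV, hVU, S, hS, hg⟩ := hg y hy
    obtain ⟨e, e'⟩ := hg y hV
    change ∑ᶠ x, g y x ∈ C y
    rw [e]
    refine hC y hy S ρ (fun x f => if hy : y ∈ W x then germ P hy (τ x f) else 0)
      (fun x hx => ?_) e'
    have hyx := hS x hx hV
    simp only [dif_pos hyx]
    exact hτ x y hyx hy

/-- Gluing of smooth functions by means of a partition of unity. -/
theorem exists_smooth_glue (hj : IsClosedEmbedding fun x : U => j x)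
    (C : X → Set (SmoothFn n))
    (hloc : ∀ x ∈ U, ∃ W : Opens X, x ∈ W ∧ ∃ g : SmoothFn n, ∀ y ∈ W, y ∈ U → g ∈ C y)
    (hC : ∀ y ∈ U, ∀ (S : Finset U) (ρ g : U → SmoothFn n) (h : SmoothFn n),
      (∀ i ∈ S, g i ∈ C y) → (∑ i ∈ S, ρ i).1 =ᶠ[𝓝 (j y)] 1 →
      h.1 =ᶠ[𝓝 (j y)] (∑ i ∈ S, ρ i * g i : SmoothFn n).1 → h ∈ C y) :
    ∃ g : SmoothFn n, ∀ y ∈ U, g ∈ C y := by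
  choose W hW g hg using fun x : U => hloc x.1 x.2
  obtain ⟨ρ, hfin, h⟩ := exists_partition hj W hW
  have hfin' : LocallyFinite fun x => Function.support (ρ x * g x : SmoothFn n).1 :=
    hfin.subset fun x q hq => left_ne_zero_of_mul hq
  have hsm : ContDiff ℝ ∞ fun q => ∑ᶠ x, (ρ x * g x : SmoothFn n).1 q := by
    refine ContMDiff.contDiff (contMDiff_finsum (fun x => ?_) hfin')
    exact (ρ x * g x : SmoothFn n).contDiff.contMDiff
  refine ⟨⟨_, hsm⟩, fun y hy => ?_⟩
  obtain ⟨V, hV, hVU, S, hS, hρ⟩ := h y hy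
  refine hC y hy S ρ g _ (fun x hx => hg x y (hS x hx hV) hy) ?_ ?_
  · filter_upwards [hρ y hV] with q hq
    rw [SmoothFn.sum_apply, hq.2]; rfl
  · filter_upwards [hρ y hV] with q hq
    rw [SmoothFn.sum_apply]
    refine finsum_eq_sum_of_support_subset _ fun x hx => ?_
    by_contra hxS
    exact hx (by change (ρ x).1 q * (g x).1 q = 0; rw [hq.1 x hxS, zero_mul])

end Partition

end CInfty

namespace CInfty

open Topology Filter

/-! ### The Moore complex -/

namespace SCRing

variable {A B : SCRing.{u}} (f : A ⟶ B)

/-- The map induced on `k`-simplices. -/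
def lmap (f : A ⟶ B) (k : ℕ) : CHom (A.lev k) (B.lev k) := (f.app (op (SimplexCategory.mk k))).hom

theorem lmap_str {m k : ℕ} (θ : SimplexCategory.mk m ⟶ SimplexCategory.mk k) (x : A.lev k) :
    lmap f m (A.str θ x) = B.str θ (lmap f k x) := map_str f θ x

/-- The map induced on `k`-simplices, as an additive map. -/
def smap (f : A ⟶ B) (k : ℕ) : A.Simplices k →+ B.Simplices k where
  toFun := lmap f k
  map_zero' := map_zero (lmap f k)
  map_add' := map_add (lmap f k)

theorem smap_smul (k : ℕ) (a : A.lev 0) (x : A.Simplices k) :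
    smap f k (a • x) = lmap f 0 a • smap f k x :=
  (map_mul (lmap f k) _ _).trans (congrArg (· * lmap f k x) (lmap_str f _ a))

theorem smap_moore (k : ℕ) (x : A.Simplices (k + 1)) :
    smap f k (A.moore k x) = B.moore k (smap f (k + 1) x) := by
  rw [moore, moore, LinearMap.sum_apply, LinearMap.sum_apply, map_sum]
  refine Finset.sum_congr rfl fun i _ => ?_
  rw [LinearMap.smul_apply, LinearMap.smul_apply, map_zsmul]
  exact congrArg _ (lmap_str f (SimplexCategory.δ i) x)

theorem moore_zero_apply (y : A.Simplices 1) :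
    A.moore 0 y = (A.d 0 y - A.d 1 y : A.lev 0) := by
  rw [moore_apply, Fin.sum_univ_two]
  simp only [Fin.val_zero, Fin.val_one, pow_zero, pow_one, one_mul, neg_one_mul, sub_eq_add_neg]
  rfl

/-- The homology class of a cycle. -/
def cls (A : SCRing.{u}) (k : ℕ) : LinearMap.ker (A.moore k) →ₗ[A.lev 0] A.PiSucc k :=
  Submodule.mkQ _

theorem cls_surjective (k : ℕ) : Function.Surjective (A.cls k) := Submodule.mkQ_surjective _

theorem cls_eq_zero {k : ℕ} (z : LinearMap.ker (A.moore k)) :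
    A.cls k z = 0 ↔ ∃ w, A.moore (k + 1) w = z.1 :=
  Submodule.Quotient.mk_eq_zero _

/-- The image of a cycle. -/
def kmap (f : A ⟶ B) (k : ℕ) : LinearMap.ker (A.moore k) →+ LinearMap.ker (B.moore k) where
  toFun z := ⟨smap f (k + 1) z.1, by
    rw [LinearMap.mem_ker, ← smap_moore, LinearMap.mem_ker.1 z.2, map_zero]⟩
  map_zero' := Subtype.ext (map_zero _)
  map_add' _ _ := Subtype.ext (map_add _ _ _)

/-- The map induced on homotopy modules. -/
noncomputable def piMap (f : A ⟶ B) (k : ℕ) : A.PiSucc k →+ B.PiSucc k :=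
  QuotientAddGroup.lift _ ((B.cls k).toAddMonoidHom.comp (kmap f k)) fun z hz => by
    obtain ⟨w, hw⟩ := hz
    refine (cls_eq_zero _).2 ⟨smap f _ w, ?_⟩
    rw [← smap_moore, hw]; rfl

theorem piMap_cls (k : ℕ) (z : LinearMap.ker (A.moore k)) :
    piMap f k (A.cls k z) = B.cls k (kmap f k z) := rfl

theorem piMap_smul (k : ℕ) (a : A.lev 0) (m : A.PiSucc k) :
    piMap f k (a • m) = lmap f 0 a • piMap f k m := by
  obtain ⟨z, rfl⟩ := cls_surjective k m
  rw [← map_smul, piMap_cls, piMap_cls, ← map_smul]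
  exact congrArg (B.cls k) (Subtype.ext (smap_smul f (k + 1) a z.1))

/-- The annihilating element of `π₀(A)` is lifted to `A₀`, so that vanishing of germs can be tested
on simplices. -/
theorem moduleGerm_eq_zero {k : ℕ} (p : Sp A.PiZero) (m : A.PiSucc k) :
    moduleGerm p m = 0 ↔ ∃ a : A.lev 0, p.eval (A.quot a) ≠ 0 ∧ a • m = 0 := by
  have : IsLocalizedModule p.nonvanishing (moduleGerm (M := A.PiSucc k) p) :=
    inferInstanceAs (IsLocalizedModule _ (LocalizedModule.mkLinearMap _ _))
  refine (IsLocalizedModule.eq_zero_iff p.nonvanishing (moduleGerm p)).trans ⟨?_, ?_⟩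
  · rintro ⟨⟨c, hc⟩, e⟩
    obtain ⟨a, rfl⟩ := A.quot_surjective c
    exact ⟨a, hc, e⟩
  · rintro ⟨a, ha, e⟩
    exact ⟨⟨A.quot a, ha⟩, e⟩

end SCRing

end CInfty

namespace CInfty

open Topology Filter

/-! ### Embeddings into `ℝⁿ` -/

section Chart

/-- A map to `ℝⁿ` is inducing if the sets on which `f ∘ j` does not vanish, for `f` smooth, form a
basis of the topology. -/
theorem isInducing_of_smooth {X : Type*} [TopologicalSpace X] {n : ℕ} (j : X → Fin n → ℝ)
    (ho : ∀ f : SmoothFn n, IsOpen {x | f.1 (j x) ≠ 0})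
    (hb : ∀ U : Set X, IsOpen U → ∀ x ∈ U, ∃ f : SmoothFn n, f.1 (j x) ≠ 0 ∧
      ∀ y, f.1 (j y) ≠ 0 → y ∈ U) : IsInducing j := by
  refine isInducing_iff_nhds.2 fun x => le_antisymm ?_ ?_
  · refine map_le_iff_le_comap.1 fun V hV => ?_
    obtain ⟨f, hf, hf'⟩ := SmoothFn.exists_bump hV
    refine mem_map.2 (mem_of_superset ((ho f).mem_nhds ?_) fun y hy => ?_)
    · change f.1 (j x) ≠ 0
      rw [hf'.self_of_nhds]; exact one_ne_zero
    · exact hf (subset_tsupport _ hy)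
  · intro U hU
    obtain ⟨f, hf, h⟩ := hb (interior U) isOpen_interior x (mem_interior_iff_mem_nhds.2 hU)
    exact ⟨{q | f.1 q ≠ 0},
      (isOpen_ne_fun f.contDiff.continuous continuous_const).mem_nhds hf,
      fun y hy => interior_subset (h y hy)⟩

theorem isClosed_zeros {A : Type u} [CInftyRing A] {n : ℕ} (φ : CHom (SmoothFn n) A) :
    IsClosed {q : Fin n → ℝ | ∀ f, φ f = 0 → f.1 q = 0} := by
  have : {q : Fin n → ℝ | ∀ f, φ f = 0 → f.1 q = 0} =
      ⋂ (f : SmoothFn n) (_ : φ f = 0), {q | f.1 q = 0} := by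
    ext q; simp
  rw [this]
  exact isClosed_iInter fun f => isClosed_iInter fun _ =>
    isClosed_eq f.contDiff.continuous continuous_const

/-- The sum of the squares of the `xᵢ - qᵢ`. -/
def SmoothFn.distSq {n : ℕ} (q : Fin n → ℝ) : SmoothFn n :=
  ∑ i, (SmoothFn.proj i - SmoothFn.const n (q i)) ^ 2

theorem SmoothFn.distSq_apply {n : ℕ} (q x : Fin n → ℝ) :
    (SmoothFn.distSq q).1 x = ∑ i, (x i - q i) ^ 2 := SmoothFn.sum_apply _ _ _

theorem SmoothFn.distSq_eq_zero {n : ℕ} {q x : Fin n → ℝ} :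
    (SmoothFn.distSq q).1 x = 0 ↔ x = q := by
  rw [distSq_apply, Finset.sum_eq_zero_iff_of_nonneg fun i _ => sq_nonneg _]
  simp [funext_iff, sub_eq_zero]

namespace IsCInftySpace

variable {X : TopCat.{u}} {F : X.Presheaf CRing.{u}} (h : IsCInftySpace F)

/-- The value of a global section at a point. -/
noncomputable def val (x : X) : CHom (F.obj (op ⊤)) ℝ :=
  (h.isLocal x).ev.comp (germHom F (show x ∈ (⊤ : Opens X) from trivial))

theorem val_apply (x : X) (s : F.obj (op ⊤)) :
    h.val x s = (h.isLocal x).ev (germ F (show x ∈ (⊤ : Opens X) from trivial) s) := rfl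

theorem isOpen_val_ne_zero (s : F.obj (op ⊤)) : IsOpen {x | h.val x s ≠ 0} := by
  refine isOpen_iff_mem_nhds.2 fun x hx => ?_
  obtain ⟨W, hW, hWU, hu⟩ := exists_isUnit_res _ s ((h.isLocal x).isUnit_iff.2 hx)
  refine mem_of_superset (W.2.mem_nhds hW) fun y hy => ?_
  refine (h.isLocal y).isUnit_iff.1 ?_
  have := hu.map (germHom F hy)
  rwa [germHom_apply, germ_res] at this

-- Softness is applied to the closed set `{x} ∪ Uᶜ`, with germ `1` at `x` and `0` on `Uᶜ`. This is
-- how the axioms of a `C^∞`-space force its topology to be given by functions.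
include h in
theorem exists_separating {U : Set X} (hU : IsOpen U) {x : X} (hx : x ∈ U) :
    ∃ s : F.obj (op ⊤), h.val x s ≠ 0 ∧ ∀ y, h.val y s ≠ 0 → y ∈ U := by
  classical
  have := h.t2
  obtain ⟨s, hs⟩ := h.isSoft ({x} ∪ Uᶜ) (isClosed_singleton.union hU.isClosed_compl)
    (fun y _ => if y = x then 1 else 0) (fun y hy => by
      by_cases hyx : y = x
      · refine ⟨⟨U, hU⟩, hyx ▸ hx, 1, fun z hzU hz => ?_⟩
        have : z = x := hz.resolve_right fun h => h hzU
        rw [if_pos this]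
        exact (map_one (germHom F hzU)).symm
      · refine ⟨⟨{x}ᶜ, isClosed_singleton.isOpen_compl⟩, hyx, 0, fun z hzU hz => ?_⟩
        rw [if_neg (show ¬ z = x from hzU)]
        exact (map_zero (germHom F hzU)).symm)
  refine ⟨s, ?_, fun y hy => ?_⟩
  · rw [val_apply, hs x (Or.inl rfl), if_pos rfl, map_one]
    exact one_ne_zero
  · by_contra hyU
    refine hy ?_
    rw [val_apply, hs y (Or.inr hyU), if_neg (show ¬ y = x from fun e => hyU (e ▸ hx)), map_zero]

variable {n : ℕ} (φ : CHom (SmoothFn n) (F.obj (op ⊤)))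

/-- The map to `ℝⁿ` given by global sections. -/
noncomputable def chart (x : X) (i : Fin n) : ℝ := h.val x (φ (SmoothFn.proj i))

theorem val_chart (x : X) (f : SmoothFn n) : h.val x (φ f) = f.1 (h.chart φ x) :=
  CHom.eval_real ((h.val x).comp φ) f

/-- If `q` were missed, the sum of squares of the `φ(xᵢ) - qᵢ` would vanish at no point and be a
unit, with inverse `φ g` say. Then `distSq q * g - 1` would lie in the kernel of `φ` and have the
value `-1` at `q`. -/
theorem exists_chart_eq (hφ : Function.Surjective φ) (q : Fin n → ℝ) (hq : ∀ f, φ f = 0 → f.1 q = 0) :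
    ∃ x, h.chart φ x = q := by
  by_contra! hne
  have hu : IsUnit (φ (SmoothFn.distSq q)) := isUnit_of_germ h.isSheaf _ fun x hx => by
    refine (h.isLocal x).isUnit_iff.2 fun h0 => hne x ?_
    rw [← SmoothFn.distSq_eq_zero, ← h.val_chart φ]
    exact h0
  obtain ⟨s, hs⟩ := hu.exists_right_inv
  obtain ⟨g, rfl⟩ := hφ s
  have := hq (SmoothFn.distSq q * g - 1) (by rw [map_sub, map_mul, hs, map_one, sub_self])
  change (SmoothFn.distSq q).1 q * g.1 q - 1 = 0 at this
  rw [SmoothFn.distSq_eq_zero.2 rfl] at this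
  norm_num at this

theorem isClosedEmbedding_chart (hφ : Function.Surjective φ) :
    IsClosedEmbedding (h.chart φ) := by
  have := h.t2
  have hi : IsInducing (h.chart φ) := isInducing_of_smooth _
    (fun f => by simp only [← h.val_chart φ]; exact h.isOpen_val_ne_zero _)
    (fun U hU x hx => by
      obtain ⟨s, hs, hs'⟩ := h.exists_separating hU hx
      obtain ⟨f, rfl⟩ := hφ s
      simp only [← h.val_chart φ]
      exact ⟨f, hs, hs'⟩)
  refine ⟨⟨hi, hi.injective⟩, ?_⟩
  convert isClosed_zeros φ using 1
  ext q
  refine ⟨?_, h.exists_chart_eq φ hφ q⟩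
  rintro ⟨x, rfl⟩ f hf
  rw [← h.val_chart φ, hf, map_zero]

end IsCInftySpace

end Chart

end CInfty

namespace CInfty

open Topology Filter

/-! ### Germs of simplices -/

section Germs

variable {X : TopCat.{u}} (O : X.Presheaf SCRing.{u})

/-- Restriction of sections of a presheaf of simplicial `C^∞`-rings. -/
def rs {U V : Opens X} (h : V ≤ U) (k : ℕ) : CHom ((O.obj (op U)).lev k) ((O.obj (op V)).lev k) :=
  SCRing.lmap (O.map (homOfLE h).op) k

/-- The germ of a section of a presheaf of simplicial `C^∞`-rings. -/
noncomputable def gm {U : Opens X} {x : X} (hx : x ∈ U) (k : ℕ) :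
    CHom ((O.obj (op U)).lev k) ((stalkSC O x).lev k) :=
  SCRing.lmap (germSC O hx) k

/-- Taking germs of global sections. -/
noncomputable abbrev germTop (x : X) : O.obj (op ⊤) ⟶ stalkSC O x :=
  germSC O (show x ∈ (⊤ : Opens X) from trivial)

/-- The germ of a global section of a presheaf of simplicial `C^∞`-rings. -/
noncomputable abbrev gg (x : X) (k : ℕ) : CHom ((O.obj (op ⊤)).lev k) ((stalkSC O x).lev k) :=
  gm O (show x ∈ (⊤ : Opens X) from trivial) k

variable {O}

theorem gm_rs {U V : Opens X} (h : V ≤ U) {x : X} (hx : x ∈ V) {k : ℕ} (s : (O.obj (op U)).lev k) :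
    gm O hx k (rs O h k s) = gm O (h hx) k s :=
  germ_res (level O (op (SimplexCategory.mk k))) h hx s

theorem exists_gm {x : X} {k : ℕ} (ξ : (stalkSC O x).lev k) :
    ∃ (U : Opens X) (hx : x ∈ U) (s : (O.obj (op U)).lev k), gm O hx k s = ξ :=
  exists_germ (level O (op (SimplexCategory.mk k))) x ξ

theorem gm_eq {U V : Opens X} {x : X} {hU : x ∈ U} {hV : x ∈ V} {k : ℕ}
    {s : (O.obj (op U)).lev k} {t : (O.obj (op V)).lev k} (h : gm O hU k s = gm O hV k t) :
    ∃ (W : Opens X) (_ : x ∈ W) (hWU : W ≤ U) (hWV : W ≤ V), rs O hWU k s = rs O hWV k t :=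
  germ_eq (level O (op (SimplexCategory.mk k))) hU hV s t h

theorem gm_ext (hO : TopCat.Presheaf.IsSheaf (level O (op (SimplexCategory.mk k)) ⋙ forget CRing.{u}))
    {U : Opens X} {s t : (O.obj (op U)).lev k}
    (h : ∀ (x : X) (hx : x ∈ U), gm O hx k s = gm O hx k t) : s = t :=
  sec_ext hO h

end Germs

/-! ### Localized simplicial `C^∞`-spaces -/

open AlgebraicGeometry

namespace IsLocalizedCInftySpace

variable {Y : PresheafedSpace SCRing.{u}} (hY : IsLocalizedCInftySpace Y)

include hY

theorem isSheaf (k : SimplexCategoryᵒᵖ) :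
    TopCat.Presheaf.IsSheaf (level Y.presheaf k ⋙ forget CRing.{u}) := hY.1.1 k

theorem cspace : IsCInftySpace (piZeroSheaf Y.presheaf) := hY.1.2

theorem isLocal (x : Y.carrier) : IsLocalCRing ((stalkSC Y.presheaf x).lev 0) := hY.2 x

omit hY in
/-- The germ of a `0`-simplex in the sheaf `π₀`. -/
noncomputable def toF (x : Y.carrier) :
    CHom ((stalkSC Y.presheaf x).lev 0) (Stalk (piZeroSheaf Y.presheaf) x) :=
  (stHom (toSheafify (Y.presheaf ⋙ SCRing.piZero)) x).comp (stHom (toPi Y.presheaf) x)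

omit hY in
theorem toF_surjective (x : Y.carrier) : Function.Surjective (toF x) :=
  (stMap_toSheafify_bijective _ x).2.comp (toPi_surjective _ x)

omit hY in
theorem toF_eq_zero {x : Y.carrier} {ξ : (stalkSC Y.presheaf x).lev 0} :
    toF x ξ = 0 ↔ ξ ∈ (stalkSC Y.presheaf x).piZeroIdeal := by
  rw [← toPi_eq_zero]
  refine ⟨fun h => (stMap_toSheafify_bijective _ x).1 (h.trans (map_zero (stHom _ x)).symm),
    fun h => (congrArg (stHom _ x) h).trans (map_zero (stHom _ x))⟩

omit hY in
/-- The comparison of `π₀` of the global sections with the global sections of the sheaf `π₀`. -/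
noncomputable def kappa (Y : PresheafedSpace SCRing.{u}) :
    CHom (Y.presheaf.obj (op ⊤)).PiZero ((piZeroSheaf Y.presheaf).obj (op ⊤)) :=
  ((toSheafify (Y.presheaf ⋙ SCRing.piZero)).app (op ⊤)).hom

omit hY in
theorem toF_gm {x : Y.carrier} {U : Opens Y.carrier} (hx : x ∈ U)
    (a : (Y.presheaf.obj (op U)).lev 0) :
    toF x (gm Y.presheaf hx 0 a) = germ (piZeroSheaf Y.presheaf) hx
      (((toSheafify (Y.presheaf ⋙ SCRing.piZero)).app (op U)).hom
        ((Y.presheaf.obj (op U)).quot a)) :=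
  (congrArg (stHom _ x) (toPi_germ Y.presheaf hx a)).trans (stHom_germ _ hx _)

omit hY in
theorem germ_kappa {x : Y.carrier} (a : (Y.presheaf.obj (op ⊤)).lev 0) :
    germ (piZeroSheaf Y.presheaf) (show x ∈ (⊤ : Opens Y.carrier) from trivial)
      (kappa Y ((Y.presheaf.obj (op ⊤)).quot a)) = toF x (gg Y.presheaf x 0 a) :=
  (toF_gm _ a).symm

/-- The value of a germ of a `0`-simplex. -/
noncomputable def ev (x : Y.carrier) : CHom ((stalkSC Y.presheaf x).lev 0) ℝ := (hY.isLocal x).ev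

theorem isUnit_iff {x : Y.carrier} {ξ : (stalkSC Y.presheaf x).lev 0} :
    IsUnit ξ ↔ hY.ev x ξ ≠ 0 := (hY.isLocal x).isUnit_iff

theorem ev_toF {x : Y.carrier} (ξ : (stalkSC Y.presheaf x).lev 0) :
    (hY.cspace.isLocal x).ev (toF x ξ) = hY.ev x ξ :=
  DFunLike.congr_fun ((hY.isLocal x).eq_ev ((hY.cspace.isLocal x).ev.comp (toF x))) ξ

/-- The point of the spectrum of the global sections given by a point. -/
noncomputable def pt (x : Y.carrier) : Sp (Y.presheaf.obj (op ⊤)).PiZero :=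
  (hY.cspace.val x).comp (kappa Y)

theorem eval_pt (x : Y.carrier) (a : (Y.presheaf.obj (op ⊤)).lev 0) :
    (hY.pt x).eval ((Y.presheaf.obj (op ⊤)).quot a) =
      hY.ev x (gg Y.presheaf x 0 a) :=
  (congrArg (hY.cspace.isLocal x).ev (germ_kappa a)).trans (hY.ev_toF _)

theorem continuous_pt : Continuous hY.pt := by
  refine continuous_generateFrom_iff.2 ?_
  rintro _ ⟨a, rfl⟩
  exact hY.cspace.isOpen_val_ne_zero (kappa Y a)

/-- A closed embedding into `ℝⁿ` whose coordinates are the values of global `0`-simplices. -/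
theorem exists_lift {n : ℕ} (φ : CHom (SmoothFn n) ((piZeroSheaf Y.presheaf).obj (op ⊤)))
    (hφ : Function.Surjective φ) :
    ∃ Φ : CHom (SmoothFn n) ((Y.presheaf.obj (op ⊤)).lev 0), ∀ x f,
      hY.ev x (gg Y.presheaf x 0 (Φ f)) =
        f.1 (hY.cspace.chart φ x) := by
  have hj := (hY.cspace.isClosedEmbedding_chart φ hφ).comp
    (isClosed_univ (X := Y.carrier)).isClosedEmbedding_subtypeVal
  have hc : ∀ i : Fin n, ∃ a : (Y.presheaf.obj (op ⊤)).lev 0, ∀ x : Y.carrier,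
      hY.ev x (gg Y.presheaf x 0 a) =
        hY.cspace.chart φ x i := fun i => by
    suffices H : ∃ σ : ShSec (level Y.presheaf (op (SimplexCategory.mk 0))) ⊤,
        ∀ (y : Y.carrier) (hy : y ∈ (⊤ : Opens Y.carrier)),
          hY.ev y (σ.val hy) = hY.cspace.chart φ y i by
      obtain ⟨σ, hσ⟩ := H
      obtain ⟨s, hs⟩ := exists_sec (hY.isSheaf _) σ
      exact ⟨s, fun x => (congrArg (hY.ev x) (hs x trivial)).trans (hσ x trivial)⟩
    -- Near each point the coordinates lift from `π₀` to `O₀`, which gives a morphism `ψ` on germs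
    -- with the right values; `f` times the `i`-th lift is `ψ (proj i * f)`. Only the values of the
    -- glued section are prescribed, not its class in `π₀`, and values are all that later arguments
    -- use.
    refine exists_glue (U := ⊤) (level Y.presheaf (op (SimplexCategory.mk 0))) hj
      (fun x => {ξ | hY.ev x ξ = hY.cspace.chart φ x i})
      (fun x => {τ | ∃ ψ : CHom (SmoothFn n) ((stalkSC Y.presheaf x).lev 0),
        (∀ f, hY.ev x (ψ f) = f.1 (hY.cspace.chart φ x)) ∧
          τ = fun f => ψ (SmoothFn.proj i * f)}) ?_ ?_ ?_
    · intro x hx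
      obtain ⟨V, hV, _, s, hs⟩ := ShSec.exists_locals
        (P := Y.presheaf ⋙ SCRing.piZero) (fun i => φ (SmoothFn.proj i)) hx
      choose a ha using fun i => (Y.presheaf.obj (op V)).quot_surjective (s i)
      refine ⟨V, hV, fun f => evalHom a (SmoothFn.proj i * f), fun y hy _ => ?_⟩
      refine ⟨(gm Y.presheaf hy 0).comp (evalHom a), fun f => ?_, rfl⟩
      rw [← CHom.comp_apply, CHom.eval_real]
      refine congrArg f.1 (funext fun l => ?_)
      rw [CHom.comp_apply, CHom.comp_apply, evalHom_proj, ← hY.ev_toF]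
      refine congrArg (hY.cspace.isLocal y).ev ?_
      refine (congrArg (stHom _ y) ((toPi_germ Y.presheaf hy (a l)).trans ?_)).trans
        (stMap_toSheafify_val (Y.presheaf ⋙ SCRing.piZero) (U := ⊤) (x := y) trivial
          (φ (SmoothFn.proj l)))
      rw [ha]
      exact (hs l y hy).symm
    · rintro y - _ ⟨ψ, hψ, rfl⟩ f hf
      refine ((hY.isLocal y).hom_congr ψ (f := SmoothFn.proj i * f) (g := 0) ?_).trans (map_zero ψ)
      have : (fun l => (hY.isLocal y).ev (ψ (SmoothFn.proj l))) = hY.cspace.chart φ y :=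
        funext fun l => hψ _
      rw [this]
      filter_upwards [hf] with q hq
      change q i * f.1 q = 0
      rw [hq, Pi.zero_apply, mul_zero]
    · rintro y - S ρ τ hτ hρ
      change hY.ev y _ = _
      have : ∀ l ∈ S, hY.ev y (τ l (ρ l)) =
          hY.cspace.chart φ y i * (ρ l).1 (hY.cspace.chart φ y) := fun l hl => by
        obtain ⟨ψ, hψ, e⟩ := hτ l hl
        rw [e, hψ]; rfl
      refine (map_sum (hY.ev y) _ _).trans ((Finset.sum_congr rfl this).trans ?_)
      rw [← Finset.mul_sum, ← SmoothFn.sum_apply]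
      exact (congrArg _ hρ.self_of_nhds).trans (mul_one _)
  choose a ha using hc
  refine ⟨evalHom a, fun x f => ?_⟩
  rw [← CHom.comp_apply, ← CHom.comp_apply, CHom.eval_real]
  refine congrArg f.1 (funext fun i => ?_)
  rw [CHom.comp_apply, CHom.comp_apply, evalHom_proj, ha]

end IsLocalizedCInftySpace

end CInfty

/-! ### Fineness of the sheaves of simplices. -/

namespace CInfty

open Topology Filter AlgebraicGeometry

theorem gm_smul {X : TopCat.{u}} {O : X.Presheaf SCRing.{u}} {U : Opens X} {x : X} (hx : x ∈ U)
    {k : ℕ} (a : (O.obj (op U)).lev 0) (s : (O.obj (op U)).lev k) :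
    gm O hx k ((O.obj (op U)).deg k a * s) = (stalkSC O x).deg k (gm O hx 0 a) * gm O hx k s :=
  SCRing.smap_smul (germSC O hx) k a s

namespace IsLocalizedCInftySpace

variable {Y : PresheafedSpace SCRing.{u}} (hY : IsLocalizedCInftySpace Y)

include hY

theorem exists_chart : ∃ (n : ℕ) (j : Y.carrier → Fin n → ℝ)
    (Φ : CHom (SmoothFn n) ((Y.presheaf.obj (op ⊤)).lev 0)), IsClosedEmbedding j ∧
      ∀ x f, hY.ev x (gg Y.presheaf x 0 (Φ f)) = f.1 (j x) := by
  obtain ⟨n, φ, hφ⟩ := hY.cspace.isFinitelyGenerated ⊤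
  obtain ⟨Φ, hΦ⟩ := hY.exists_lift φ hφ
  exact ⟨n, _, Φ, hY.cspace.isClosedEmbedding_chart φ hφ, hΦ⟩

/-- This makes multiplication with `Φ f` a local operation: bump functions and partitions of unity
on `ℝⁿ` act as such on simplices of all degrees. -/
theorem gg_congr {n : ℕ} {j : Y.carrier → Fin n → ℝ}
    {Φ : CHom (SmoothFn n) ((Y.presheaf.obj (op ⊤)).lev 0)}
    (hΦ : ∀ x f, hY.ev x (gg Y.presheaf x 0 (Φ f)) = f.1 (j x)) {x : Y.carrier}
    {f g : SmoothFn n} (h : f.1 =ᶠ[𝓝 (j x)] g.1) :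
    gg Y.presheaf x 0 (Φ f) = gg Y.presheaf x 0 (Φ g) := by
  refine (hY.isLocal x).hom_congr ((gg Y.presheaf x 0).comp Φ) ?_
  convert h using 2
  exact funext fun i => hΦ x _

/-- Gluing of simplices: simplices with germs in given affine spaces exist if they exist
locally. -/
theorem fine_glue (k : ℕ) (C : ∀ x : Y.carrier, Set ((stalkSC Y.presheaf x).Simplices k))
    (hloc : ∀ x, ∃ (W : Opens Y.carrier) (_ : x ∈ W) (s : (Y.presheaf.obj (op W)).lev k),
      ∀ (y : Y.carrier) (hy : y ∈ W), gm Y.presheaf hy k s ∈ C y)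
    (hC : ∀ (y : Y.carrier) (ι : Type u) (S : Finset ι) (c : ι → (stalkSC Y.presheaf y).lev 0)
      (ξ : ι → (stalkSC Y.presheaf y).Simplices k), (∀ i ∈ S, ξ i ∈ C y) → ∑ i ∈ S, c i = 1 →
        ∑ i ∈ S, c i • ξ i ∈ C y) :
    ∃ s : (Y.presheaf.obj (op ⊤)).lev k, ∀ y, gg Y.presheaf y k s ∈ C y := by
  obtain ⟨n, j, Φ, hj, hΦ⟩ := hY.exists_chart
  have hj' := hj.comp (isClosed_univ (X := Y.carrier)).isClosedEmbedding_subtypeVal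
  suffices H : ∃ σ : ShSec (level Y.presheaf (op (SimplexCategory.mk k))) ⊤,
      ∀ (y : Y.carrier) (hy : y ∈ (⊤ : Opens Y.carrier)), σ.val hy ∈ C y by
    obtain ⟨σ, hσ⟩ := H
    obtain ⟨s, hs⟩ := exists_sec (hY.isSheaf _) σ
    exact ⟨s, fun x => (congrArg (· ∈ C x) (hs x trivial)).mpr (hσ x trivial)⟩
  refine exists_glue (U := ⊤) _ hj' C
    (fun y => {τ | ∃ ξ ∈ C y, τ = fun f => gg Y.presheaf y 0 (Φ f) • ξ}) ?_ ?_ ?_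
  · intro x _
    obtain ⟨W, hW, s, hs⟩ := hloc x
    refine ⟨W, hW, fun f => (Y.presheaf.obj (op W)).deg k (rs Y.presheaf le_top 0 (Φ f)) * s,
      fun y hy _ => ⟨_, hs y hy, funext fun f => ?_⟩⟩
    refine (gm_smul hy _ s).trans ?_
    rw [gm_rs]; rfl
  · rintro y - _ ⟨ξ, -, rfl⟩ f hf
    have : gg Y.presheaf y 0 (Φ f) = 0 := by
      rw [hY.gg_congr hΦ (f := f) (g := 0) hf, map_zero, map_zero]
    simp only [this]
    exact zero_smul _ ξ
  · rintro y - S ρ τ hτ hρ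
    choose! ξ hξ e using hτ
    -- The coefficients add up to `1` in the stalk itself and not merely in value, because the germ
    -- of `∑ ρ i` at the image point in `ℝⁿ` is `1`.
    have h1 : ∑ i ∈ S, gg Y.presheaf y 0 (Φ (ρ i)) = 1 := by
      rw [← map_sum, ← map_sum, hY.gg_congr hΦ (f := ∑ i ∈ S, ρ i) (g := 1) hρ, map_one, map_one]
    have := hC y _ S (fun i => gg Y.presheaf y 0 (Φ (ρ i))) ξ hξ h1
    refine (congrArg (· ∈ C y) ?_).mpr this
    exact Finset.sum_congr rfl fun i hi => congrFun (e i hi) (ρ i)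

/-- Simplices over a neighbourhood of a point extend, after shrinking the neighbourhood. -/
theorem exists_extension {k : ℕ} {x : Y.carrier} {W : Opens Y.carrier} (hx : x ∈ W)
    (s : (Y.presheaf.obj (op W)).lev k) :
    ∃ (t : (Y.presheaf.obj (op ⊤)).lev k) (V : Opens Y.carrier) (_ : x ∈ V) (hV : V ≤ W),
      ∀ (y : Y.carrier) (hy : y ∈ V), gg Y.presheaf y k t = gm Y.presheaf (hV hy) k s := by
  obtain ⟨n, j, Φ, hj, hΦ⟩ := hY.exists_chart
  have := hj.isInducing.regularSpace
  -- The germs are prescribed on a closed neighbourhood `K` inside `W` and left free elsewhere: `s`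
  -- is a local solution on `W`, and `0` is one off `K`.
  obtain ⟨K, hK, hKc, hKW⟩ := exists_mem_nhds_isClosed_subset (W.2.mem_nhds hx)
  obtain ⟨t, ht⟩ := hY.fine_glue k
    (fun y => {ξ | ∀ hy : y ∈ K, ξ = gm Y.presheaf (hKW hy) k s})
    (fun y => by
      by_cases hy : y ∈ W
      · exact ⟨W, hy, s, fun z hz hz' => rfl⟩
      · exact ⟨⟨Kᶜ, hKc.isOpen_compl⟩, fun h => hy (hKW h), 0, fun z hz hz' => (hz hz').elim⟩)
    (fun y ι S c ξ hξ hc hy => by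
      rw [Finset.sum_congr rfl fun i hi => congrArg (c i • ·) (hξ i hi hy)]
      refine (Finset.sum_smul (M := (stalkSC Y.presheaf y).Simplices k)).symm.trans ?_
      rw [hc]
      exact one_smul _ _)
  exact ⟨t, ⟨interior K, isOpen_interior⟩, mem_interior_iff_mem_nhds.2 hK,
    interior_subset.trans hKW, fun y hy => ht y (interior_subset hy)⟩

/-- Bump functions among the `0`-simplices. -/
theorem exists_bump {x : Y.carrier} {W : Opens Y.carrier} (hx : x ∈ W) :
    ∃ b : (Y.presheaf.obj (op ⊤)).lev 0, hY.ev x (gg Y.presheaf x 0 b) ≠ 0 ∧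
      ∀ y ∉ W, gg Y.presheaf y 0 b = 0 := by
  obtain ⟨n, j, Φ, hj, hΦ⟩ := hY.exists_chart
  have hW := W.2.mem_nhds hx
  rw [hj.isInducing.nhds_eq_comap] at hW
  obtain ⟨N, hN, hNW⟩ := hW
  obtain ⟨f, hf, hf'⟩ := SmoothFn.exists_bump hN
  refine ⟨Φ f, ?_, fun y hy => ?_⟩
  · rw [hΦ, hf'.self_of_nhds]; exact one_ne_zero
  · rw [hY.gg_congr hΦ (f := f) (g := 0) (notMem_tsupport_iff_eventuallyEq.1
      fun h => hy (hNW (hf h))), map_zero, map_zero]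

/-- A global simplex whose germ at `x` vanishes is killed by a `0`-simplex that does not vanish at
`x`. -/
theorem exists_smul_eq_zero {k : ℕ} {x : Y.carrier} (s : (Y.presheaf.obj (op ⊤)).lev k)
    (h : gg Y.presheaf x k s = 0) : ∃ b : (Y.presheaf.obj (op ⊤)).lev 0,
      hY.ev x (gg Y.presheaf x 0 b) ≠ 0 ∧ (Y.presheaf.obj (op ⊤)).deg k b * s = 0 := by
  obtain ⟨W, hW, hWU, _, e⟩ := gm_eq (h.trans (map_zero (gg Y.presheaf x k)).symm)
  obtain ⟨b, hb, hb'⟩ := hY.exists_bump hW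
  refine ⟨b, hb, gm_ext (hY.isSheaf _) fun y hy => ?_⟩
  rw [gm_smul, map_zero]
  by_cases hyW : y ∈ W
  · have := congrArg (gm Y.presheaf hyW k) e
    rw [map_zero, map_zero, gm_rs] at this
    rw [this, mul_zero]
  · rw [hb' y hyW, map_zero, zero_mul]

end IsLocalizedCInftySpace

end CInfty

/-! ### Global sections of a localized space form a geometric ring. -/

namespace CInfty

open Topology Filter AlgebraicGeometry

namespace IsLocalizedCInftySpace

variable {Y : PresheafedSpace SCRing.{u}} (hY : IsLocalizedCInftySpace Y)

include hY

/-- Being a boundary is a local property. -/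
theorem exists_moore_eq {k : ℕ} (z : (Y.presheaf.obj (op ⊤)).Simplices k)
    (h : ∀ x, ∃ w, (stalkSC Y.presheaf x).moore k w = gg Y.presheaf x k z) :
    ∃ w, (Y.presheaf.obj (op ⊤)).moore k w = z := by
  obtain ⟨w, hw⟩ := hY.fine_glue (k + 1)
    -- The solutions `w` of a linear equation form an affine space over the local ring of
    -- `0`-simplices, as required for gluing.
    (fun x => {w | (stalkSC Y.presheaf x).moore k w = gg Y.presheaf x k z})
    (fun x => by
      obtain ⟨η, hη⟩ := h x
      obtain ⟨W, hW, w, rfl⟩ := exists_gm η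
      have e : gm Y.presheaf hW k ((Y.presheaf.obj (op W)).moore k w) = gg Y.presheaf x k z :=
        (SCRing.smap_moore (germSC Y.presheaf hW) k w).trans hη
      obtain ⟨V, hV, hVW, _, e⟩ := gm_eq e
      refine ⟨V, hV, rs Y.presheaf hVW (k + 1) w, fun y hy => ?_⟩
      have := congrArg (gm Y.presheaf hy k) e
      refine Eq.trans ?_ ((gm_rs hVW hy _).symm.trans (this.trans (gm_rs _ hy _)))
      rw [gm_rs]
      exact (SCRing.smap_moore (germSC Y.presheaf (hVW hy)) k w).symm)
    (fun y ι S c ξ hξ hc => by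
      change (stalkSC Y.presheaf y).moore k _ = _
      rw [map_sum, Finset.sum_congr rfl fun i hi =>
        (map_smul _ _ _).trans (congrArg (c i • ·) (hξ i hi))]
      refine (Finset.sum_smul (M := (stalkSC Y.presheaf y).Simplices k)).symm.trans ?_
      rw [hc]
      exact one_smul _ _)
  exact ⟨w, gm_ext (hY.isSheaf _) fun x _ =>
    (SCRing.smap_moore (germSC Y.presheaf _) k w).trans (hw x)⟩

/-- Injectivity: a `0`-simplex with zero image in the sheaf `π₀` is a boundary in each stalk, hence
globally. Surjectivity: the germs of `0`-simplices that map to the germ of a given section are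
closed under affine combinations and exist locally. -/
theorem kappa_bijective : Function.Bijective (kappa Y) := by
  constructor
  · refine (injective_iff_map_eq_zero (kappa Y)).2 fun b hb => ?_
    obtain ⟨a, rfl⟩ := (Y.presheaf.obj (op ⊤)).quot_surjective b
    obtain ⟨y, hy⟩ := hY.exists_moore_eq (k := 0) a fun x => by
      have h := germ_kappa (x := x) a
      have h0 : toF x (gg Y.presheaf x 0 a) = 0 :=
        h.symm.trans ((congrArg _ hb).trans (map_zero (germHom (piZeroSheaf Y.presheaf) _)))
      obtain ⟨η, hη⟩ := toF_eq_zero.1 h0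
      exact ⟨η, (SCRing.moore_zero_apply η).trans hη⟩
    rw [← map_zero (Y.presheaf.obj (op ⊤)).quot, SCRing.quot_eq, sub_zero]
    exact ⟨y, (SCRing.moore_zero_apply y).symm.trans hy⟩
  · intro σ
    obtain ⟨a, ha⟩ := hY.fine_glue 0 (fun x => {ξ | toF x ξ = germ (piZeroSheaf Y.presheaf)
        (show x ∈ (⊤ : Opens Y.carrier) from trivial) σ})
      (fun x => by
        obtain ⟨V, hV, _, s, hs⟩ := ShSec.exists_local (P := Y.presheaf ⋙ SCRing.piZero) σ
          (show x ∈ (⊤ : Opens Y.carrier) from trivial)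
        obtain ⟨a, rfl⟩ := (Y.presheaf.obj (op V)).quot_surjective s
        refine ⟨V, hV, a, fun y hy => (toF_gm hy a).trans ?_⟩
        refine Eq.trans ?_ (stMap_toSheafify_val (Y.presheaf ⋙ SCRing.piZero) (U := ⊤) (x := y)
          trivial σ)
        refine (stMap_germ _ hy _).symm.trans (congrArg (stMap _ y) ?_)
        exact (hs y hy).symm)
      (fun y ι S c ξ hξ hc => by
        change toF y _ = _
        refine (map_sum (toF y) _ _).trans ?_
        refine (Finset.sum_congr rfl fun i hi => (map_mul (toF y) _ _).trans
          (congrArg₂ (· * ·) (congrArg (toF y) (SCRing.deg_zero _ (c i))) (hξ i hi))).trans ?_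
        rw [← Finset.sum_mul, ← map_sum, hc, map_one, one_mul])
    refine ⟨(Y.presheaf.obj (op ⊤)).quot a, sec_ext hY.cspace.isSheaf fun x _ => ?_⟩
    exact (germ_kappa a).trans (ha x)

theorem exists_presentation : ∃ (n : ℕ) (φ : CHom (SmoothFn n) (Y.presheaf.obj (op ⊤)).PiZero),
    Function.Surjective φ := by
  obtain ⟨n, φ, hφ⟩ := hY.cspace.isFinitelyGenerated ⊤
  choose a ha using fun i => hY.kappa_bijective.2 (φ (SmoothFn.proj i))
  have e : (kappa Y).comp (evalHom a) = φ := by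
    rw [CHom.eq_evalHom ((kappa Y).comp (evalHom a)), CHom.eq_evalHom φ]
    congr 1
    funext i
    rw [CHom.comp_apply, evalHom_proj, ha]
  refine ⟨n, evalHom a, fun b => ?_⟩
  obtain ⟨f, hf⟩ := hφ (kappa Y b)
  rw [← e, CHom.comp_apply] at hf
  exact ⟨f, hY.kappa_bijective.1 hf⟩

omit hY in
theorem ker_comp_kappa (hY : IsLocalizedCInftySpace Y) {n : ℕ}
    (φ : CHom (SmoothFn n) (Y.presheaf.obj (op ⊤)).PiZero) (f : SmoothFn n) :
    (kappa Y).comp φ f = 0 ↔ φ f = 0 := by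
  rw [CHom.comp_apply, map_eq_zero_iff _ hY.kappa_bijective.1]

/-- If `φ f ≠ 0`, its image in the sheaf `π₀` has a nonzero germ at some `x`. This germ depends only
on the germ of `f` at the image of `x` in `ℝⁿ`, so `f` cannot share the latter with an element of
the kernel. -/
theorem isGermDetermined : IsGermDetermined (Y.presheaf.obj (op ⊤)).PiZero := by
  obtain ⟨n, φ, hφ⟩ := hY.exists_presentation
  refine ⟨n, φ, hφ, fun f hf => ?_⟩
  have hne : (kappa Y).comp φ f ≠ 0 := fun h => hf ((hY.ker_comp_kappa φ f).1 h)
  have : ∃ x : Y.carrier, germ (piZeroSheaf Y.presheaf)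
      (show x ∈ (⊤ : Opens Y.carrier) from trivial) ((kappa Y).comp φ f) ≠ 0 := by
    by_contra! h
    exact hne (sec_ext hY.cspace.isSheaf fun x hx =>
      (h x).trans (map_zero (germHom (piZeroSheaf Y.presheaf) hx)).symm)
  obtain ⟨x, hx⟩ := this
  refine ⟨hY.cspace.chart ((kappa Y).comp φ) x, fun g hg hfg => hx ?_⟩
  have h1 := (hY.cspace.isLocal x).hom_congr ((germHom (piZeroSheaf Y.presheaf)
    (show x ∈ (⊤ : Opens Y.carrier) from trivial)).comp ((kappa Y).comp φ)) hfg
  have h2 : (kappa Y).comp φ g = 0 := (hY.ker_comp_kappa φ g).2 hg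
  refine h1.trans ?_
  rw [CHom.comp_apply, h2, map_zero]

/-- A presentation of `π₀` identifies both the space and the spectrum with the common zero set of
its kernel in `ℝⁿ`. -/
theorem pt_surjective : Function.Surjective hY.pt := fun p => by
  obtain ⟨n, φ, hφ⟩ := hY.exists_presentation
  obtain ⟨x, hx⟩ := hY.cspace.exists_chart_eq ((kappa Y).comp φ)
    (fun s => by
      obtain ⟨b, rfl⟩ := hY.kappa_bijective.2 s
      obtain ⟨f, rfl⟩ := hφ b
      exact ⟨f, rfl⟩)
    (fun i => p.eval (φ (SmoothFn.proj i))) fun f hf => by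
      have := CHom.eval_real (p.eval.comp φ) f
      rw [CHom.comp_apply, (hY.ker_comp_kappa φ f).1 hf, map_zero] at this
      exact this.symm
  refine ⟨x, CHom.hext fun b => ?_⟩
  obtain ⟨f, rfl⟩ := hφ b
  refine (hY.cspace.val_chart ((kappa Y).comp φ) x f).trans ?_
  rw [hx]
  exact (CHom.eval_real (p.eval.comp φ) f).symm

theorem isInducing_pt : IsInducing hY.pt := by
  refine isInducing_iff_nhds.2 fun x => le_antisymm
    (map_le_iff_le_comap.1 hY.continuous_pt.continuousAt) fun U hU => ?_
  obtain ⟨s, hs, hs'⟩ := hY.cspace.exists_separating isOpen_interior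
    (mem_interior_iff_mem_nhds.2 hU)
  obtain ⟨a, rfl⟩ := hY.kappa_bijective.2 s
  exact ⟨Sp.basicOpen a, (Sp.isOpen_basicOpen a).mem_nhds hs,
    fun y hy => interior_subset (hs' y hy)⟩

theorem isHomeomorph_pt : IsHomeomorph hY.pt := by
  have := hY.cspace.t2
  exact isHomeomorph_iff_isEmbedding_surjective.2
    ⟨⟨hY.isInducing_pt, hY.isInducing_pt.injective⟩, hY.pt_surjective⟩

/-- Algebraic localization agrees with passage to stalks. A simplex bounding a cycle near `x`
extends to a global one; the error then has zero germ at `x` and is killed by some `b` with `b(x) ≠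
0`. Conversely, an annihilator that does not vanish at `x` becomes a unit in the stalk. -/
theorem moduleGerm_eq_zero {k : ℕ} (x : Y.carrier) (m : (Y.presheaf.obj (op ⊤)).PiSucc k) :
    moduleGerm (hY.pt x) m = 0 ↔
      SCRing.piMap (germTop Y.presheaf x) k m = 0 := by
  rw [SCRing.moduleGerm_eq_zero]
  constructor
  · rintro ⟨a, ha, e⟩
    rw [hY.eval_pt] at ha
    have hu := hY.isUnit_iff.2 ha
    have := congrArg (SCRing.piMap (germTop Y.presheaf x) k) e
    rw [SCRing.piMap_smul, map_zero] at this
    exact (hu.smul_eq_zero).1 this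
  · intro h
    obtain ⟨z, rfl⟩ := SCRing.cls_surjective k m
    obtain ⟨η, hη⟩ := (SCRing.cls_eq_zero _).1 h
    obtain ⟨W, hW, w, rfl⟩ := exists_gm η
    obtain ⟨t, V, hV, hVW, ht⟩ := hY.exists_extension hW w
    obtain ⟨b, hb, e⟩ := hY.exists_smul_eq_zero (x := x) (k := k + 1)
      (z.1 - (Y.presheaf.obj (op ⊤)).moore (k + 1) t) (by
        refine (map_sub (gg Y.presheaf x (k + 1)) _ _).trans (sub_eq_zero.2 ?_)
        refine Eq.trans ?_ (SCRing.smap_moore (germSC Y.presheaf _) (k + 1) t).symm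
        refine hη.symm.trans (congrArg ((stalkSC Y.presheaf x).moore (k + 1)) ?_)
        exact (ht x hV).symm)
    refine ⟨b, (hY.eval_pt x b).trans_ne hb, ?_⟩
    rw [← map_smul]
    refine (SCRing.cls_eq_zero _).2 ⟨b • show (Y.presheaf.obj (op ⊤)).Simplices (k + 1 + 1) from t, ?_⟩
    rw [map_smul]
    refine (sub_eq_zero.1 ?_).symm
    exact (smul_sub b z.1 _).symm.trans e

theorem eq_zero_of_piMap {k : ℕ} (m : (Y.presheaf.obj (op ⊤)).PiSucc k)
    (h : ∀ x : Y.carrier, SCRing.piMap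
      (germTop Y.presheaf x) k m = 0) : m = 0 := by
  obtain ⟨z, rfl⟩ := SCRing.cls_surjective k m
  exact (SCRing.cls_eq_zero _).2 (hY.exists_moore_eq (k := k + 1) z.1 fun x =>
    (SCRing.cls_eq_zero _).1 (h x))

/-- Cycles of a prescribed homology class form an affine space, so a cycle representing the sum in
every stalk can be glued from finite sums of representatives. Uniqueness holds because a class that
vanishes in all stalks is zero. -/
theorem isLocallyComplete (k : ℕ) : IsGermDeterminedLocallyComplete
    (Y.presheaf.obj (op ⊤)).PiZero ((Y.presheaf.obj (op ⊤)).PiSucc k) := by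
  intro ι t ht
  choose z hz using fun i => SCRing.cls_surjective k (t i)
  obtain rfl : (fun i => (Y.presheaf.obj (op ⊤)).cls k (z i)) = t := funext hz
  clear hz
  let π := fun (x : Y.carrier) => SCRing.piMap
    (germTop Y.presheaf x) k
  obtain ⟨s, hs⟩ := hY.fine_glue (k + 1)
    (fun x => {ζ | ∃ h : (stalkSC Y.presheaf x).moore k ζ = 0, (stalkSC Y.presheaf x).cls k ⟨ζ, h⟩ =
      ∑ᶠ i, π x ((Y.presheaf.obj (op ⊤)).cls k (z i))})
    (fun x => by
      obtain ⟨U, hU, hxU, hfin⟩ := ht (hY.pt x)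
      refine ⟨⟨hY.pt ⁻¹' U, hU.preimage hY.continuous_pt⟩, hxU,
        rs Y.presheaf le_top (k + 1) (∑ i ∈ hfin.toFinset, z i : LinearMap.ker _).1,
        fun y hy => ?_⟩
      have e : gm Y.presheaf hy (k + 1) (rs Y.presheaf le_top (k + 1)
          (∑ i ∈ hfin.toFinset, z i : LinearMap.ker _).1) =
          (SCRing.kmap (germTop Y.presheaf y) k (∑ i ∈ hfin.toFinset, z i)).1 := gm_rs _ _ _
      refine (congrArg (· ∈ {ζ | ∃ h : (stalkSC Y.presheaf y).moore k ζ = 0,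
        (stalkSC Y.presheaf y).cls k ⟨ζ, h⟩ =
          ∑ᶠ i, π y ((Y.presheaf.obj (op ⊤)).cls k (z i))}) e).mpr ⟨Subtype.prop (SCRing.kmap (germTop Y.presheaf y) k _), ?_⟩
      rw [finsum_eq_sum_of_support_subset (s := hfin.toFinset)]
      · change π y ((Y.presheaf.obj (op ⊤)).cls k (∑ i ∈ hfin.toFinset, z i)) = _
        rw [map_sum, map_sum]
      · intro i hi
        refine hfin.mem_toFinset.2 ⟨hY.pt y, hy, fun h => hi ?_⟩
        exact (hY.moduleGerm_eq_zero y _).1 h)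
    (fun y ι S c ξ hξ hc => by
      choose h e using hξ
      refine ⟨?_, ?_⟩
      · rw [map_sum]
        exact Finset.sum_eq_zero fun i hi => by
          rw [map_smul, show _ = (0 : (stalkSC Y.presheaf y).Simplices k) from h i hi, smul_zero]
      · have : (stalkSC Y.presheaf y).cls k (∑ i ∈ S.attach,
            c i • ⟨ξ i.1, h i.1 i.2⟩) = ∑ i ∈ S.attach, c i • ∑ᶠ i, π y
              ((Y.presheaf.obj (op ⊤)).cls k (z i)) := by
          rw [map_sum]
          exact Finset.sum_congr rfl fun i _ => (map_smul _ _ _).trans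
            (congrArg (c i • ·) (e i.1 i.2))
        rw [← Finset.sum_smul, Finset.sum_attach, hc, one_smul] at this
        refine Eq.trans (congrArg _ (Subtype.ext ?_)) this
        refine Eq.trans ?_ (AddSubmonoidClass.coe_finsetSum _ _).symm
        exact (Finset.sum_attach S fun i => c i • ξ i).symm)
  have hs0 : (Y.presheaf.obj (op ⊤)).moore k s = 0 := gm_ext (hY.isSheaf _) fun x _ => by
    obtain ⟨h, -⟩ := hs x
    exact (SCRing.smap_moore (germSC Y.presheaf _) k s).trans
      (h.trans (map_zero (gg Y.presheaf x k)).symm)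
  have key : ∀ (m : (Y.presheaf.obj (op ⊤)).PiSucc k) (x : Y.carrier),
      (moduleGerm (hY.pt x) m = ∑ᶠ i, moduleGerm (hY.pt x) ((Y.presheaf.obj (op ⊤)).cls k (z i))) ↔
        π x m = ∑ᶠ i, π x ((Y.presheaf.obj (op ⊤)).cls k (z i)) := by
    intro m x
    obtain ⟨U, hU, hxU, hfin⟩ := ht (hY.pt x)
    -- Both infinite sums are replaced by sums over the same finite set, after which additive maps
    -- commute with them; a `finsum` with infinite support would be `0` by convention.
    rw [finsum_eq_sum_of_support_subset (s := hfin.toFinset),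
      finsum_eq_sum_of_support_subset (s := hfin.toFinset), ← sub_eq_zero, ← map_sum, ← map_sub,
      hY.moduleGerm_eq_zero, map_sub, map_sum, sub_eq_zero]
    · intro i hi
      refine hfin.mem_toFinset.2 ⟨hY.pt x, hxU, fun h => hi ?_⟩
      exact (hY.moduleGerm_eq_zero x _).1 h
    · intro i hi
      exact hfin.mem_toFinset.2 ⟨hY.pt x, hxU, hi⟩
  refine ⟨(Y.presheaf.obj (op ⊤)).cls k ⟨s, hs0⟩, fun p => ?_, fun m hm => ?_⟩
  · obtain ⟨x, rfl⟩ := hY.pt_surjective p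
    exact (key _ x).2 (hs x).2
  · refine sub_eq_zero.1 (hY.eq_zero_of_piMap _ fun x => ?_)
    rw [map_sub, sub_eq_zero]
    exact ((key m x).1 (hm (hY.pt x))).trans (hs x).2.symm

/-- The global sections of a localized simplicial `C^∞`-space form a geometric ring. -/
theorem isGeometric : SCRing.IsGeometric (Y.presheaf.obj (op ⊤)) :=
  ⟨hY.isGermDetermined, hY.isLocallyComplete⟩

end IsLocalizedCInftySpace

end CInfty

namespace CInfty

open Topology Filter AlgebraicGeometry

/-! ### The spectrum of a finitely generated `C^∞`-ring -/

namespace Sp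

variable {A : Type u} [CInftyRing A]

/-- Since `U_a ∩ U_b = U_{ab}`, the generating sets form a basis and not only a subbasis. -/
theorem exists_basicOpen {U : Set (Sp A)} (hU : IsOpen U) {p : Sp A} (hp : p ∈ U) :
    ∃ a, p ∈ basicOpen a ∧ basicOpen a ⊆ U := by
  induction hU with
  | basic s hs =>
    obtain ⟨a, rfl⟩ := hs
    exact ⟨a, hp, subset_rfl⟩
  | univ => exact ⟨1, by simp [basicOpen], Set.subset_univ _⟩
  | inter s t _ _ ihs iht =>
    obtain ⟨a, ha, hs⟩ := ihs hp.1
    obtain ⟨b, hb, ht⟩ := iht hp.2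
    refine ⟨a * b, ?_, fun q hq => ?_⟩
    · simp only [basicOpen, Set.mem_ofPred_eq, map_mul] at *
      exact mul_ne_zero ha hb
    · simp only [basicOpen, Set.mem_ofPred_eq, map_mul] at hq
      exact ⟨hs (left_ne_zero_of_mul hq), ht (right_ne_zero_of_mul hq)⟩
  | sUnion S _ ih =>
    obtain ⟨s, hs, hps⟩ := hp
    obtain ⟨a, ha, h⟩ := ih s hs hps
    exact ⟨a, ha, h.trans (Set.subset_sUnion_of_mem hs)⟩

variable {n : ℕ} (φ : CHom (SmoothFn n) A)

/-- The map from the spectrum to `ℝⁿ` given by elements of the ring. -/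
def chart (p : Sp A) (i : Fin n) : ℝ := p.eval (φ (SmoothFn.proj i))

theorem eval_chart (p : Sp A) (f : SmoothFn n) : p.eval (φ f) = f.1 (chart φ p) :=
  CHom.eval_real (p.eval.comp φ) f

variable {φ}

theorem chart_injective (hφ : Function.Surjective φ) : Function.Injective (chart φ) :=
  fun p q h => CHom.hext fun a => by
    obtain ⟨f, rfl⟩ := hφ a
    exact (eval_chart φ p f).trans ((congrArg f.1 h).trans (eval_chart φ q f).symm)

theorem exists_chart_eq (hφ : Function.Surjective φ) {q : Fin n → ℝ}
    (hq : ∀ f, φ f = 0 → f.1 q = 0) : ∃ p, chart φ p = q := by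
  obtain ⟨p, hp⟩ := exists_factor φ hφ (SmoothFn.evalAt q) hq
  exact ⟨p, funext fun i => hp _⟩

theorem isClosedEmbedding_chart (hφ : Function.Surjective φ) : IsClosedEmbedding (chart φ) := by
  have hi : IsInducing (chart φ) := isInducing_of_smooth _
    (fun f => by simp only [← eval_chart φ]; exact isOpen_basicOpen (φ f))
    (fun U hU x hx => by
      obtain ⟨a, ha, h⟩ := exists_basicOpen hU hx
      obtain ⟨f, rfl⟩ := hφ a
      simp only [← eval_chart φ]
      exact ⟨f, ha, fun y hy => h hy⟩)
  refine ⟨⟨hi, chart_injective hφ⟩, ?_⟩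
  convert isClosed_zeros φ using 1
  ext q
  refine ⟨?_, exists_chart_eq hφ⟩
  rintro ⟨x, rfl⟩ f hf
  rw [← eval_chart φ, hf, map_zero]

end Sp

/-- The element `a - g(a)` is killed by `g`, hence by `p`. A point is thus recognized from what
becomes invertible there, which is how values are compared below. -/
theorem CHom.eq_of_ne_zero {A : Type u} [CInftyRing A] {p g : CHom A ℝ}
    (h : ∀ a, p a ≠ 0 → g a ≠ 0) : g = p := by
  refine CHom.hext fun a => ?_
  by_contra hne
  refine h (a - cst A (g a)) ?_ ?_
  · rw [map_sub, map_cst, cst_real]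
    exact sub_ne_zero.2 (Ne.symm hne)
  · rw [map_sub, map_cst, cst_real, sub_self]

/-! ### Stalks of the structure sheaf of the spectrum -/

/-- The canonical morphism from a presheaf of simplicial `C^∞`-rings to the associated sheaf. -/
noncomputable def toSimplicialSheafify {X : TopCat.{u}} (P : X.Presheaf SCRing.{u}) :
    P ⟶ simplicialSheafify P where
  app U :=
    { app := fun k => (toSheafify (level P k)).app U
      naturality := fun _ _ θ => CRing.hom_ext' fun s => ShSec.ext fun _ hx =>
        (stMap_germ (levelStr P θ) hx s).symm }
  naturality _ _ i := NatTrans.ext (funext fun k => (toSheafify (level P k)).naturality i)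

namespace SCRing

variable (A : SCRing.{u})

/-- The spectrum of a simplicial `C^∞`-ring. -/
noncomputable abbrev spec : PresheafedSpace SCRing.{u} :=
  ⟨A.spTop, simplicialSheafify A.locPresheaf⟩

/-- The canonical morphism from a simplicial `C^∞`-ring to its localizations. -/
noncomputable def toLoc (U : Opens A.spTop) : A ⟶ A.locPresheaf.obj (op U) where
  app k := ⟨Loc.of (A.invertedAt U k)⟩
  naturality _ _ _ := rfl

/-- The canonical morphism from a simplicial `C^∞`-ring to the global sections of its spectrum. -/
noncomputable def toGlobal : A ⟶ A.spec.presheaf.obj (op ⊤) :=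
  A.toLoc ⊤ ≫ (toSimplicialSheafify A.locPresheaf).app (op ⊤)

variable {A}

theorem isOpen_value_ne_zero (a : A.lev 0) : IsOpen {p : A.spTop | A.value p a ≠ 0} :=
  Sp.isOpen_basicOpen (A.quot a)

variable {p : A.spTop} {k : ℕ}

variable (p k) in
/-- The germ at a point of the spectrum of a simplex. -/
noncomputable def preGerm : CHom (A.lev k) ((stalkSC A.locPresheaf p).lev k) :=
  (gg A.locPresheaf p k).comp (lmap (A.toLoc ⊤) k)

theorem gm_of {U : Opens A.spTop} (hp : p ∈ U) (a : A.lev k) :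
    gm A.locPresheaf hp k (Loc.of _ a) = preGerm p k a :=
  gm_rs (O := A.locPresheaf) le_top hp (lmap (A.toLoc ⊤) k a)

theorem isUnit_preGerm {a : A.lev 0} (ha : A.value p a ≠ 0) :
    IsUnit (preGerm p k (A.deg k a)) := by
  let W : Opens A.spTop := ⟨_, isOpen_value_ne_zero a⟩
  have hW : p ∈ W := ha
  have : IsUnit (Loc.of (A.invertedAt W (op (SimplexCategory.mk k))) (A.deg k a)) :=
    Loc.isUnit_of ⟨a, fun q hq => hq, rfl⟩
  rw [← gm_of hW]
  exact this.map (gm A.locPresheaf hW k)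

theorem preGerm_eq_of {x y : A.lev k} (h : EqAt (A.value p) (A.deg k) x y) :
    preGerm p k x = preGerm p k y := by
  obtain ⟨c, hc, e⟩ := h
  refine (isUnit_preGerm hc).mul_left_cancel ?_
  rw [← map_mul, ← map_mul, e]

theorem exists_inverse {U : Opens A.spTop} (hp : p ∈ U) : ∃ inv : A.lev k → A.lev k,
    ∀ b ∈ A.invertedAt U (op (SimplexCategory.mk k)),
      EqAt (A.value p) (A.deg k) (b * inv b) 1 := by
  have : ∀ b ∈ A.invertedAt U (op (SimplexCategory.mk k)), ∃ b' : A.lev k,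
      EqAt (A.value p) (A.deg k) (b * b') 1 := by
    rintro _ ⟨a, ha, rfl⟩
    obtain ⟨b, c, hc, e⟩ := exists_inv_at (A.value p) (ha p hp)
    refine ⟨A.deg k b, c, hc, ?_⟩
    have := congrArg (A.deg k) e
    rw [map_mul, map_mul] at this
    rw [mul_one]
    exact this
  choose! inv hinv using this
  exact ⟨inv, hinv⟩

/-- By induction on formal expressions: a formal inverse of `b` has the same germ as any element of
`A_k` that inverts `b` near `p`, so localization adds no new germs. -/
theorem preGerm_surjective : Function.Surjective (preGerm p k) := fun ξ => by
  obtain ⟨U, hU, s, rfl⟩ := exists_gm ξ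
  obtain ⟨inv, hinv⟩ := exists_inverse (k := k) hU
  obtain ⟨t, rfl⟩ := _root_.Quotient.exists_rep s
  refine ⟨Loc.repr inv t, ?_⟩
  change preGerm p k (Loc.repr inv t) = gm A.locPresheaf hU k (Loc.mk t)
  induction t with
  | of a => exact (gm_of hU a).symm
  | inv b =>
    have h1 : gm A.locPresheaf hU k (Loc.of _ b) * gm A.locPresheaf hU k (Loc.mk (.inv b)) = 1 :=
      (map_mul (gm A.locPresheaf hU k) _ _).symm.trans
        ((congrArg _ (Loc.of_mul_inv b)).trans (map_one _))
    have h2 := preGerm_eq_of (hinv b b.2)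
    rw [map_mul, map_one, ← gm_of hU] at h2
    refine (IsUnit.of_mul_eq_one _ h1).mul_left_cancel ?_
    rw [h1]
    exact h2
  | op n f t ih =>
    refine ((preGerm p k).map_op' f _).trans ?_
    refine Eq.trans ?_ (congrArg (gm A.locPresheaf hU k) (Loc.op_mk f t))
    refine Eq.trans ?_ ((gm A.locPresheaf hU k).map_op' f _).symm
    exact congrArg _ (funext fun i => ih i)

/-- Equal germs become equal in the localization over a neighbourhood of `p`. There `Loc.repr_rel`
applies, and elements of `A_k` represent themselves. -/
theorem preGerm_eq_iff {x y : A.lev k} :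
    preGerm p k x = preGerm p k y ↔ EqAt (A.value p) (A.deg k) x y := by
  refine ⟨fun h => ?_, preGerm_eq_of⟩
  obtain ⟨W, hW, _, _, e⟩ := gm_eq h
  have e' : Loc.of (A.invertedAt W (op (SimplexCategory.mk k))) x = Loc.of _ y := e
  obtain ⟨inv, hinv⟩ := exists_inverse (k := k) hW
  exact Loc.repr_rel hinv (_root_.Quotient.exact e')

variable (p k) in
/-- The germ at a point of the spectrum of a simplex, in the structure sheaf. -/
noncomputable def spGerm : CHom (A.lev k) ((stalkSC A.spec.presheaf p).lev k) :=
  (gg A.spec.presheaf p k).comp (lmap A.toGlobal k)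

theorem spGerm_eq (a : A.lev k) : spGerm p k a =
    stMap (toSheafify (level A.locPresheaf (op (SimplexCategory.mk k)))) p (preGerm p k a) :=
  (stMap_germ (toSheafify (level A.locPresheaf (op (SimplexCategory.mk k)))) _ _).symm

theorem spGerm_surjective : Function.Surjective (spGerm p k) := fun ξ => by
  obtain ⟨ζ, rfl⟩ := (stMap_toSheafify_bijective _ p).2 ξ
  obtain ⟨a, rfl⟩ := preGerm_surjective ζ
  exact ⟨a, spGerm_eq a⟩

theorem spGerm_eq_iff {x y : A.lev k} :
    spGerm p k x = spGerm p k y ↔ EqAt (A.value p) (A.deg k) x y := by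
  refine Iff.trans ⟨fun h => ?_, fun h => ?_⟩ preGerm_eq_iff
  · exact (stMap_toSheafify_bijective _ p).1 ((spGerm_eq x).symm.trans (h.trans (spGerm_eq y)))
  · exact (spGerm_eq x).trans ((congrArg _ h).trans (spGerm_eq y).symm)

theorem spGerm_str {m : ℕ} (θ : SimplexCategory.mk m ⟶ SimplexCategory.mk k) (a : A.lev k) :
    spGerm p m (A.str θ a) = (stalkSC A.spec.presheaf p).str θ (spGerm p k a) :=
  lmap_str (A.toGlobal ≫ germTop A.spec.presheaf p) θ a

theorem isUnit_spGerm {a : A.lev 0} (ha : A.value p a ≠ 0) : IsUnit (spGerm p 0 a) := by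
  obtain ⟨b, c, hc, e⟩ := exists_inv_at (A.value p) ha
  refine IsUnit.of_mul_eq_one (spGerm p 0 b) ?_
  rw [← map_mul, ← map_one (spGerm p 0), spGerm_eq_iff]
  exact ⟨c, hc, by rw [mul_one, deg_zero, e]⟩

theorem isLocal_stalk (p : A.spTop) : IsLocalCRing ((stalkSC A.spec.presheaf p).lev 0) := by
  obtain ⟨ev, hev⟩ := exists_factor (spGerm p 0) spGerm_surjective (A.value p) fun a ha => by
    rw [← map_zero (spGerm p 0), spGerm_eq_iff] at ha
    obtain ⟨c, hc, e⟩ := ha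
    rw [deg_zero, mul_zero] at e
    have := congrArg (A.value p) e
    rw [map_mul, map_zero] at this
    exact (mul_eq_zero.1 this).resolve_left hc
  refine isLocalCRing_of ev fun ξ hξ => ?_
  obtain ⟨a, rfl⟩ := spGerm_surjective ξ
  rw [hev] at hξ
  exact isUnit_spGerm hξ

open IsLocalizedCInftySpace

theorem value_eq_zero {a : A.lev 0} (ha : a ∈ A.piZeroIdeal) : A.value p a = 0 := by
  have : A.quot a = 0 := by
    rw [← map_zero A.quot, A.quot_eq, sub_zero]; exact ha
  exact (congrArg (Sp.eval (A := A.PiZero) p) this).trans (map_zero _)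

/-- The stalk of the sheaf `π₀` at `p` is the localization of `π₀(A)` at `p`: a `1`-simplex of the
stalk lifts to `A₁`, at the price of a factor `c` that is a unit in the stalk. -/
theorem toF_spGerm_eq_zero {a : A.lev 0} :
    toF (Y := A.spec) p (spGerm p 0 a) = 0 ↔
      ∃ c : A.lev 0, A.value p c ≠ 0 ∧ c * a ∈ A.piZeroIdeal := by
  rw [toF_eq_zero]
  constructor
  · rintro ⟨η, hη⟩
    obtain ⟨y, rfl⟩ := spGerm_surjective η
    rw [← spGerm_str, ← spGerm_str, ← map_sub, spGerm_eq_iff] at hη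
    obtain ⟨c, hc, e⟩ := hη
    refine ⟨c, hc, ?_⟩
    rw [deg_zero] at e
    rw [← e]
    exact Ideal.mul_mem_left _ _ ⟨y, rfl⟩
  · rintro ⟨c, hc, y, hy⟩
    have h1 : spGerm p 0 c * spGerm p 0 a ∈ (stalkSC A.spec.presheaf p).piZeroIdeal := by
      refine ⟨spGerm p 1 y, ?_⟩
      rw [← spGerm_str, ← spGerm_str, ← map_sub, ← map_mul, ← hy]
    exact ((stalkSC A.spec.presheaf p).piZeroIdeal.unit_mul_mem_iff_mem (isUnit_spGerm hc)).1 h1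

theorem isLocal_piZero_stalk (p : A.spTop) : IsLocalCRing (Stalk (piZeroSheaf A.spec.presheaf) p) := by
  have : Nontrivial (Stalk (piZeroSheaf A.spec.presheaf) p) := by
    refine nontrivial_of_ne 1 0 fun h => ?_
    have h1 : toF (Y := A.spec) p (spGerm p 0 1) = 0 :=
      (congrArg (toF (Y := A.spec) p) (map_one (spGerm p 0))).trans ((map_one _).trans h)
    obtain ⟨c, hc, h2⟩ := toF_spGerm_eq_zero.1 h1
    rw [mul_one] at h2
    exact hc (value_eq_zero h2)
  exact (isLocal_stalk p).of_surjective (toF (Y := A.spec) p) (toF_surjective (Y := A.spec) p)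

end SCRing

end CInfty

namespace CInfty

open Topology Filter AlgebraicGeometry

/-! ### The spectrum of a simplicial `C^∞`-ring is a `C^∞`-space -/

section Criterion

variable {X : TopCat.{u}} {F : X.Presheaf CRing.{u}}
  (hF : TopCat.Presheaf.IsSheaf (F ⋙ forget CRing.{u})) (hl : ∀ x : X, IsLocalCRing (Stalk F x))

include hF in
/-- Sections of a sheaf of `C^∞`-rings with local stalks are generated by coordinates of a closed
embedding, provided that the germs are. -/
theorem surjective_of_germ {U : Opens X} {n : ℕ} (Ψ : CHom (SmoothFn n) (F.obj (op U)))
    {j : X → Fin n → ℝ} (hj : IsClosedEmbedding fun x : U => j x)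
    (hΨ : ∀ (x : X) (hx : x ∈ U), (fun i => (hl x).ev (germ F hx (Ψ (SmoothFn.proj i)))) = j x)
    (hs : ∀ (x : X) (hx : x ∈ U) (ξ : Stalk F x), ∃ f, germ F hx (Ψ f) = ξ) :
    Function.Surjective Ψ := fun σ => by
  have hcongr : ∀ (x : X) (hx : x ∈ U) {f g : SmoothFn n}, f.1 =ᶠ[𝓝 (j x)] g.1 →
      germ F hx (Ψ f) = germ F hx (Ψ g) := fun x hx f g h =>
    (hl x).hom_congr ((germHom F hx).comp Ψ) (by convert h using 2; exact hΨ x hx)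
  -- Functions on `ℝⁿ` representing `σ` locally are glued, rather than sections: their locally
  -- finite sum is again smooth, and it is the preimage of `σ`.
  obtain ⟨g, hg⟩ := exists_smooth_glue hj
    (fun y => {g | ∀ hy : y ∈ U, germ F hy (Ψ g) = germ F hy σ})
    (fun x hx => by
      obtain ⟨f, hf⟩ := hs x hx (germ F hx σ)
      obtain ⟨W, hW, hWU, _, e⟩ := germ_eq F hx hx _ _ hf
      refine ⟨W, hW, f, fun y hy hyU _ => ?_⟩
      have := congrArg (germ F hy) e
      rwa [germ_res, germ_res] at this)
    (fun y _ S ρ g h hg hρ hh hy => by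
      rw [hcongr y hy hh, map_sum, ← germHom_apply, map_sum]
      have h1 : ∑ i ∈ S, germHom F hy (Ψ (ρ i)) = 1 := by
        rw [← map_sum, ← map_sum, germHom_apply, hcongr y hy (g := 1) hρ, map_one,
          ← germHom_apply, map_one]
      rw [← one_mul (germ F hy σ), ← h1, Finset.sum_mul]
      refine Finset.sum_congr rfl fun i hi => ?_
      rw [map_mul, map_mul]
      exact congrArg _ (hg i hi hy))
  exact ⟨g, sec_ext hF fun x hx => hg x hx hx⟩

/-- The part of `ℝⁿ` where a function `h` does not vanish, as a closed subset of `ℝⁿ⁺¹`. -/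
theorem isClosedEmbedding_cons {U : Opens X} {n : ℕ} {j : X → Fin n → ℝ}
    (hj : IsClosedEmbedding j) (h : SmoothFn n) (hU : ∀ x, x ∈ U ↔ h.1 (j x) ≠ 0) :
    IsClosedEmbedding fun x : U => (Fin.cons (h.1 (j x))⁻¹ (j x) : Fin (n + 1) → ℝ) := by
  have hjU : Continuous fun x : U => j x := hj.continuous.comp continuous_subtype_val
  have hc : Continuous fun x : U => (Fin.cons (h.1 (j x))⁻¹ (j x) : Fin (n + 1) → ℝ) := by
    refine continuous_pi fun i => ?_
    refine Fin.cases ?_ (fun i => ?_) i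
    · simp only [Fin.cons_zero]
      exact (h.contDiff.continuous.comp hjU).inv₀ fun x => (hU x).1 x.2
    · simp only [Fin.cons_succ]
      exact (continuous_apply i).comp hjU
  have ht : Continuous (Fin.tail : (Fin (n + 1) → ℝ) → Fin n → ℝ) :=
    continuous_pi fun i => continuous_apply i.succ
  refine ⟨IsEmbedding.of_comp hc ht (hj.isEmbedding.comp IsEmbedding.subtypeVal), ?_⟩
  have : (Set.range fun x : U => (Fin.cons (h.1 (j x))⁻¹ (j x) : Fin (n + 1) → ℝ)) =
      {q | q 0 * h.1 (Fin.tail q) = 1} ∩ Fin.tail ⁻¹' Set.range j := by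
    ext q
    constructor
    · rintro ⟨x, rfl⟩
      exact ⟨inv_mul_cancel₀ ((hU x).1 x.2), x, rfl⟩
    · rintro ⟨h1, x, hx⟩
      change q 0 * h.1 (Fin.tail q) = 1 at h1
      rw [← hx] at h1
      refine ⟨⟨x, (hU x).2 (right_ne_zero_of_mul_eq_one h1)⟩, ?_⟩
      change (Fin.cons (h.1 (j x))⁻¹ (j x) : Fin (n + 1) → ℝ) = q
      rw [← eq_inv_of_mul_eq_one_left h1, hx, Fin.cons_self_tail]
  rw [this]
  exact (isClosed_eq ((continuous_apply 0).mul (h.contDiff.continuous.comp ht))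
    continuous_const).inter (hj.isClosed_range.preimage ht)

include hF in
/-- A sheaf of `C^∞`-rings with local stalks, all of whose germs come from the coordinates of a
closed embedding into `ℝⁿ`, defines a `C^∞`-space. -/
theorem isCInftySpace_of_chart {n : ℕ} (Ψ : CHom (SmoothFn n) (F.obj (op ⊤)))
    {j : X → Fin n → ℝ} (hj : IsClosedEmbedding j)
    (hΨ : ∀ (x : X) (hx : x ∈ (⊤ : Opens X)),
      (fun i => (hl x).ev (germ F hx (Ψ (SmoothFn.proj i)))) = j x)
    (hs : ∀ (x : X) (hx : x ∈ (⊤ : Opens X)) (ξ : Stalk F x), ∃ f, germ F hx (Ψ f) = ξ) :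
    IsCInftySpace F where
  t2 := hj.isEmbedding.t2Space
  isSheaf := hF
  isLocal := hl
  isSoft Z hZ σ hσ := by
    have hj' := hj.comp (isClosed_univ (X := X)).isClosedEmbedding_subtypeVal
    have hcongr : ∀ (x : X) (hx : x ∈ (⊤ : Opens X)) {f g : SmoothFn n}, f.1 =ᶠ[𝓝 (j x)] g.1 →
        germHom F hx (Ψ f) = germHom F hx (Ψ g) := fun x hx f g h =>
      (hl x).hom_congr ((germHom F hx).comp Ψ) (by convert h using 2; exact hΨ x hx)
    let C : ∀ y : X, Set (Stalk F y) := fun y => {ξ | ∀ hy : y ∈ Z, ξ = σ y hy}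
    suffices H : ∃ τ : ShSec F ⊤, ∀ (y : X) (hy : y ∈ (⊤ : Opens X)), τ.val hy ∈ C y by
      obtain ⟨τ, hτ⟩ := H
      obtain ⟨s, hs⟩ := exists_sec hF τ
      exact ⟨s, fun y hy => (hs y trivial).trans (hτ y trivial hy)⟩
    refine exists_glue (U := ⊤) F hj' C (fun y => {τ | ∃ ξ ∈ C y, τ = fun f =>
      germHom F (show y ∈ (⊤ : Opens X) from trivial) (Ψ f) * ξ}) ?_ ?_ ?_
    · intro x _
      have : ∃ (W : Opens X) (_ : x ∈ W) (s : F.obj (op W)),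
          ∀ (y : X) (hy : y ∈ W), germ F hy s ∈ C y := by
        by_cases hx : x ∈ Z
        · obtain ⟨W, hW, s, hs⟩ := hσ x hx
          exact ⟨W, hW, s, fun y hy hyZ => (hs y hy hyZ).symm⟩
        · exact ⟨⟨Zᶜ, hZ.isOpen_compl⟩, hx, 0, fun y hy hyZ => (hy hyZ).elim⟩
      obtain ⟨W, hW, s, hs⟩ := this
      refine ⟨W, hW, fun f => res F le_top (Ψ f) * s, fun y hy _ => ⟨_, hs y hy, funext fun f => ?_⟩⟩
      rw [← germHom_apply, map_mul, germHom_apply, germ_res]; rfl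
    · rintro y - _ ⟨ξ, -, rfl⟩ f hf
      change _ * ξ = 0
      rw [hcongr y trivial (g := 0) hf, map_zero, map_zero, zero_mul]
    · rintro y - S ρ τ hτ hρ hy
      have h1 : ∑ i ∈ S, germHom F (show y ∈ (⊤ : Opens X) from trivial) (Ψ (ρ i)) = 1 := by
        rw [← map_sum, ← map_sum, hcongr y trivial (g := 1) hρ, map_one, map_one]
      rw [← one_mul (σ y hy), ← h1, Finset.sum_mul]
      refine Finset.sum_congr rfl fun i hi => ?_
      obtain ⟨ξ, hξ, e⟩ := hτ i hi
      rw [e]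
      exact congrArg _ (hξ hy)
  isFinitelyGenerated U := by
    -- Every open subset of `ℝⁿ` is the set where some smooth `h` does not vanish. Adding `1/h` as a
    -- coordinate makes `U` closed in `ℝⁿ⁺¹`, so finite generation over `U` follows by the same
    -- gluing.
    obtain ⟨O, hO, hOU⟩ := hj.isInducing.isOpen_iff.1 U.2
    obtain ⟨h, hh, hh', -⟩ := hO.exists_contDiff_support_eq (n := ⊤)
    let h' : SmoothFn n := ⟨h, hh'⟩
    have hU : ∀ x, x ∈ U ↔ h'.1 (j x) ≠ 0 := fun x => by
      rw [← Function.mem_support, show Function.support h'.1 = O from hh]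
      exact (Set.ext_iff.1 hOU x).symm
    have hev : ∀ (x : X) (f : SmoothFn n), (hl x).ev (germ F (show x ∈ (⊤ : Opens X) from trivial)
        (Ψ f)) = f.1 (j x) := fun x f => by
      rw [← hΨ x trivial]
      exact CHom.eval_real ((hl x).ev.comp ((germHom F _).comp Ψ)) f
    have hu : IsUnit (res F (le_top (a := U)) (Ψ h')) := isUnit_of_germ hF _ fun x hx => by
      rw [germ_res, (hl x).isUnit_iff]
      exact (hev x h').trans_ne ((hU x).1 hx)
    obtain ⟨v, hv⟩ := hu.exists_left_inv
    let Ψ' : CHom (SmoothFn (n + 1)) (F.obj (op U)) :=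
      evalHom (Fin.cons v fun i => res F le_top (Ψ (SmoothFn.proj i)))
    have hΨ' : ∀ (x : X) (hx : x ∈ U),
        (fun i => (hl x).ev (germ F hx (Ψ' (SmoothFn.proj i)))) =
          (Fin.cons (h'.1 (j x))⁻¹ (j x) : Fin (n + 1) → ℝ) := fun x hx => by
      funext i
      rw [evalHom_proj]
      refine Fin.cases ?_ (fun i => ?_) i
      · rw [Fin.cons_zero, Fin.cons_zero]
        refine eq_inv_of_mul_eq_one_left ?_
        have := congrArg (fun s => (hl x).ev (germHom F hx s)) hv
        simp only [map_mul, map_one] at this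
        rwa [germHom_apply, germHom_apply, germ_res, hev] at this
      · rw [Fin.cons_succ, Fin.cons_succ, germ_res, hev]; rfl
    refine ⟨n + 1, Ψ', surjective_of_germ hF hl Ψ' (isClosedEmbedding_cons hj h' hU) hΨ' ?_⟩
    intro x hx ξ
    obtain ⟨f, rfl⟩ := hs x trivial ξ
    refine ⟨SmoothFn.comp f fun i => SmoothFn.proj i.succ, ?_⟩
    rw [← germ_res F (le_top (a := U)) hx]
    refine congrArg (germ F hx) ?_
    refine (Ψ'.map_op' f _).trans ?_
    have e := DFunLike.congr_fun (CHom.eq_evalHom ((res F (le_top (a := U))).comp Ψ)) f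
    refine Eq.trans ?_ e.symm
    refine congrArg (CInftyRing.op f) (funext fun i => ?_)
    exact (evalHom_proj _ _).trans (Fin.cons_succ _ _ _)

end Criterion

namespace SCRing

variable (A : SCRing.{u})

open IsLocalizedCInftySpace

/-- The comparison of `π₀(A)` with the global sections of the sheaf `π₀` on the spectrum. -/
noncomputable def toPiZeroSheaf : CHom A.PiZero ((piZeroSheaf A.spec.presheaf).obj (op ⊤)) :=
  (kappa A.spec).comp (piZeroMap A.toGlobal)

variable {A}

theorem germ_toPiZeroSheaf (p : A.spTop) (hp : p ∈ (⊤ : Opens A.spTop)) (a : A.lev 0) :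
    germ (piZeroSheaf A.spec.presheaf) hp (A.toPiZeroSheaf (A.quot a)) =
      toF (Y := A.spec) p (spGerm p 0 a) :=
  (congrArg (fun b => germ (piZeroSheaf A.spec.presheaf) hp (kappa A.spec b))
    (piZeroMap_quot A.toGlobal a)).trans (germ_kappa (Y := A.spec) _)

/-- Elements that do not vanish at `p` become units in the stalk, and this alone identifies the
residue morphism with `p`. -/
theorem ev_toPiZeroSheaf (p : A.spTop) (hp : p ∈ (⊤ : Opens A.spTop)) (b : A.PiZero) :
    (isLocal_piZero_stalk p).ev (germ (piZeroSheaf A.spec.presheaf) hp (A.toPiZeroSheaf b)) =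
      Sp.eval (A := A.PiZero) p b := by
  refine DFunLike.congr_fun (CHom.eq_of_ne_zero (p := Sp.eval (A := A.PiZero) p)
    (g := (isLocal_piZero_stalk p).ev.comp
      ((germHom (piZeroSheaf A.spec.presheaf) hp).comp A.toPiZeroSheaf)) fun b hb => ?_) b
  obtain ⟨a, rfl⟩ := A.quot_surjective b
  refine (isLocal_piZero_stalk p).isUnit_iff.1 ?_
  refine (congrArg IsUnit (germ_toPiZeroSheaf p hp a)).mpr ?_
  exact (isUnit_spGerm hb).map (toF (Y := A.spec) p)

theorem exists_germ_toPiZeroSheaf {n : ℕ} {φ : CHom (SmoothFn n) A.PiZero}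
    (hφ : Function.Surjective φ) (p : A.spTop) (hp : p ∈ (⊤ : Opens A.spTop))
    (ξ : Stalk (piZeroSheaf A.spec.presheaf) p) :
    ∃ f, germ (piZeroSheaf A.spec.presheaf) hp (A.toPiZeroSheaf.comp φ f) = ξ := by
  obtain ⟨η, rfl⟩ := toF_surjective (Y := A.spec) p ξ
  obtain ⟨a, rfl⟩ := spGerm_surjective η
  obtain ⟨f, hf⟩ := hφ (A.quot a)
  refine ⟨f, Eq.trans ?_ (germ_toPiZeroSheaf p hp a)⟩
  rw [← hf]; rfl

/-- The spectrum of a simplicial `C^∞`-ring with finitely generated `π₀` is a localized simplicial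
`C^∞`-space. -/
theorem isLocalizedCInftySpace_spec (hA : IsFinitelyGenerated A.PiZero) :
    IsLocalizedCInftySpace A.spec := by
  obtain ⟨n, φ, hφ⟩ := hA
  exact ⟨⟨fun k => sheafify_isSheaf (level A.locPresheaf k),
    isCInftySpace_of_chart (sheafify_isSheaf _) isLocal_piZero_stalk (A.toPiZeroSheaf.comp φ)
      (j := Sp.chart φ) (Sp.isClosedEmbedding_chart hφ)
      (fun p hp => funext fun i => ev_toPiZeroSheaf p hp _) (exists_germ_toPiZeroSheaf hφ)⟩,
    isLocal_stalk⟩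

end SCRing

end CInfty

namespace CInfty

open Topology Filter AlgebraicGeometry

/-! ### Isomorphisms -/

theorem CRing.isIso_of_bijective {A B : CRing.{u}} (f : A ⟶ B) (hf : Function.Bijective f.hom) :
    IsIso f := by
  obtain ⟨g, hg⟩ := exists_factor f.hom hf.2 (CHom.id A) fun a ha =>
    hf.1 (ha.trans (map_zero f.hom).symm)
  refine ⟨⟨⟨g⟩, CRing.hom_ext' hg, CRing.hom_ext' fun b => ?_⟩⟩
  obtain ⟨a, rfl⟩ := hf.2 b
  exact congrArg f.hom (hg a)

theorem SCRing.isIso_of_bijective {A B : SCRing.{u}} (f : A ⟶ B)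
    (hf : ∀ k, Function.Bijective (f.app k).hom) : IsIso f :=
  have := fun k => CRing.isIso_of_bijective (f.app k) (hf k)
  NatIso.isIso_of_isIso_app f

theorem toSheafify_bijective {X : TopCat.{u}} {P : X.Presheaf CRing.{u}}
    (hP : TopCat.Presheaf.IsSheaf (P ⋙ forget CRing.{u})) (U : Opens X) :
    Function.Bijective ((toSheafify P).app (op U)).hom := by
  refine ⟨fun s t h => sec_ext hP fun x hx => ?_, fun σ => ?_⟩
  · exact congrArg (fun σ : ShSec P U => σ.val hx) h
  · obtain ⟨s, hs⟩ := exists_sec hP σ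
    exact ⟨s, ShSec.ext hs⟩

theorem isIso_toSimplicialSheafify {X : TopCat.{u}} {P : X.Presheaf SCRing.{u}}
    (hP : ∀ k, TopCat.Presheaf.IsSheaf (level P k ⋙ forget CRing.{u})) :
    IsIso (toSimplicialSheafify P) :=
  have : ∀ U, IsIso ((toSimplicialSheafify P).app U) := fun U =>
    SCRing.isIso_of_bijective _ fun k => toSheafify_bijective (hP k) U.unop
  NatIso.isIso_of_isIso_app _

/-! ### Morphisms to a spectrum -/

namespace IsLocalizedCInftySpace

variable {Y : PresheafedSpace SCRing.{u}} (hY : IsLocalizedCInftySpace Y) {A : SCRing.{u}}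

/-! ### Uniqueness of the morphism with a given transpose. -/

section Unique

variable (G : Y ⟶ A.spec)

/-- The morphism to the global sections given by a morphism to a spectrum. -/
noncomputable def transpose : A ⟶ Y.presheaf.obj (op ⊤) := A.toGlobal ≫ G.c.app (op ⊤)

theorem stalkMap_spGerm (y : Y.carrier) {k : ℕ} (a : A.lev k) :
    stalkMap G.base (levelMap G.c (op (SimplexCategory.mk k))) y
      (SCRing.spGerm (G.base y) k a) = gg Y.presheaf y k (SCRing.lmap (transpose G) k a) :=
  stalkMap_germ G.base (levelMap G.c (op (SimplexCategory.mk k))) _ _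

-- The stalk map of `G` carries units to units. By `CHom.eq_of_ne_zero` this determines the point
-- `G.base y`, with no locality assumption on the morphism.
include hY in
theorem value_base (y : Y.carrier) (a : A.lev 0) : A.value (G.base y) a =
    hY.ev y (gg Y.presheaf y 0 (SCRing.lmap (transpose G) 0 a)) := by
  refine (DFunLike.congr_fun (CHom.eq_of_ne_zero (p := A.value (G.base y)) (g := (hY.ev y).comp
    ((gg Y.presheaf y 0).comp (SCRing.lmap (transpose G) 0))) fun b hb => ?_) a).symm
  refine hY.isUnit_iff.1 ?_
  have h := (SCRing.isUnit_spGerm hb).map (⟨stalkMap G.base (levelMap G.c _) y,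
    stalkMap_op G.base (levelMap G.c _) y⟩ : CHom ((stalkSC A.spec.presheaf (G.base y)).lev 0)
      ((stalkSC Y.presheaf y).lev 0))
  exact (congrArg IsUnit (stalkMap_spGerm G y b)).mp h

-- The values determine the map of spaces. Every germ on the spectrum is the germ of an element of
-- `A`, and its image in the stalk of `Y` is computed by the transpose.
include hY in
theorem hom_ext {G G' : Y ⟶ A.spec} (h : transpose G = transpose G') : G = G' := by
  have hb : G.base = G'.base := by
    refine TopCat.hom_ext (ContinuousMap.ext fun y => ?_)
    refine SCRing.piZero_hom_ext fun a => ?_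
    exact (hY.value_base G y a).trans ((congrArg (fun f => hY.ev y (gg Y.presheaf y 0
      (SCRing.lmap f 0 a))) h).trans (hY.value_base G' y a).symm)
  obtain ⟨φ, c⟩ := G
  obtain ⟨φ', c'⟩ := G'
  obtain rfl : φ = φ' := hb
  refine congrArg (PresheafedSpace.Hom.mk φ) ?_
  refine NatTrans.ext (funext fun U => NatTrans.ext (funext fun k => CRing.hom_ext' fun σ => ?_))
  refine sec_ext (hY.isSheaf k) fun y hy => ?_
  obtain ⟨a, ha⟩ := SCRing.spGerm_surjective (A := A) (p := φ y) (k := k.unop.len)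
    (germ (level A.spec.presheaf k) (U := U.unop) hy σ)
  have key : ∀ c : A.spec.presheaf ⟶ (TopCat.Presheaf.pushforward SCRing.{u} φ).obj Y.presheaf,
      germ (level Y.presheaf k) hy ((c.app U).app k σ) =
        gg Y.presheaf y k.unop.len (SCRing.lmap (transpose ⟨φ, c⟩) k.unop.len a) := fun c =>
    (stalkMap_germ φ (levelMap c k) (U := U.unop) hy σ).symm.trans
      ((congrArg (stalkMap φ (levelMap c k) y) ha.symm).trans (stalkMap_spGerm ⟨φ, c⟩ y a))
  exact (key c).trans ((congrArg (fun f => gg Y.presheaf y k.unop.len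
    (SCRing.lmap f k.unop.len a)) h).trans (key c').symm)

end Unique

/-! ### Construction of the morphism from its transpose. -/

section Existence

variable (f : A ⟶ Y.presheaf.obj (op ⊤))

/-- The map from a space to a spectrum given by a morphism to its global sections. -/
noncomputable def liftBase : Y.carrier ⟶ A.spTop :=
  TopCat.ofHom ⟨fun y => Sp.map (SCRing.piZeroMap f) (hY.pt y),
    (Sp.continuous_map _).comp hY.continuous_pt⟩

theorem value_liftBase (y : Y.carrier) (a : A.lev 0) : A.value (hY.liftBase f y) a =
    hY.ev y (gg Y.presheaf y 0 (SCRing.lmap f 0 a)) :=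
  (congrArg (Sp.eval (hY.pt y)) (SCRing.piZeroMap_quot f a)).trans (hY.eval_pt y _)

/-- The sections over an open subset given by a morphism to the global sections. -/
def restrictTo (V : Opens Y.carrier) : A ⟶ Y.presheaf.obj (op V) :=
  f ≫ Y.presheaf.map (homOfLE le_top).op

/-- Degeneracies preserve units, so only degree `0` matters. There an element whose values are
nonzero is a unit in each stalk, hence over the open set. -/
theorem isUnit_restrictTo (U : Opens A.spTop) (k : SimplexCategoryᵒᵖ) :
    ∀ a ∈ A.invertedAt U k,
      IsUnit (((restrictTo f ((Opens.map (hY.liftBase f)).obj U)).app k).hom a) := by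
  rintro _ ⟨a, ha, rfl⟩
  refine (congrArg IsUnit (SCRing.app_degAt (restrictTo f _) k a)).mpr ?_
  refine IsUnit.map (SCRing.degAt _ k) (isUnit_of_germ (hY.isSheaf _) _ fun y hy => ?_)
  refine (congrArg IsUnit (gm_rs (O := Y.presheaf) le_top hy (SCRing.lmap f 0 a))).mpr ?_
  refine hY.isUnit_iff.2 ?_
  exact (hY.value_liftBase f y a).symm.trans_ne (ha _ hy)

/-- The morphism from the presheaf of localizations given by a morphism to the global sections. -/
noncomputable def liftPre : A.locPresheaf ⟶
    (TopCat.Presheaf.pushforward SCRing.{u} (hY.liftBase f)).obj Y.presheaf where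
  app U :=
    { app := fun k => ⟨Loc.lift ((restrictTo f ((Opens.map (hY.liftBase f)).obj U.unop)).app k).hom
        (hY.isUnit_restrictTo f U.unop k)⟩
      naturality := fun _ _ θ => CRing.Hom.ext (Loc.hom_ext fun a =>
        ConcreteCategory.congr_hom ((restrictTo f _).naturality θ) a) }
  naturality U V i := NatTrans.ext (funext fun k => CRing.Hom.ext (Loc.hom_ext fun a => by
    have : restrictTo f ((Opens.map (hY.liftBase f)).obj U.unop) ≫
        Y.presheaf.map ((Opens.map (hY.liftBase f)).map i.unop).op =
          restrictTo f ((Opens.map (hY.liftBase f)).obj V.unop) := by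
      rw [restrictTo, restrictTo, Category.assoc, ← Functor.map_comp]; rfl
    exact (ConcreteCategory.congr_hom (congrArg (fun g => NatTrans.app g k) this) a).symm))

/-- The morphism to a spectrum given by a morphism to the global sections. -/
noncomputable def lift : Y ⟶ A.spec :=
  have := isIso_toSimplicialSheafify hY.isSheaf
  { base := hY.liftBase f
    c := simplicialSheafifyMap (hY.liftPre f) ≫
      (TopCat.Presheaf.pushforward SCRing.{u} (hY.liftBase f)).map
        (inv (toSimplicialSheafify Y.presheaf)) }

/-- The two morphisms are compared in the associated sheaf, which is isomorphic to the given one.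
There the inverse isomorphism in the construction cancels. -/
theorem transpose_lift : transpose (hY.lift f) = f := by
  have := isIso_toSimplicialSheafify hY.isSheaf
  have h1 : transpose (hY.lift f) ≫ (toSimplicialSheafify Y.presheaf).app (op ⊤) =
      A.toGlobal ≫ (simplicialSheafifyMap (hY.liftPre f)).app (op ⊤) := by
    refine (Category.assoc _ _ _).trans (congrArg (A.toGlobal ≫ ·) ?_)
    refine (Category.assoc _ _ _).trans (Eq.trans ?_ (Category.comp_id _))
    refine congrArg _ ?_
    exact congrArg (fun g => NatTrans.app g (op ⊤)) (IsIso.inv_hom_id (toSimplicialSheafify Y.presheaf))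
  have h2 : A.toGlobal ≫ (simplicialSheafifyMap (hY.liftPre f)).app (op ⊤) =
      f ≫ (toSimplicialSheafify Y.presheaf).app (op ⊤) := by
    refine NatTrans.ext (funext fun k => CRing.hom_ext' fun a => ShSec.ext fun y hy => ?_)
    refine (stalkMap_germ (hY.liftBase f) (levelMap (hY.liftPre f) k) (U := ⊤) hy
      (Loc.of _ a)).trans ?_
    exact germ_res (level Y.presheaf k) le_top hy ((f.app k).hom a)
  exact (cancel_mono _).1 (h1.trans h2)

end Existence

end IsLocalizedCInftySpace

end CInfty

namespace CInfty

open Topology Filter AlgebraicGeometry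

/-! ### The adjunction -/

theorem SCRing.toGlobal_naturality {A B : SCRing.{u}} (g : A ⟶ B) :
    A.toGlobal ≫ (SCRing.spectrum.map g.op).c.app (op ⊤) = g ≫ B.toGlobal := by
  refine NatTrans.ext (funext fun k => CRing.hom_ext' fun a => ShSec.ext fun y hy => ?_)
  exact stalkMap_germ (SCRing.spMap g) (levelMap (SCRing.preSpMap g).c k) (U := ⊤) hy (Loc.of _ a)

section Adjunction

variable (hΓ : ∀ X : LocalizedSpace.{u}, SCRing.IsGeometric (PresheafedSpace.Γ.obj (op X.obj)))
  (hSp : ∀ A : GeometricRing.{u}, IsLocalizedCInftySpace (SCRing.spectrum.obj (op A.obj)))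

/-- The morphisms to a spectrum are the morphisms to the ring of global sections. -/
noncomputable def homEquiv (Y : LocalizedSpace.{u}) (A : GeometricRing.{u}ᵒᵖ) :
    ((globalSections hΓ).obj Y ⟶ A) ≃ (Y ⟶ (geometricSpectrum hSp).obj A) where
  toFun f := ObjectProperty.homMk (Y.property.lift (A := A.unop.obj) f.unop.hom)
  invFun G := Quiver.Hom.op
    (ObjectProperty.homMk (IsLocalizedCInftySpace.transpose (A := A.unop.obj) G.hom))
  left_inv f := Quiver.Hom.unop_inj
    (ObjectProperty.hom_ext _ (Y.property.transpose_lift (A := A.unop.obj) f.unop.hom))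
  right_inv _ := ObjectProperty.hom_ext _
    (Y.property.hom_ext (A := A.unop.obj) (Y.property.transpose_lift _))

/-- Global sections are left adjoint to the spectrum. -/
noncomputable def adjunction : globalSections hΓ ⊣ geometricSpectrum hSp :=
  Adjunction.mkOfHomEquiv
    { homEquiv := homEquiv hΓ hSp
      homEquiv_naturality_left_symm := fun _ _ => rfl
      homEquiv_naturality_right := fun {Y A B} f g => by
        refine (Equiv.eq_symm_apply _).1 ?_
        refine Quiver.Hom.unop_inj (ObjectProperty.hom_ext _ ?_)
        have h1 := SCRing.toGlobal_naturality g.unop.hom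
        have h2 := Y.property.transpose_lift (A := A.unop.obj) f.unop.hom
        change g.unop.hom ≫ f.unop.hom = B.unop.obj.toGlobal ≫
          ((SCRing.spectrum.map g.unop.hom.op).c.app (op ⊤) ≫
            (Y.property.lift (A := A.unop.obj) f.unop.hom).c.app (op ⊤))
        refine Eq.trans ?_ (Category.assoc _ _ _)
        refine Eq.trans ?_ (congrArg (· ≫ _) h1.symm)
        exact (congrArg (g.unop.hom ≫ ·) h2.symm).trans (Category.assoc _ _ _).symm }

theorem counit_adjunction (A : GeometricRing.{u}ᵒᵖ) :
    ((adjunction hΓ hSp).counit.app A).unop.hom = A.unop.obj.toGlobal :=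
  Category.comp_id _

theorem unit_adjunction (Y : LocalizedSpace.{u}) :
    ((adjunction hΓ hSp).unit.app Y).hom =
      Y.property.lift (A := Y.obj.presheaf.obj (op ⊤)) (𝟙 _) := rfl

end Adjunction

/-! ### The unit -/

/-- A morphism of sheaves over a homeomorphism that is bijective on stalks is bijective on
sections. -/
theorem comap_bijective {X Y : TopCat.{u}} {P : X.Presheaf CRing.{u}} {Q : Y.Presheaf CRing.{u}}
    (hP : TopCat.Presheaf.IsSheaf (P ⋙ forget CRing.{u}))
    (hQ : TopCat.Presheaf.IsSheaf (Q ⋙ forget CRing.{u})) {φ : Y ⟶ X} (hφ : IsHomeomorph φ)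
    {η : P ⟶ (TopCat.Presheaf.pushforward CRing.{u} φ).obj Q}
    (h : ∀ y, Function.Bijective (stalkMap φ η y)) (U : Opens X) :
    Function.Bijective (comap φ η U) := by
  -- Injectivity over all open sets comes before surjectivity: it makes local preimages agree on
  -- overlaps.
  have hinj : ∀ U, Function.Injective (comap φ η U) := fun U s t e => sec_ext hP fun x hx => by
    obtain ⟨y, rfl⟩ := hφ.surjective x
    refine (h y).1 ?_
    rw [stalkMap_germ, stalkMap_germ, e]
  refine ⟨hinj U, fun t => ?_⟩
  have hloc : ∀ y : ((Opens.map φ).obj U : Opens Y), ∃ (V : Opens X) (_ : φ y ∈ V) (hVU : V ≤ U)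
      (s : P.obj (op V)), comap φ η V s = res Q (preimage_mono φ hVU) t := by
    rintro ⟨y, hy⟩
    obtain ⟨ξ, hξ⟩ := (h y).2 (germ Q hy t)
    obtain ⟨V, hV, s, rfl⟩ := exists_germ P (φ y) ξ
    rw [stalkMap_germ] at hξ
    obtain ⟨W, hW, hWV, hWU, e⟩ := germ_eq Q _ _ _ _ hξ
    have hWV' : (⟨_, hφ.isOpenMap _ W.2⟩ : Opens X) ≤ V := by
      rintro _ ⟨z, hz, rfl⟩; exact hWV hz
    have hWU' : (⟨_, hφ.isOpenMap _ W.2⟩ : Opens X) ≤ U := by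
      rintro _ ⟨z, hz, rfl⟩; exact hWU hz
    have hW' : (Opens.map φ).obj ⟨_, hφ.isOpenMap _ W.2⟩ ≤ W := by
      rintro z ⟨z', hz', e⟩
      exact hφ.injective e ▸ hz'
    refine ⟨⟨_, hφ.isOpenMap _ W.2⟩, ⟨y, hW, rfl⟩, hWU', res P hWV' s, ?_⟩
    have := congrArg (res Q hW') e
    rw [res_res, res_res] at this
    rw [comap_res]
    exact this
  choose V hV hVU s hs using hloc
  obtain ⟨r, hr, -⟩ := TopCat.Sheaf.existsUnique_gluing' (C := Type u)
    ⟨P ⋙ forget CRing.{u}, hP⟩ V U (fun y => homOfLE (hVU y))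
    (fun x hx => by
      obtain ⟨y, rfl⟩ := hφ.surjective x
      exact Opens.mem_iSup.2 ⟨⟨y, hx⟩, hV _⟩) s (fun i j => by
      refine hinj (V i ⊓ V j) ?_
      have e1 := comap_res φ η (inf_le_left : V i ⊓ V j ≤ V i) (s i)
      have e2 := comap_res φ η (inf_le_right : V i ⊓ V j ≤ V j) (s j)
      rw [hs, res_res] at e1 e2
      exact e1.trans e2.symm)
  refine ⟨r, sec_ext hQ fun y hy => ?_⟩
  have e : res P (hVU ⟨y, hy⟩) r = s ⟨y, hy⟩ := hr ⟨y, hy⟩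
  have e' := comap_res φ η (hVU ⟨y, hy⟩) r
  rw [e, hs] at e'
  have := congrArg (germ Q (mem_preimage φ (hV ⟨y, hy⟩))) e'
  rw [germ_res, germ_res] at this
  exact this.symm

namespace IsLocalizedCInftySpace

variable {Y : PresheafedSpace SCRing.{u}} (hY : IsLocalizedCInftySpace Y)

/-- The morphism from a localized simplicial `C^∞`-space to the spectrum of its global sections. -/
noncomputable def toSpec : Y ⟶ (Y.presheaf.obj (op ⊤)).spec := hY.lift (𝟙 _)

theorem isHomeomorph_toSpec : IsHomeomorph hY.toSpec.base := by
  have : ⇑hY.toSpec.base = hY.pt := funext fun y => SCRing.piZero_hom_ext fun a =>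
    congrArg (Sp.eval (hY.pt y)) (SCRing.piZeroMap_quot (𝟙 _) a)
  rw [this]
  exact hY.isHomeomorph_pt

theorem stalkMap_toSpec (y : Y.carrier) {k : ℕ} (a : (Y.presheaf.obj (op ⊤)).lev k) :
    stalkMap hY.toSpec.base (levelMap hY.toSpec.c (op (SimplexCategory.mk k))) y
      (SCRing.spGerm (hY.toSpec.base y) k a) = gg Y.presheaf y k a :=
  (stalkMap_spGerm hY.toSpec y a).trans
    (congrArg (fun f => gg Y.presheaf y k (SCRing.lmap f k a)) (hY.transpose_lift (𝟙 _)))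

/-- Injectivity: global simplices with equal germs at `y` agree after multiplication with some `c`,
`c(y) ≠ 0`, which is equality of germs on the spectrum. Surjectivity: every germ on `Y` extends to a
global simplex. -/
theorem stalkMap_toSpec_bijective (y : Y.carrier) (k : ℕ) : Function.Bijective
    (stalkMap hY.toSpec.base (levelMap hY.toSpec.c (op (SimplexCategory.mk k))) y) := by
  constructor
  · intro ξ ζ h
    obtain ⟨a, rfl⟩ := SCRing.spGerm_surjective (A := Y.presheaf.obj (op ⊤)) (k := k) ξ
    obtain ⟨b, rfl⟩ := SCRing.spGerm_surjective (A := Y.presheaf.obj (op ⊤)) (k := k) ζ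
    have h' := (hY.stalkMap_toSpec y a).symm.trans (h.trans (hY.stalkMap_toSpec y b))
    obtain ⟨c, hc, e⟩ := hY.exists_smul_eq_zero (a - b) ((map_sub _ _ _).trans (sub_eq_zero.2 h'))
    refine SCRing.spGerm_eq_iff.2 ⟨c, ?_, ?_⟩
    · exact (hY.value_liftBase (𝟙 _) y c).trans_ne hc
    · rwa [mul_sub, sub_eq_zero] at e
  · intro ξ
    obtain ⟨W, hW, s, rfl⟩ := exists_gm (O := Y.presheaf) (k := k) ξ
    obtain ⟨t, V, hV, hVW, ht⟩ := hY.exists_extension hW s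
    exact ⟨_, (hY.stalkMap_toSpec y t).trans (ht y hV)⟩

theorem isIso_toSpec : IsIso hY.toSpec := by
  have hb : IsIso hY.toSpec.base :=
    (TopCat.isoOfHomeo (hY.isHomeomorph_toSpec.homeomorph _)).isIso_hom
  have hc : ∀ U, IsIso (hY.toSpec.c.app U) := fun U => SCRing.isIso_of_bijective _ fun k =>
    comap_bijective (sheafify_isSheaf _) (hY.isSheaf k) hY.isHomeomorph_toSpec
      (fun y => hY.stalkMap_toSpec_bijective y k.unop.len) U.unop
  have := NatIso.isIso_of_isIso_app hY.toSpec.c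
  exact PresheafedSpace.isIso_of_components _

end IsLocalizedCInftySpace

theorem isIso_unit_adjunction
    (hΓ : ∀ X : LocalizedSpace.{u}, SCRing.IsGeometric (PresheafedSpace.Γ.obj (op X.obj)))
    (hSp : ∀ A : GeometricRing.{u}, IsLocalizedCInftySpace (SCRing.spectrum.obj (op A.obj))) :
    IsIso (adjunction hΓ hSp).unit := by
  have : ∀ Y, IsIso ((adjunction hΓ hSp).unit.app Y) := fun Y => by
    refine (ObjectProperty.isIso_hom_iff _).1 ?_
    rw [unit_adjunction]
    exact Y.property.isIso_toSpec
  exact NatIso.isIso_of_isIso_app _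

end CInfty

namespace CInfty

/-! ### Normalization of cycles and boundaries -/

/-- The underlying abelian group of a `C^∞`-ring. -/
def CRing.toAb : CRing.{u} ⥤ AddCommGrpCat.{u} where
  obj A := AddCommGrpCat.of A
  map f := AddCommGrpCat.ofHom (f.hom.toRingHom : _ →+ _)

namespace SCRing

variable {A B : SCRing.{u}}

/-- The alternating sum of the faces. -/
def bd (A : SCRing.{u}) (k : ℕ) : A.lev (k + 1) →+ A.lev k where
  toFun x := ∑ i : Fin (k + 2), (-1) ^ (i : ℕ) * A.d i x
  map_zero' := by simp
  map_add' x y := by simp only [map_add, mul_add, Finset.sum_add_distrib]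

theorem bd_apply {k : ℕ} (x : A.lev (k + 1)) :
    A.bd k x = ∑ i : Fin (k + 2), (-1) ^ (i : ℕ) * A.d i x := rfl

theorem moore_eq_bd {k : ℕ} (x : A.lev (k + 1)) : A.moore k x = A.bd k x := A.moore_apply k x

theorem bd_bd {k : ℕ} (x : A.lev (k + 2)) : A.bd k (A.bd (k + 1) x) = 0 := by
  -- The identity is that of the alternating face map complex of the underlying simplicial abelian
  -- group.
  let X := ((SimplicialObject.whiskering _ _).obj CRing.toAb).obj A
  have key : ∀ (k : ℕ) (x : A.lev (k + 1)),
      (AlgebraicTopology.AlternatingFaceMapComplex.objD X k).hom x = A.bd k x := fun k x => by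
    let e : (X.obj (op (SimplexCategory.mk (k + 1))) ⟶ X.obj (op (SimplexCategory.mk k))) →+
        A.lev k := ⟨⟨fun f => f.hom x, rfl⟩, fun _ _ => rfl⟩
    refine (map_sum e _ _).trans (Finset.sum_congr rfl fun i _ => ?_)
    refine (map_zsmul e _ _).trans ((zsmul_eq_mul _ _).trans ?_)
    push_cast
    rfl
  rw [← key, ← key]
  exact congrArg (fun f => AddCommGrpCat.Hom.hom f x)
    (AlgebraicTopology.AlternatingFaceMapComplex.d_squared X k)

theorem d_s_self {k : ℕ} (j : Fin (k + 1)) (x : A.lev k) : A.d j.castSucc (A.s j x) = x := by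
  rw [d, s, str_str, SimplexCategory.δ_comp_σ_self, str_id]

theorem d_s_succ {k : ℕ} (j : Fin (k + 1)) (x : A.lev k) : A.d j.succ (A.s j x) = x := by
  rw [d, s, str_str, SimplexCategory.δ_comp_σ_succ, str_id]

theorem d_s_of_le {k : ℕ} {i : Fin (k + 2)} {j : Fin (k + 1)} (h : i ≤ j.castSucc)
    (x : A.lev (k + 1)) : A.d i.castSucc (A.s j.succ x) = A.s j (A.d i x) := by
  rw [d, s, str_str, SimplexCategory.δ_comp_σ_of_le h, ← str_str]

theorem d_s_of_gt {k : ℕ} {i : Fin (k + 2)} {j : Fin (k + 1)} (h : j.castSucc < i)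
    (x : A.lev (k + 1)) : A.d i.succ (A.s j.castSucc x) = A.s j (A.d i x) := by
  rw [d, s, str_str, SimplexCategory.δ_comp_σ_of_gt h, ← str_str]

theorem d_d {k : ℕ} {i j : Fin (k + 2)} (h : i ≤ j) (x : A.lev (k + 2)) :
    A.d i (A.d j.succ x) = A.d j (A.d i.castSucc x) := by
  rw [d, d, str_str, SimplexCategory.δ_comp_δ h, ← str_str]

theorem d_s_eq_zero_of_lt {k : ℕ} {i j : Fin (k + 2)} (h : i < j) {x : A.lev (k + 1)}
    (hx : A.d i x = 0) : A.d i.castSucc (A.s j x) = 0 := by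
  obtain ⟨j, rfl⟩ := Fin.exists_succ_eq.2 (Fin.ne_zero_of_lt h)
  rw [d_s_of_le (Fin.le_castSucc_iff.2 h), hx, map_zero]

theorem d_s_eq_zero_of_gt {k : ℕ} {i j : Fin (k + 2)} (h : j < i) {x : A.lev (k + 1)}
    (hx : A.d i x = 0) : A.d i.succ (A.s j x) = 0 := by
  obtain ⟨j, rfl⟩ := Fin.exists_castSucc_eq.2 (Fin.ne_last_of_lt h)
  rw [d_s_of_gt h, hx, map_zero]

/-- Only the face `j` is split off. The term `l = j` of the sum is the face `j + 1`, which cancels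
it below. -/
theorem bd_s_eq {k : ℕ} (j : Fin (k + 2)) (x : A.lev (k + 1)) :
    A.bd (k + 1) (A.s j x) = (-1) ^ (j : ℕ) * x + ∑ l : Fin (k + 2),
      if l < j then (-1) ^ (l : ℕ) * A.d l.castSucc (A.s j x)
      else -((-1) ^ (l : ℕ) * A.d l.succ (A.s j x)) := by
  rw [bd_apply, Fin.sum_univ_succAbove _ j.castSucc, d_s_self, Fin.val_castSucc]
  refine congrArg _ (Finset.sum_congr rfl fun l _ => ?_)
  split_ifs with h
  · rw [Fin.succAbove_of_castSucc_lt _ _ (Fin.castSucc_lt_castSucc_iff.2 h), Fin.val_castSucc]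
  · rw [Fin.succAbove_of_le_castSucc _ _ (Fin.castSucc_le_castSucc_iff.2 (not_lt.1 h)),
      Fin.val_succ, pow_succ]
    ring

theorem bd_s_of_d_eq_zero {k : ℕ} (j : Fin (k + 2)) {x : A.lev (k + 1)} (hx : ∀ i, A.d i x = 0) :
    A.bd (k + 1) (A.s j x) = 0 := by
  rw [bd_s_eq, Finset.sum_eq_single j]
  · rw [if_neg (lt_irrefl _), d_s_succ, add_neg_cancel]
  · intro l _ hl
    split_ifs with h
    · rw [d_s_eq_zero_of_lt h (hx l), mul_zero]
    · rw [d_s_eq_zero_of_gt (lt_of_le_of_ne (not_lt.1 h) hl.symm) (hx l), mul_zero, neg_zero]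
  · simp

/-- After the faces `j` and `j + 1` cancel, the faces `l + 1` with `l > j` give `-s_j bd x` up to
its missing term for `l = j`. For a cycle `x`, therefore, `s_j d_j x` is a boundary up to sign,
which permits the removal of one face at a time. -/
theorem bd_s {k : ℕ} (j : Fin (k + 1)) {x : A.lev (k + 1)}
    (hx : ∀ i : Fin (k + 2), (i : ℕ) < j → A.d i x = 0) :
    A.bd (k + 1) (A.s j.castSucc x) =
      (-1) ^ (j : ℕ) * A.s j (A.d j.castSucc x) - A.s j (A.bd k x) := by
  have h1 : A.s j (A.bd k x) = ∑ l : Fin (k + 2), (-1) ^ (l : ℕ) * A.s j (A.d l x) := by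
    rw [bd_apply, map_sum]
    simp only [map_mul, map_pow, map_neg, map_one]
  rw [bd_s_eq, h1, ← Finset.add_sum_erase _ _ (Finset.mem_univ j.castSucc),
    ← Finset.add_sum_erase _ (fun l : Fin (k + 2) => (-1) ^ (l : ℕ) * A.s j (A.d l x))
      (Finset.mem_univ j.castSucc), if_neg (lt_irrefl _), d_s_succ, Fin.val_castSucc,
    add_neg_cancel_left, sub_add_cancel_left, ← Finset.sum_neg_distrib]
  refine Finset.sum_congr rfl fun l hl => ?_
  split_ifs with h
  · rw [d_s_eq_zero_of_lt h (hx l h), hx l h, map_zero, mul_zero, neg_zero]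
  · rw [d_s_of_gt (lt_of_le_of_ne (not_lt.1 h) (Finset.ne_of_mem_erase hl).symm)]

/-- One round of normalization: subtracting `s_j d_j x` kills the face `j`, and the simplicial
identities keep the lower faces zero. -/
theorem d_sub_s_d {k : ℕ} {j : Fin (k + 1)} {x : A.lev (k + 1)}
    (hx : ∀ i : Fin (k + 2), (i : ℕ) < j → A.d i x = 0) (i : Fin (k + 2)) (hi : (i : ℕ) < j + 1) :
    A.d i (x - A.s j (A.d j.castSucc x)) = 0 := by
  rcases Nat.lt_succ_iff_lt_or_eq.1 hi with h | h
  · rw [map_sub, hx i h, zero_sub, neg_eq_zero]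
    cases k with
    | zero => exact absurd h (by have := j.2; omega)
    | succ k =>
      obtain ⟨i, rfl⟩ : ∃ i', Fin.castSucc i' = i :=
        ⟨⟨i, by have := j.2; omega⟩, rfl⟩
      refine d_s_eq_zero_of_lt h ?_
      obtain ⟨j, rfl⟩ := Fin.exists_succ_eq.2 (Fin.ne_zero_of_lt (show i < j from h))
      rw [← Fin.succ_castSucc, d_d (Fin.le_castSucc_iff.2 h), hx _ h, map_zero]
  · obtain rfl : i = j.castSucc := Fin.ext h
    rw [map_sub, d_s_self, sub_self]

theorem bd_eq_last {k : ℕ} {x : A.lev (k + 1)}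
    (hx : ∀ i : Fin (k + 2), (i : ℕ) < k + 1 → A.d i x = 0) :
    A.bd k x = (-1) ^ (k + 1) * A.d (Fin.last (k + 1)) x := by
  rw [bd_apply, Fin.sum_univ_castSucc, Finset.sum_eq_zero, zero_add, Fin.val_last]
  intro i _
  rw [hx i.castSucc i.2, mul_zero]

/-- Boundaries with trivial faces bound simplices with trivial faces. -/
theorem exists_normalized_boundary {k : ℕ} (w : A.lev (k + 2))
    (hw : ∀ i, A.d i (A.bd (k + 1) w) = 0) : ∃ w', A.bd (k + 1) w' = A.bd (k + 1) w ∧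
      ∀ i : Fin (k + 3), (i : ℕ) < k + 2 → A.d i w' = 0 := by
  suffices H : ∀ j ≤ k + 2, ∃ w', A.bd (k + 1) w' = A.bd (k + 1) w ∧
      ∀ i : Fin (k + 3), (i : ℕ) < j → A.d i w' = 0 from H _ le_rfl
  intro j
  induction j with
  | zero => exact fun _ => ⟨w, rfl, fun i hi => absurd hi (Nat.not_lt_zero _)⟩
  | succ j ih =>
    intro hj
    obtain ⟨w', e, h⟩ := ih (Nat.le_of_succ_le hj)
    let j' : Fin (k + 2) := ⟨j, hj⟩
    refine ⟨w' - A.s j' (A.d j'.castSucc w'), ?_, d_sub_s_d (j := j') h⟩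
    -- Since `bd w'` has zero faces, its degeneracy is a cycle. Taking the boundary of `bd_s` thus
    -- shows that the subtracted term `s_j d_j w'` is a cycle too, so the boundary does not change.
    have h1 := congrArg (A.bd (k + 1)) (bd_s j' h)
    rw [bd_bd, map_sub, e, bd_s_of_d_eq_zero j' hw, sub_zero] at h1
    have h2 : ((-1) ^ (j' : ℕ) * A.s j' (A.d j'.castSucc w') : A.lev (k + 2)) =
        ((-1) ^ (j' : ℕ) : ℤ) • A.s j' (A.d j'.castSucc w') := by
      rw [zsmul_eq_mul]; push_cast; rfl
    rw [h2, map_zsmul, eq_comm, ((isUnit_neg_one (α := ℤ)).pow _).smul_eq_zero] at h1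
    rw [map_sub, h1, sub_zero, e]

/-- Every cycle is homologous to one with trivial faces. -/
theorem exists_normalized_cycle {k : ℕ} (z : A.lev (k + 1)) (hz : A.bd k z = 0) :
    ∃ z' w, (∀ i, A.d i z' = 0) ∧ A.bd (k + 1) w = z - z' := by
  have H : ∀ j ≤ k + 1, ∃ z' w, A.bd (k + 1) w = z - z' ∧
      ∀ i : Fin (k + 2), (i : ℕ) < j → A.d i z' = 0 := by
    intro j
    induction j with
    | zero => exact fun _ => ⟨z, 0, by rw [map_zero, sub_self], fun i hi => absurd hi (Nat.not_lt_zero _)⟩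
    | succ j ih =>
      intro hj
      obtain ⟨z', w, e, h⟩ := ih (Nat.le_of_succ_le hj)
      let j' : Fin (k + 1) := ⟨j, hj⟩
      have hz' : A.bd k z' = 0 := by
        have := congrArg (A.bd k) e
        rwa [bd_bd, map_sub, hz, zero_sub, eq_comm, neg_eq_zero] at this
      refine ⟨z' - A.s j' (A.d j'.castSucc z'), w + ((-1) ^ j : ℤ) • A.s j'.castSucc z', ?_,
        d_sub_s_d (j := j') h⟩
      rw [map_add, e, map_zsmul, bd_s j' h, hz', map_zero, sub_zero, zsmul_eq_mul]
      push_cast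
      rw [← mul_assoc, ← pow_add, Even.neg_one_pow ⟨_, rfl⟩, one_mul]
      ring
  obtain ⟨z', w, e, h⟩ := H _ le_rfl
  refine ⟨z', w, fun i => ?_, e⟩
  -- The rounds kill all faces but the last. The last one is, up to sign, the whole boundary, which
  -- is zero.
  rcases lt_or_eq_of_le (Nat.lt_succ_iff.1 i.2) with hi | hi
  · exact h i hi
  · obtain rfl : i = Fin.last (k + 1) := Fin.ext hi
    have := congrArg (A.bd k) e
    rw [bd_bd, map_sub, hz, zero_sub, eq_comm, neg_eq_zero, bd_eq_last h] at this
    exact ((isUnit_one.neg.pow _).mul_right_eq_zero).1 this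

end SCRing

end CInfty

namespace CInfty

/-! ### Homotopy groups of simplicial `C^∞`-rings -/

namespace SCRing

variable {A B : SCRing.{u}}

section Spheres

variable {k : ℕ} {v : A.lev 0}

theorem Sphere.d_eq (x : Sphere A.sset (k + 1) v) (i : Fin (k + 2)) :
    A.d i (show A.lev (k + 1) from x.1) = A.deg k v := x.2 k (SimplexCategory.δ i) (Nat.lt_succ_self k)

/-- A simplex all of whose faces are constant. -/
def Sphere.mk (x : A.lev (k + 1)) (hx : ∀ i, A.d i x = A.deg k v) : Sphere A.sset (k + 1) v :=
  ⟨x, fun m θ hm => by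
    obtain ⟨i, θ', rfl⟩ := SimplexCategory.eq_comp_δ_of_not_surjective θ fun hs => by
      have h := Fintype.card_le_of_surjective (α := Fin (m + 1)) (β := Fin (k + 1 + 1)) _ hs
      simp only [Fintype.card_fin] at h
      omega
    change A.str (θ' ≫ SimplexCategory.δ i) x = A.deg m v
    rw [← str_str]
    exact (congrArg (A.str θ') (hx i)).trans (A.str_deg θ' v)⟩

/-- The simplex `x` translated to the base point `0`. -/
def Sphere.translate (x : Sphere A.sset (k + 1) v) : A.lev (k + 1) :=
  (show A.lev (k + 1) from x.1) - A.deg (k + 1) v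

theorem Sphere.d_translate (x : Sphere A.sset (k + 1) v) (i : Fin (k + 2)) :
    A.d i (Sphere.translate x) = 0 := by
  refine (map_sub (A.d i) _ _).trans (sub_eq_zero.2 ((Sphere.d_eq x i).trans ?_))
  exact (A.str_deg _ v).symm

theorem bd_eq_zero_of_d {x : A.lev (k + 1)} (hx : ∀ i, A.d i x = 0) : A.bd k x = 0 := by
  rw [bd_apply]
  exact Finset.sum_eq_zero fun i _ => by rw [hx, mul_zero]

/-- The cycle given by a simplex with constant faces. -/
def Sphere.cycle (x : Sphere A.sset (k + 1) v) : LinearMap.ker (A.moore k) :=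
  ⟨Sphere.translate x, (moore_eq_bd _).trans (bd_eq_zero_of_d (Sphere.d_translate x))⟩

theorem cls_eq_iff {z z' : LinearMap.ker (A.moore k)} : A.cls k z = A.cls k z' ↔
    ∃ w : A.lev (k + 2), A.bd (k + 1) w = (show A.lev (k + 1) from z.1) - (show A.lev (k + 1) from z'.1) := by
  rw [← sub_eq_zero, ← map_sub, cls_eq_zero]
  exact exists_congr fun w => ⟨fun h => (moore_eq_bd w).symm.trans h, fun h => (moore_eq_bd w).trans h⟩

/-- An alternating sum all of whose terms but the last two vanish. -/
theorem bd_eq_of_d_eq_zero {w : A.lev (k + 2)}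
    (hw : ∀ i : Fin (k + 3), (i : ℕ) < k + 1 → A.d i w = 0) :
    A.bd (k + 1) w = (-1) ^ (k + 1) *
      (A.d (Fin.last (k + 1)).castSucc w - A.d (Fin.last (k + 2)) w) := by
  rw [bd_apply, Fin.sum_univ_castSucc, Fin.sum_univ_castSucc, Finset.sum_eq_zero, zero_add,
    Fin.val_last, Fin.val_castSucc, Fin.val_last, pow_succ]
  · ring
  · intro i _
    rw [hw i.castSucc.castSucc i.2, mul_zero]

/-- A homotopy, translated to the base point `0`, has the difference of its last two faces as
boundary, up to sign. Conversely, the bounding simplex can be normalized so that only its last face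
survives; adding the last degeneracy of `x` then makes the last two faces `x` and `y`. -/
theorem Sphere.homotopic_iff (x y : Sphere A.sset (k + 1) v) :
    Sphere.Homotopic x y ↔ A.cls k (Sphere.cycle x) = A.cls k (Sphere.cycle y) := by
  rw [cls_eq_iff]
  constructor
  · rintro ⟨(w : A.lev (k + 2)), h, hx, hy⟩
    have hd : ∀ i, A.d i (A.deg (k + 2) v) = A.deg (k + 1) v := fun i => A.str_deg _ v
    refine ⟨((-1) ^ (k + 1) : ℤ) • (w - A.deg (k + 2) v), ?_⟩
    rw [map_zsmul, bd_eq_of_d_eq_zero fun i hi => ?_, zsmul_eq_mul]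
    · push_cast
      rw [← mul_assoc, ← pow_add, Even.neg_one_pow ⟨_, rfl⟩, one_mul, map_sub, map_sub, hd, hd]
      exact congrArg₂ (· - ·) (congrArg (· - _) hx) (congrArg (· - _) hy)
    · rw [map_sub, hd, sub_eq_zero]
      exact h i hi
  · rintro ⟨w, hw⟩
    obtain ⟨w', e, hw'⟩ := exists_normalized_boundary w fun i => by
      rw [hw]
      refine (map_sub (A.d i) (Sphere.translate x) (Sphere.translate y)).trans ?_
      rw [Sphere.d_translate, Sphere.d_translate, sub_zero]
    rw [hw, bd_eq_last hw'] at e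
    let t : A.lev (k + 1) := Sphere.translate x
    have ht : ∀ i, A.d i t = 0 := Sphere.d_translate x
    have hl : A.d (Fin.last (k + 2)) (((-1) ^ (k + 1) : ℤ) • w') =
        Sphere.translate y - Sphere.translate x := by
      rw [map_zsmul, zsmul_eq_mul]
      push_cast
      have := congrArg (-·) e
      rw [pow_succ] at this
      refine Eq.trans ?_ (this.trans (neg_sub _ _))
      ring
    have hs : ∀ i : Fin (k + 3), (i : ℕ) < k + 2 →
        A.d i (((-1) ^ (k + 1) : ℤ) • w') = 0 := fun i hi => by
      rw [map_zsmul, hw' i hi, smul_zero]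
    refine ⟨(((-1) ^ (k + 1) : ℤ) • w' + A.s (Fin.last (k + 1)) (show A.lev (k + 1) from x.1) :
      A.lev (k + 2)), fun i hi => ?_, ?_, ?_⟩
    · refine (map_add (A.d i) _ _).trans ?_
      rw [hs i (Nat.lt_succ_of_lt hi), zero_add]
      have h0 : (show A.lev (k + 1) from x.1) = t + A.deg (k + 1) v := (sub_add_cancel _ _).symm
      rw [h0, map_add, map_add]
      obtain ⟨i, rfl⟩ : ∃ i', Fin.castSucc i' = i := ⟨⟨i, by omega⟩, rfl⟩
      rw [d_s_eq_zero_of_lt (show i < Fin.last (k + 1) from hi) (ht i), zero_add]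
      exact (congrArg _ (A.str_deg _ v)).trans (A.str_deg _ v)
    · refine (map_add (A.d _) _ _).trans ?_
      rw [hs _ (by simp), zero_add, d_s_self]
    · refine (map_add (A.d _) _ _).trans ?_
      rw [hl, ← Fin.succ_last, d_s_succ]
      change ((show A.lev (k + 1) from y.1) - _) - ((show A.lev (k + 1) from x.1) - _) +
        (show A.lev (k + 1) from x.1) = (show A.lev (k + 1) from y.1)
      ring

variable (v k) in
/-- The comparison of homotopy groups with the homology of the Moore complex. -/
noncomputable def homotopyToPi : HomotopyGroup A.sset (k + 1) v → A.PiSucc k :=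
  Quot.lift (fun x => A.cls k (Sphere.cycle x)) fun x y => (Sphere.homotopic_iff x y).1

theorem homotopyToPi_bijective : Function.Bijective (homotopyToPi (A := A) k v) := by
  constructor
  · rintro ⟨x⟩ ⟨y⟩ h
    exact Quot.sound ((Sphere.homotopic_iff x y).2 h)
  · intro m
    obtain ⟨z, rfl⟩ := cls_surjective k m
    obtain ⟨z', w, h, hw⟩ := exists_normalized_cycle (show A.lev (k + 1) from z.1)
      ((moore_eq_bd _).symm.trans z.2)
    refine ⟨Quot.mk _ (Sphere.mk (v := v) (z' + A.deg (k + 1) v) fun i => ?_), ?_⟩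
    · rw [map_add, h, zero_add]
      exact A.str_deg _ v
    · refine (cls_eq_iff.2 ⟨w, hw.trans (congrArg _ ?_)⟩).symm
      exact (add_sub_cancel_right z' (A.deg (k + 1) v)).symm

end Spheres

theorem homotopyToPi_map (f : A ⟶ B) (k : ℕ) (v : A.lev 0) (x : HomotopyGroup A.sset (k + 1) v) :
    homotopyToPi (A := B) k (lmap f 0 v) (HomotopyGroup.map (ssetMap f) (k + 1) v x) =
      piMap f k (homotopyToPi k v x) := by
  induction x using Quot.ind with
  | mk x =>
    refine congrArg (B.cls k) (Subtype.ext ?_)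
    refine Eq.trans ?_ (map_sub (lmap f (k + 1)) _ _).symm
    exact congrArg (_ - ·) (lmap_str f _ v).symm

/-- The comparison of the set of components with the ring `π₀`. -/
noncomputable def homotopyToPiZero (v : A.lev 0) : HomotopyGroup A.sset 0 v → A.PiZero :=
  Quot.lift (fun x => A.quot (show A.lev 0 from x.1)) fun _ _ ⟨w, _, hx, hy⟩ =>
    A.quot_eq.2 ⟨w, congrArg₂ (· - ·) hx hy⟩

theorem homotopyToPiZero_bijective (v : A.lev 0) :
    Function.Bijective (homotopyToPiZero (A := A) v) := by
  constructor
  · rintro ⟨x⟩ ⟨y⟩ h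
    obtain ⟨w, hx, hy⟩ := A.exists_faces (A.quot_eq.1 h)
    exact Quot.sound ⟨w, fun i hi => absurd hi (Nat.not_lt_zero _), hx, hy⟩
  · intro m
    obtain ⟨a, rfl⟩ := A.quot_surjective m
    exact ⟨Quot.mk _ ⟨a, fun m _ hm => absurd hm (Nat.not_lt_zero _)⟩, rfl⟩

theorem homotopyToPiZero_map (f : A ⟶ B) (v : A.lev 0) (x : HomotopyGroup A.sset 0 v) :
    homotopyToPiZero (A := B) (lmap f 0 v) (HomotopyGroup.map (ssetMap f) 0 v x) =
      piZeroMap f (homotopyToPiZero v x) := by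
  induction x using Quot.ind with
  | mk x => exact (piZeroMap_quot f _).symm

/-- A morphism that is bijective on `π₀` and on the homology of the Moore complexes is a weak
equivalence. -/
theorem isWeakEquivalence_of_bijective (f : A ⟶ B) (h0 : Function.Bijective (piZeroMap f))
    (h : ∀ k, Function.Bijective (piMap f k)) : IsWeakEquivalence f := by
  intro n v
  cases n with
  | zero =>
    refine (Function.Bijective.of_comp_iff' (homotopyToPiZero_bijective (A := B) (lmap f 0 v)) _).1 ?_
    exact (congrArg Function.Bijective (funext (homotopyToPiZero_map f v))).mpr
      (h0.comp (homotopyToPiZero_bijective _))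
  | succ k =>
    refine (Function.Bijective.of_comp_iff' (homotopyToPi_bijective (A := B) (v := lmap f 0 v)) _).1 ?_
    exact (congrArg Function.Bijective (funext (homotopyToPi_map f k v))).mpr
      ((h k).comp homotopyToPi_bijective)

end SCRing

end CInfty

namespace CInfty

open Topology Filter AlgebraicGeometry

/-! ### The counit -/

namespace SCRing

variable {A : SCRing.{u}}

open IsLocalizedCInftySpace

theorem IsGeometric.isFinitelyGenerated (hA : A.IsGeometric) : IsFinitelyGenerated A.PiZero := by
  obtain ⟨n, φ, hφ, -⟩ := hA.1
  exact ⟨n, φ, hφ⟩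

/-- At every `q ∈ ℝⁿ` some multiple `h f` with `h(q) ≠ 0` lies in the kernel: for `q` in the
spectrum because the germ there vanishes, elsewhere because some element of the kernel does not
vanish at `q`. Dividing by `h` near `q` gives an element of the kernel with the germ of `f`, so germ
determination applies. -/
theorem toPiZeroSheaf_injective (hA : IsGermDetermined A.PiZero) :
    Function.Injective A.toPiZeroSheaf := by
  obtain ⟨n, φ, hφ, hI⟩ := hA
  refine (injective_iff_map_eq_zero A.toPiZeroSheaf).2 fun b hb => ?_
  obtain ⟨f, rfl⟩ := hφ b
  by_contra hne
  obtain ⟨q, hq⟩ := hI f hne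
  have key : ∃ h : SmoothFn n, h.1 q ≠ 0 ∧ φ (h * f) = 0 := by
    by_cases hz : ∀ g, φ g = 0 → g.1 q = 0
    · obtain ⟨p, rfl⟩ : ∃ p : A.spTop, Sp.chart φ p = q := Sp.exists_chart_eq hφ hz
      obtain ⟨a, ha⟩ := A.quot_surjective (φ f)
      have h1 : toF (Y := A.spec) p (spGerm p 0 a) = 0 := by
        refine (germ_toPiZeroSheaf p trivial a).symm.trans ?_
        rw [ha, hb]
        exact map_zero (germHom _ _)
      obtain ⟨c, hc, hca⟩ := toF_spGerm_eq_zero.1 h1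
      obtain ⟨h, hh⟩ := hφ (A.quot c)
      refine ⟨h, ?_, ?_⟩
      · refine (Sp.eval_chart φ p h).symm.trans_ne ?_
        rw [hh]
        exact hc
      · rw [map_mul, hh, ← ha, ← map_mul, ← map_zero A.quot, A.quot_eq, sub_zero]
        exact hca
    · push Not at hz
      obtain ⟨g, hg, hgq⟩ := hz
      exact ⟨g, hgq, by rw [map_mul, hg, zero_mul]⟩
  obtain ⟨h, hh, hf⟩ := key
  obtain ⟨k, hk⟩ := SmoothFn.exists_local_inv h hh
  refine hq (k * (h * f)) ?_ ?_
  · refine (map_mul φ k (h * f)).trans ?_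
    rw [hf, mul_zero]
  · filter_upwards [hk] with x hx
    have hx' : h.1 x * k.1 x = 1 := hx
    change f.1 x = k.1 x * (h.1 x * f.1 x)
    rw [← mul_assoc, mul_comm (k.1 x), hx', one_mul]

theorem toPiZeroSheaf_surjective (hA : IsFinitelyGenerated A.PiZero) :
    Function.Surjective A.toPiZeroSheaf := by
  obtain ⟨n, φ, hφ⟩ := hA
  refine Function.Surjective.of_comp (g := φ) ?_
  exact surjective_of_germ (U := ⊤) (sheafify_isSheaf _) isLocal_piZero_stalk
    (A.toPiZeroSheaf.comp φ) (j := Sp.chart φ)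
    ((Sp.isClosedEmbedding_chart hφ).comp (isClosed_univ (X := A.spTop)).isClosedEmbedding_subtypeVal)
    (fun p hp => funext fun i => ev_toPiZeroSheaf p hp _) (exists_germ_toPiZeroSheaf hφ)

theorem piZeroMap_toGlobal_bijective (hA : A.IsGeometric) :
    Function.Bijective (piZeroMap A.toGlobal) :=
  (Function.Bijective.of_comp_iff' (isLocalizedCInftySpace_spec hA.isFinitelyGenerated).kappa_bijective
    _).1 ⟨toPiZeroSheaf_injective hA.1, toPiZeroSheaf_surjective hA.isFinitelyGenerated⟩

/-- The morphism to the stalk at a point of the spectrum. -/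
noncomputable abbrev toStalk (A : SCRing.{u}) (p : A.spTop) : A ⟶ stalkSC A.spec.presheaf p :=
  A.toGlobal ≫ germTop A.spec.presheaf p

/-- A simplex of the stalk bounding the cycle lifts to `A`, and the equation then holds in `A` after
multiplication with some `c`, `c(p) ≠ 0`. So the homology of the stalk detects exactly the germs in
the localized module. -/
theorem piMap_toStalk_eq_zero {k : ℕ} (p : A.spTop) (m : A.PiSucc k) :
    piMap (A.toStalk p) k m = 0 ↔ moduleGerm (A := A.PiZero) p m = 0 := by
  refine Iff.trans ?_ (moduleGerm_eq_zero (A := A) p m).symm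
  obtain ⟨z, rfl⟩ := cls_surjective k m
  constructor
  · intro h
    obtain ⟨w, hw⟩ := (cls_eq_zero _).1 h
    obtain ⟨y, rfl⟩ := spGerm_surjective (p := p) (k := k + 2) w
    have h1 : spGerm p (k + 1) (A.moore (k + 1) y) = spGerm p (k + 1) z.1 :=
      (smap_moore (A.toStalk p) (k + 1) y).trans hw
    obtain ⟨c, hc, e⟩ := spGerm_eq_iff.1 h1
    refine ⟨c, hc, ?_⟩
    rw [← map_smul]
    refine (cls_eq_zero _).2 ⟨c • show A.Simplices (k + 1 + 1) from y, ?_⟩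
    rw [map_smul]
    exact e
  · rintro ⟨a, ha, e⟩
    have := congrArg (piMap (A.toStalk p) k) e
    rw [piMap_smul, map_zero] at this
    exact (isUnit_spGerm ha).smul_eq_zero.1 this

theorem piMap_toGlobal_injective (hA : A.IsGeometric) (k : ℕ) :
    Function.Injective (piMap A.toGlobal k) := by
  refine (injective_iff_map_eq_zero (piMap A.toGlobal k)).2 fun m hm => ?_
  -- For the empty family, uniqueness of the sum says that an element is zero if all of its germs
  -- are.
  obtain ⟨s, -, hs⟩ := hA.2 k PEmpty (fun i => i.elim) fun p =>
    ⟨Set.univ, isOpen_univ, trivial, Set.toFinite _⟩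
  refine (hs m fun p => ?_).trans (hs 0 fun p => ?_).symm
  · rw [finsum_of_isEmpty]
    refine (piMap_toStalk_eq_zero p m).1 ?_
    have : piMap (A.toStalk p) k m = piMap (germTop A.spec.presheaf p) k (piMap A.toGlobal k m) := by
      obtain ⟨z, rfl⟩ := cls_surjective k m
      rfl
    rw [this, hm, map_zero]
  · rw [finsum_of_isEmpty, map_zero]

/-- Cycles in the structure sheaf of the spectrum come locally from cycles. -/
theorem exists_local_cycle {k : ℕ} (z : LinearMap.ker ((A.spec.presheaf.obj (op ⊤)).moore k))
    (p : A.spTop) : ∃ (a : LinearMap.ker (A.moore k)) (W : Opens A.spTop), p ∈ W ∧ ∀ q ∈ W,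
      piMap (A.toStalk q) k (A.cls k a) = piMap (germTop A.spec.presheaf q) k
        ((A.spec.presheaf.obj (op ⊤)).cls k z) := by
  obtain ⟨a, ha⟩ := spGerm_surjective (p := p) (k := k + 1) (gg A.spec.presheaf p (k + 1) z.1)
  have h1 : spGerm p k (A.moore k a) = spGerm p k 0 := by
    refine (smap_moore (A.toStalk p) k a).trans ?_
    refine (congrArg ((stalkSC A.spec.presheaf p).moore k) ha).trans ?_
    refine (LinearMap.mem_ker.1 (kmap (germTop A.spec.presheaf p) k z).2).trans ?_
    exact (map_zero (spGerm p k)).symm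
  obtain ⟨c, hc, e⟩ := spGerm_eq_iff.1 h1
  rw [mul_zero] at e
  -- The lift `a` need not be a cycle, but `c a` is. Multiplication with `b`, an inverse of `c`
  -- wherever `u` does not vanish, restores the germs and preserves the cycle condition.
  obtain ⟨b, u, hu, hcb⟩ := exists_inv_at (A.value p) hc
  obtain ⟨W, hW, _, _, hWe⟩ := gm_eq (O := A.spec.presheaf) (U := ⊤) (V := ⊤) (x := p)
    (s := lmap A.toGlobal (k + 1) a) (t := z.1) ha
  have hca : A.moore k (b • c • show A.Simplices (k + 1) from a) = 0 := by
    rw [map_smul, map_smul, show c • A.moore k a = (0 : A.Simplices k) from e, smul_zero]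
  refine ⟨⟨_, hca⟩, W ⊓ ⟨_, isOpen_value_ne_zero u⟩, ⟨hW, hu⟩, fun q hq => ?_⟩
  rw [piMap_cls, piMap_cls]
  refine congrArg _ (Subtype.ext ?_)
  have h2 : spGerm q (k + 1) a = gg A.spec.presheaf q (k + 1) z.1 := by
    have := congrArg (gm A.spec.presheaf hq.1 (k + 1)) hWe
    exact (gm_rs _ _ _).symm.trans (this.trans (gm_rs _ _ _))
  refine Eq.trans ?_ h2
  refine spGerm_eq_iff.2 ⟨u, hq.2, ?_⟩
  change A.deg (k + 1) u * (A.deg (k + 1) b * (A.deg (k + 1) c * a)) = A.deg (k + 1) u * a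
  rw [← mul_assoc, ← mul_assoc, ← map_mul, ← map_mul, mul_assoc, mul_comm b, hcb]

theorem piMap_toGlobal_surjective (hA : A.IsGeometric) (k : ℕ) :
    Function.Surjective (piMap A.toGlobal k) := fun m' => by
  have hs := isLocalizedCInftySpace_spec hA.isFinitelyGenerated
  obtain ⟨n, φ, hφ⟩ := hA.isFinitelyGenerated
  choose x hx using fun i => A.quot_surjective (φ (SmoothFn.proj i))
  let Φ : CHom (SmoothFn n) (A.lev 0) := evalHom x
  have hΦ : ∀ f, A.quot (Φ f) = φ f := DFunLike.congr_fun (show A.quot.comp Φ = φ by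
    rw [CHom.eq_evalHom (A.quot.comp Φ), CHom.eq_evalHom φ]
    congr 1
    funext i
    rw [CHom.comp_apply, evalHom_proj, hx])
  have hval : ∀ (p : A.spTop) f, A.value p (Φ f) = f.1 (Sp.chart φ p) := fun p f =>
    (congrArg (Sp.eval (A := A.PiZero) p) (hΦ f)).trans (Sp.eval_chart φ p f)
  obtain ⟨z, rfl⟩ := cls_surjective k m'
  choose a W hW ha using fun p : (⊤ : Opens A.spTop) => exists_local_cycle z p.1
  obtain ⟨ρ, -, hρ⟩ := exists_partition (X := A.spTop) (U := ⊤) (j := Sp.chart φ)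
    ((Sp.isClosedEmbedding_chart hφ).comp
      (isClosed_univ (X := A.spTop)).isClosedEmbedding_subtypeVal) W hW
  -- Multiplied by a partition of unity, the local classes form a locally finite family in
  -- `π_{k+1}(A)`; local completeness provides its sum, the candidate preimage.
  let t : (⊤ : Opens A.spTop) → A.PiSucc k := fun i => Φ (ρ i) • A.cls k (a i)
  have hzero : ∀ (p : A.spTop) (f : SmoothFn n), f.1 =ᶠ[𝓝 (Sp.chart φ p)] 0 → ∀ m : A.PiSucc k,
      moduleGerm (A := A.PiZero) p (Φ f • m) = 0 := fun p f hf m => by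
    obtain ⟨w, hw, e⟩ := SmoothFn.exists_bump_mul_eq (f := f) (g := 0) hf
    refine (moduleGerm_eq_zero p _).2 ⟨Φ w, ?_, ?_⟩
    · exact (hval p w).trans_ne (hw.trans_ne one_ne_zero)
    · rw [smul_smul, ← map_mul, e, mul_zero, map_zero, zero_smul]
  have hloc : ∀ p : A.spTop, ∃ (V : Opens A.spTop) (S : Finset (⊤ : Opens A.spTop)), p ∈ V ∧
      (∀ i ∈ S, V ≤ W i) ∧ ∀ q ∈ V, (∀ i ∉ S, moduleGerm (A := A.PiZero) q (t i) = 0) ∧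
        (∑ i ∈ S, ρ i).1 =ᶠ[𝓝 (Sp.chart φ q)] 1 := fun p => by
    obtain ⟨V, hV, -, S, hS, h⟩ := hρ p trivial
    refine ⟨V, S, hV, hS, fun q hq => ⟨fun i hi => hzero q _ ?_ _, ?_⟩⟩
    · filter_upwards [h q hq] with r hr using hr.1 i hi
    · filter_upwards [h q hq] with r hr
      rw [SmoothFn.sum_apply, hr.2]; rfl
  obtain ⟨m, hm, -⟩ := hA.2 k _ t fun p => by
    obtain ⟨V, S, hV, -, h⟩ := hloc p
    refine ⟨V.1, V.2, hV, S.finite_toSet.subset ?_⟩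
    rintro i ⟨q, hq, hi⟩
    by_contra hiS
    exact hi ((h q hq).1 i hiS)
  refine ⟨m, sub_eq_zero.1 (hs.eq_zero_of_piMap _ fun p => ?_)⟩
  obtain ⟨V, S, hV, hS, h⟩ := hloc p
  have h1 : piMap (A.toStalk p) k (m - ∑ i ∈ S, t i) = 0 := by
    rw [piMap_toStalk_eq_zero, map_sub, map_sum]
    refine sub_eq_zero.2 ((hm p).trans (finsum_eq_sum_of_support_subset _ fun i hi => ?_))
    by_contra hiS
    exact hi ((h p hV).1 i hiS)
  -- In the stalk at `p` all classes with index in `S` have the same image, so coefficients of sum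
  -- `1` reproduce it.
  have h2 : ∑ i ∈ S, spGerm p 0 (Φ (ρ i)) = 1 := by
    rw [← map_sum, ← map_sum, ← map_one (spGerm p 0)]
    refine spGerm_eq_iff.2 ?_
    obtain ⟨w, hw, e⟩ := SmoothFn.exists_bump_mul_eq (g := 1) (h p hV).2
    refine ⟨Φ w, (hval p w).trans_ne (hw.trans_ne one_ne_zero), ?_⟩
    rw [deg_zero, ← map_mul, e, mul_one, mul_one]
  have h3 : piMap (A.toStalk p) k (∑ i ∈ S, t i) = piMap (germTop A.spec.presheaf p) k
      ((A.spec.presheaf.obj (op ⊤)).cls k z) := by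
    rw [map_sum]
    refine (Finset.sum_congr rfl fun i hi => (piMap_smul (A.toStalk p) k _ _).trans
      (congrArg (spGerm p 0 (Φ (ρ i)) • ·) (ha i p (hS i hi hV)))).trans ?_
    rw [← Finset.sum_smul, h2, one_smul]
  rw [map_sub, sub_eq_zero] at h1
  rw [map_sub, sub_eq_zero, ← h3, ← h1]
  obtain ⟨y, rfl⟩ := cls_surjective k m
  rfl

/-- A geometric simplicial `C^∞`-ring is weakly equivalent to the global sections of its
spectrum. -/
theorem isWeakEquivalence_toGlobal (hA : A.IsGeometric) : IsWeakEquivalence A.toGlobal :=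
  isWeakEquivalence_of_bijective _ (piZeroMap_toGlobal_bijective hA) fun k =>
    ⟨piMap_toGlobal_injective hA k, piMap_toGlobal_surjective hA k⟩

end SCRing

end CInfty

theorem mainTheorem2 :
    ∃ (hΓ : ∀ X : CInfty.LocalizedSpace.{u},
        CInfty.SCRing.IsGeometric (AlgebraicGeometry.PresheafedSpace.Γ.obj (op X.obj)))
      (hSp : ∀ A : CInfty.GeometricRing.{u},
        CInfty.IsLocalizedCInftySpace (CInfty.SCRing.spectrum.obj (op A.obj)))
      (adj : CInfty.globalSections hΓ ⊣ CInfty.geometricSpectrum hSp),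
      IsIso adj.unit ∧
        ∀ A : CInfty.GeometricRing.{u}ᵒᵖ,
          CInfty.SCRing.IsWeakEquivalence (adj.counit.app A).unop.hom := by
  have hΓ : ∀ X : CInfty.LocalizedSpace.{u},
      CInfty.SCRing.IsGeometric (AlgebraicGeometry.PresheafedSpace.Γ.obj (op X.obj)) :=
    fun X => X.property.isGeometric
  have hSp : ∀ A : CInfty.GeometricRing.{u},
      CInfty.IsLocalizedCInftySpace (CInfty.SCRing.spectrum.obj (op A.obj)) :=
    fun A => CInfty.SCRing.isLocalizedCInftySpace_spec A.property.isFinitelyGenerated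
  refine ⟨hΓ, hSp, CInfty.adjunction hΓ hSp, CInfty.isIso_unit_adjunction hΓ hSp, fun A => ?_⟩
  rw [CInfty.counit_adjunction]
  exact CInfty.SCRing.isWeakEquivalence_toGlobal A.unop.property
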